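/- Let $G$ be a second countable locally compact (Hausdorff) group and let $G_1,G_2\subset G$ be a matched pair: closed subgroups with $G_1\cap G_2=\{e\}$ such that $G\setminus G_1G_2$ has Haar measure zero. Let $A$ be a Polish $G$-module, i.e. a Polish abelian group with a continuous action of $G$ by automorphisms. For a standard Borel space $X$ with a measure class, $\mathrm L(X,A)$ denotes the group of Borel functions $X\to A$ modulo equality almost everywhere. *Measurable cohomology.* $H(G,A)$ is the cohomology of the complex $(\mathrm L(G^n,A))_{n\ge0}$ with $$(\mathrm dF)(g_0,\dots,g_n)=g_0\cdot F(g_1,\dots,g_n)+\sum_{i=1}^{n}(-1)^iF(g_0,\dots,g_{i-1}g_i,\dots,g_n)+(-1)^{n+1}F(g_0,\dots,g_{n-1}).$$ The same formula makes the groups $\mathcal F(G^n,A)$ of all Borel functions $G^n\to A$ a complex, and $j:\mathcal F(G^n,A)\to\mathrm L(G^n,A)$ denotes the map sending a function to its class. *The bicomplex.* For $p,q\ge0$ let $\Gamma_{pq}$ be the space of labellings $X$ of the edges of a grid with $p$ rows and $q$ columns of squares, with vertical edges $g_{ij}\in G_1$ ($1\le i\le p$, $0\le j\le q$, from vertex $(i-1,j)$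 down to $(i,j)$) and horizontal edges $s_{ij}\in G_2$ ($0\le i\le p$, $1\le j\le q$, from vertex $(i,j-1)$ right to $(i,j)$), such that $s_{i-1,j}\,g_{ij}=g_{i,j-1}\,s_{ij}$ for every square. It carries the measure class obtained from $G_1^p\times G_2^q$ through the injective map picking out the left column and the top row. Let $\partial^h_k:\Gamma_{p,q+1}\to\Gamma_{pq}$ ($0\le k\le q+1$) and $\partial^v_k:\Gamma_{p+1,q}\to\Gamma_{pq}$ ($0\le k\le p+1$) remove the $k$-th column, respectively row, of vertices, multiplying adjacent edges. Put $$(\mathrm d^hF)(X)=s_{01}\cdot F(\partial^h_0X)+\sum_{k=1}^{q+1}(-1)^kF(\partial^h_kX),\qquad(\mathrm d^vF)(X)=g_{10}\cdot F(\partial^v_0X)+\sum_{k=1}^{p+1}(-1)^kF(\partial^v_kX)$$ for $F\in\mathrm L(\Gamma_{pq},A)$, and let $D^n(A)=\bigoplus_{p+q=n}\mathrm L(\Gamma_{pq},A)$ with $\mathrm d=\mathrm d^h+(-1)^q\,\mathrm d^v$ on $\mathrm L(\Gamma_{pq},A)$. *The maps.* Define $I:\mathcal F(G^n,A)\to D^n(A)$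 by $$I(F)(X)=\sum_{\text{path in }X}\mathrm{Sign}(\text{path})\,F(\text{path})\qquad(X\in\Gamma_{pq},\ p+q=n),$$ where a path goes from the top left to the bottom right corner of $X$ in $n$ steps, each down or right, $F(\text{path})$ is the value of $F$ on the $n$ successive edges of the path, and $\mathrm{Sign}(\text{path})$ is $-1$ to the power the number of squares above the path. For almost all $(x_1,\dots,x_n)\in G^n$ there is a unique $X=X(x_1,\dots,x_n)\in\Gamma_{nn}$ whose diagonal boxes have the diagonals $x_1,\dots,x_n$, that is, $s_{k-1,k}\,g_{kk}=x_k$ for $1\le k\le n$. For $0\le i\le n$ let $P_iX\in\Gamma_{n-i,i}$ be the lower left corner of $X$, consisting of its $n-i$ final rows and $i$ first columns. Define $I':D^n(A)\to\mathrm L(G^n,A)$ by $$I'(F)(x_1,\dots,x_n)=\sum_{i=0}^n(g_{10}g_{20}\cdots g_{i0})\cdot F(P_iX),\qquad X=X(x_1,\dots,x_n),$$ with $g_{10},\dots,g_{i0}$ the first $i$ edges of the left column of $X$. **Proposition.** All face maps above, on the spaces $G^n$ and on the spaces $\Gamma_{pq}$, and all maps $P_i$ are nonsingular (they are Borel and preimages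 of null sets are null), and $(x_1,\dots,x_n)\mapsto X(x_1,\dots,x_n)$ is defined almost everywhere and is an isomorphism of measure classes $G^n\to\Gamma_{nn}$, so that everything is well defined. The groups $\mathcal F(G^n,A)$, $\mathrm L(G^n,A)$ and $D^n(A)$ form cochain complexes, and $j$, $I$ and $I'$ are cochain transformations. In every degree $n\ge0$ each of them induces an isomorphism on cohomology, and $I'_*\circ I_*=j_*$. In particular the total cohomology $H(D(A))$ of the bicomplex $(\mathrm L(\Gamma_{pq},A))_{p,q\ge0}$ is isomorphic to $H(G,A)$; when the cohomology of $(\mathcal F(G^n,A))_n$ is identified with $H(G,A)$ through $j_*$, the isomorphism is given by $I$ and its inverse by $I'$. -/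

import Mathlib

open MeasureTheory
open scoped Pointwise

set_option linter.unusedSectionVars false

noncomputable section

/-! ### Cohomology of a sequence of abelian groups -/

section Cohomology

variable {K : ℕ → Type*} [∀ n, AddCommGroup (K n)]
  {K' : ℕ → Type*} [∀ n, AddCommGroup (K' n)]

/-- `d ∘ d = 0`. -/
def IsCochainComplex (d : ∀ n, K n →+ K (n + 1)) : Prop :=
  ∀ n (x : K n), d (n + 1) (d n x) = 0

/-- The `n`-cocycles. -/
def cocycles (d : ∀ n, K n →+ K (n + 1)) (n : ℕ) : AddSubgroup (K n) := (d n).ker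

/-- The `n`-coboundaries; there is nothing in degree `-1`. -/
def coboundaries (d : ∀ n, K n →+ K (n + 1)) : ∀ n : ℕ, AddSubgroup (K n)
  | 0 => ⊥
  | n + 1 => (d n).range

/-- The `n`-th cohomology group: cocycles modulo coboundaries. -/
abbrev Cohomology (d : ∀ n, K n →+ K (n + 1)) (n : ℕ) : Type _ :=
  cocycles d n ⧸ (coboundaries d n).addSubgroupOf (cocycles d n)

/-- The class of a cocycle. -/
def cohomologyClass (d : ∀ n, K n →+ K (n + 1)) (n : ℕ) (z : cocycles d n) : Cohomology d n :=
  QuotientAddGroup.mk z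

/-- The degreewise homomorphisms `f n` form a cochain transformation. -/
def IsCochainMap (d : ∀ n, K n →+ K (n + 1)) (d' : ∀ n, K' n →+ K' (n + 1))
    (f : ∀ n, K n →+ K' n) : Prop :=
  ∀ n (x : K n), d' n (f n x) = f (n + 1) (d n x)

/-- `Φ` is the map induced by `f` on cohomology: `Φ [z] = [f z]` for every cocycle `z`. -/
def IsInducedBy (d : ∀ n, K n →+ K (n + 1)) (d' : ∀ n, K' n →+ K' (n + 1))
    (f : ∀ n, K n →+ K' n) (Φ : ∀ n, Cohomology d n ≃+ Cohomology d' n) : Prop :=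
  ∀ n (z : cocycles d n), ∃ hz : f n z ∈ cocycles d' n,
    Φ n (cohomologyClass d n z) = cohomologyClass d' n ⟨f n z, hz⟩

end Cohomology

/-! ### Borel functions and classes of Borel functions modulo null sets -/

/-- The group of Borel functions `X → A`. -/
def borelFun (X A : Type*) [MeasurableSpace X] [AddCommGroup A] [TopologicalSpace A]
    [IsTopologicalAddGroup A] [SecondCountableTopology A] [MeasurableSpace A] [BorelSpace A] :
    AddSubgroup (X → A) where
  carrier := {F | Measurable F}
  zero_mem' := measurable_const
  add_mem' := fun hF hG => Measurable.add hF hG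
  neg_mem' := fun hF => Measurable.neg hF

section Functions

variable {X Y : Type*} [MeasurableSpace X] [MeasurableSpace Y]
  {G : Type*} [Group G] [TopologicalSpace G] [IsTopologicalGroup G] [LocallyCompactSpace G]
  [T2Space G] [SecondCountableTopology G] [MeasurableSpace G] [BorelSpace G]
  {A : Type*} [AddCommGroup A] [TopologicalSpace A] [IsTopologicalAddGroup A] [PolishSpace A]
  [MeasurableSpace A] [BorelSpace A] [DistribMulAction G A] [ContinuousSMul G A]

/-- The class in `L(X, A)` of a Borel function. -/
def borelClass (μ : Measure X) : borelFun X A →+ (X →ₘ[μ] A) :=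
  AddMonoidHom.mk' (fun F => AEEqFun.mk F.1 (Measurable.aestronglyMeasurable F.2))
    (fun _ _ => rfl)

/-- `F ↦ (x ↦ c(x) · F(f x))` on Borel functions. -/
def borelPull (f : X → Y) (hf : Measurable f) (c : X → G) (hc : Measurable c) :
    borelFun Y A →+ borelFun X A :=
  AddMonoidHom.mk'
    (fun F => ⟨fun x => c x • F.1 (f x),
      (continuous_smul : Continuous fun p : G × A => p.1 • p.2).measurable.comp
        (hc.prodMk (Measurable.comp F.2 hf))⟩)
    (fun F F' => Subtype.ext (funext fun x => smul_add (c x) (F.1 (f x)) (F'.1 (f x))))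

open Classical in
/-- `F ↦ (x ↦ c(x) · F(f x))` on classes modulo null sets. This makes sense for a nonsingular
map `f` (preimages of null sets are null); for other maps we put `0`. -/
def lPull (μ : Measure X) (ν : Measure Y) (f : X → Y) (c : X → G) (hc : Measurable c) :
    (Y →ₘ[ν] A) →+ (X →ₘ[μ] A) :=
  if hf : Measure.QuasiMeasurePreserving f μ ν then
    AddMonoidHom.mk'
      (fun F => AEEqFun.mk (fun x => c x • F (f x))
        ((continuous_smul : Continuous fun p : G × A => p.1 • p.2).comp_aestronglyMeasurable
          (hc.aestronglyMeasurable.prodMk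
            (F.aestronglyMeasurable.comp_quasiMeasurePreserving hf))))
      (fun F F' => by
        rw [AEEqFun.mk_add_mk, AEEqFun.mk_eq_mk]
        filter_upwards [hf.ae_eq_comp (AEEqFun.coeFn_add F F')] with x hx
        have hx' : (F + F') (f x) = F (f x) + F' (f x) := hx
        simp only [Pi.add_apply, hx', smul_add])
  else 0

end Functions

/-! ### Face operators and the two complexes of the group `G` -/

/-- The face `∂ᵢ` on tuples `(g₀, …, gₙ)`: `∂₀` removes `g₀`, `∂ᵢ` multiplies `gᵢ₋₁` and `gᵢ` for
`1 ≤ i ≤ n`, and `∂ₙ₊₁` removes `gₙ`. -/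
def barFace {H : Type*} [Mul H] {n : ℕ} (i : Fin (n + 2)) (g : Fin (n + 1) → H) : Fin n → H :=
  Fin.cases (motive := fun _ => Fin n → H) (fun k => g k.succ)
    (fun j => Fin.contractNth j (· * ·) g) i

/-- The group element acting in the `i`-th face operator: `g₀` for `i = 0`, else the unit. -/
def faceCoeff {H : Type*} [One H] {n : ℕ} (i : Fin (n + 2)) (g : Fin (n + 1) → H) : H :=
  if i = 0 then g 0 else 1

theorem measurable_barFace {H : Type*} [Mul H] [MeasurableSpace H] [MeasurableMul₂ H] {n : ℕ}
    (i : Fin (n + 2)) : Measurable (barFace i : (Fin (n + 1) → H) → Fin n → H) := by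
  refine measurable_pi_lambda _ fun k => ?_
  refine Fin.cases ?_ (fun j => ?_) i
  · exact measurable_pi_apply _
  · simp only [barFace, Fin.cases_succ, Fin.contractNth]
    split_ifs
    · exact measurable_pi_apply _
    · exact (measurable_pi_apply _).mul (measurable_pi_apply _)
    · exact measurable_pi_apply _

theorem measurable_faceCoeff {H : Type*} [One H] [MeasurableSpace H] {n : ℕ}
    (i : Fin (n + 2)) : Measurable (faceCoeff i : (Fin (n + 1) → H) → H) := by
  unfold faceCoeff
  split_ifs
  · exact measurable_pi_apply _
  · exact measurable_const

section GroupComplexes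

variable (G : Type*) [Group G] [TopologicalSpace G] [IsTopologicalGroup G] [LocallyCompactSpace G]
  [T2Space G] [SecondCountableTopology G] [MeasurableSpace G] [BorelSpace G]
  (A : Type*) [AddCommGroup A] [TopologicalSpace A] [IsTopologicalAddGroup A] [PolishSpace A]
  [MeasurableSpace A] [BorelSpace A] [DistribMulAction G A] [ContinuousSMul G A]

/-- The product of Haar measures on `Gⁿ`. -/
def haarPow (n : ℕ) : Measure (Fin n → G) := Measure.pi fun _ => Measure.haar

/-- `L(Gⁿ, A)`. -/
abbrev LCochain (n : ℕ) : Type _ := (Fin n → G) →ₘ[haarPow G n] A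

/-- The coboundary `d = ∑ᵢ (-1)ⁱ dᵢ` on `L(Gⁿ, A)`; its cohomology is the measurable cohomology
`H(G, A)`. -/
def lCoboundary (n : ℕ) : LCochain G A n →+ LCochain G A (n + 1) :=
  ∑ i : Fin (n + 2), (-1 : ℤ) ^ (i : ℕ) •
    lPull (haarPow G (n + 1)) (haarPow G n) (barFace i) (faceCoeff i) (measurable_faceCoeff i)

/-- Borel functions `Gⁿ → A`. -/
abbrev BorelCochain (n : ℕ) : Type _ := borelFun (Fin n → G) A

/-- The same coboundary on Borel functions `Gⁿ → A`. -/
def borelCoboundary (n : ℕ) : BorelCochain G A n →+ BorelCochain G A (n + 1) :=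
  ∑ i : Fin (n + 2), (-1 : ℤ) ^ (i : ℕ) •
    borelPull (barFace i) (measurable_barFace i) (faceCoeff i) (measurable_faceCoeff i)

/-- The cochain transformation that sends a Borel function to its class. -/
def borelToL (n : ℕ) : BorelCochain G A n →+ LCochain G A n := borelClass (haarPow G n)

end GroupComplexes

/-- A second countable locally compact group is a standard Borel space. -/
theorem standardBorelSpace_group (G : Type*) [Group G] [TopologicalSpace G] [IsTopologicalGroup G]
    [LocallyCompactSpace G] [T2Space G] [SecondCountableTopology G] [MeasurableSpace G]
    [BorelSpace G] : StandardBorelSpace G := by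
  let := IsTopologicalGroup.rightUniformSpace G
  have : IsRightUniformGroup G := { uniformity_eq := rfl }
  have : CompleteSpace G := IsRightUniformGroup.completeSpace_of_weaklyLocallyCompactSpace
  have : (uniformity G).IsCountablyGenerated := Filter.comap.isCountablyGenerated _ _
  infer_instance

/-! ### Matched pairs and the spaces `Γ_pq` -/

/-- A matched pair of closed subgroups of `G`. -/
structure MatchedPair (G : Type*) [Group G] [TopologicalSpace G] [IsTopologicalGroup G]
    [LocallyCompactSpace G] [MeasurableSpace G] [BorelSpace G] where
  /-- the first subgroup -/
  G₁ : Subgroup G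
  /-- the second subgroup -/
  G₂ : Subgroup G
  isClosed₁ : IsClosed (G₁ : Set G)
  isClosed₂ : IsClosed (G₂ : Set G)
  inf_eq_bot : G₁ ⊓ G₂ = ⊥
  haar_compl : Measure.haar ((G₁ : Set G) * (G₂ : Set G))ᶜ = 0

namespace MatchedPair

variable {G : Type*} [Group G] [TopologicalSpace G] [IsTopologicalGroup G] [LocallyCompactSpace G]
  [T2Space G] [SecondCountableTopology G] [MeasurableSpace G] [BorelSpace G]
  (M : MatchedPair G)

instance : LocallyCompactSpace M.G₁ := M.isClosed₁.locallyCompactSpace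

instance : LocallyCompactSpace M.G₂ := M.isClosed₂.locallyCompactSpace

/-- `Γ_pq`: the labellings of the edges of a grid of `p` rows and `q` columns of squares, with
`X.1.1 i j ∈ G₁` the vertical edge from the vertex `(i, j)` down to `(i + 1, j)` and
`X.1.2 i j ∈ G₂` the horizontal edge from `(i, j)` right to `(i, j + 1)`, such that in every small
square right-then-down equals down-then-right. -/
abbrev Gam (p q : ℕ) : Type _ :=
  {X : (Fin p → Fin (q + 1) → M.G₁) × (Fin (p + 1) → Fin q → M.G₂) //
    ∀ (i : Fin p) (j : Fin q),
      (X.2 i.castSucc j : G) * (X.1 i j.succ : G) = (X.1 i j.castSucc : G) * (X.2 i.succ j : G)}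

variable {M}

/-- The vertical edge from `(i, j)` to `(i + 1, j)`. -/
def Gam.vert {p q : ℕ} (X : M.Gam p q) (i : Fin p) (j : Fin (q + 1)) : M.G₁ := X.1.1 i j

/-- The horizontal edge from `(i, j)` to `(i, j + 1)`. -/
def Gam.horiz {p q : ℕ} (X : M.Gam p q) (i : Fin (p + 1)) (j : Fin q) : M.G₂ := X.1.2 i j

theorem Gam.measurable_vert {p q : ℕ} (i : Fin p) (j : Fin (q + 1)) :
    Measurable fun X : M.Gam p q => X.vert i j := by
  unfold Gam.vert
  fun_prop

theorem Gam.measurable_horiz {p q : ℕ} (i : Fin (p + 1)) (j : Fin q) :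
    Measurable fun X : M.Gam p q => X.horiz i j := by
  unfold Gam.horiz
  fun_prop

variable (M)

/-- The left column and the top row of an element of `Γ_pq`. -/
def leftTop (p q : ℕ) (X : M.Gam p q) : (Fin p → M.G₁) × (Fin q → M.G₂) :=
  (fun i => X.vert i 0, fun j => X.horiz 0 j)

/-- The measure on `Γ_pq` transported from the product of Haar measures on `G₁^p × G₂^q` by the
injective map that picks out the left column and the top row. Only its measure class matters. -/
def measure (p q : ℕ) : Measure (M.Gam p q) :=
  Measure.comap (M.leftTop p q)
    ((Measure.pi fun _ : Fin p => (Measure.haar : Measure M.G₁)).prod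
      (Measure.pi fun _ : Fin q => (Measure.haar : Measure M.G₂)))

theorem unique_square {s : M.G₂} {g g' : M.G₁} {h : M.G₁} {t t' : M.G₂}
    (e : (s : G) * g = h * t) (e' : (s : G) * g' = h * t') : g = g' ∧ t = t' := by
  have e1 : (g : G)⁻¹ * g' = (t : G)⁻¹ * t' := by
    have a : (g : G) = (s : G)⁻¹ * (h * t) := by rw [← e]; group
    have b : (g' : G) = (s : G)⁻¹ * (h * t') := by rw [← e']; group
    rw [a, b]; group
  have m : (g : G)⁻¹ * g' ∈ M.G₁ ⊓ M.G₂ := by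
    refine ⟨M.G₁.mul_mem (M.G₁.inv_mem g.2) g'.2, ?_⟩
    rw [e1]
    exact M.G₂.mul_mem (M.G₂.inv_mem t.2) t'.2
  rw [M.inf_eq_bot, Subgroup.mem_bot] at m
  have m' := e1.symm.trans m
  exact ⟨Subtype.ext (inv_mul_eq_one.mp m), Subtype.ext (inv_mul_eq_one.mp m')⟩

theorem leftTop_injective (p q : ℕ) : Function.Injective (M.leftTop p q) := by
  intro X Y hXY
  have h1 : ∀ i, X.1.1 i 0 = Y.1.1 i 0 := fun i => congrFun (congrArg Prod.fst hXY) i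
  have h2 : ∀ j, X.1.2 0 j = Y.1.2 0 j := fun j => congrFun (congrArg Prod.snd hXY) j
  have step : ∀ i : Fin p, (∀ j, X.1.2 i.castSucc j = Y.1.2 i.castSucc j) →
      ∀ j, X.1.1 i j = Y.1.1 i j := by
    intro i hi j
    induction j using Fin.induction with
    | zero => exact h1 i
    | succ j ih =>
      have eY := Y.2 i j
      rw [← hi j, ← ih] at eY
      exact (M.unique_square (X.2 i j) eY).1
  have rows : ∀ i : Fin (p + 1), ∀ j, X.1.2 i j = Y.1.2 i j := by
    intro i
    induction i using Fin.induction with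
    | zero => exact h2
    | succ i ih =>
      intro j
      have eY := Y.2 i j
      rw [← ih j, ← step i ih j.castSucc] at eY
      exact (M.unique_square (X.2 i j) eY).2
  refine Subtype.ext (Prod.ext ?_ ?_)
  · funext i j
    exact step i (rows i.castSucc) j
  · funext i j
    exact rows i j

/-- So the transported measure on `Γ_pq` is the honest one. -/
theorem measurableEmbedding_leftTop (p q : ℕ) : MeasurableEmbedding (M.leftTop p q) := by
  have := standardBorelSpace_group G
  have : StandardBorelSpace M.G₁ := M.isClosed₁.measurableSet.standardBorel
  have : StandardBorelSpace M.G₂ := M.isClosed₂.measurableSet.standardBorel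
  have hm : MeasurableSet {X : (Fin p → Fin (q + 1) → M.G₁) × (Fin (p + 1) → Fin q → M.G₂) |
      ∀ (i : Fin p) (j : Fin q), (X.2 i.castSucc j : G) * (X.1 i j.succ : G)
        = (X.1 i j.castSucc : G) * (X.2 i.succ j : G)} := by
    simp only [Set.ofPred_forall]
    refine MeasurableSet.iInter fun i => MeasurableSet.iInter fun j => ?_
    exact measurableSet_eq_fun (by fun_prop) (by fun_prop)
  have : StandardBorelSpace (M.Gam p q) := hm.standardBorel
  refine Measurable.measurableEmbedding ?_ (M.leftTop_injective p q)
  exact (measurable_pi_lambda _ fun i => Gam.measurable_vert i 0).prodMk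
    (measurable_pi_lambda _ fun j => Gam.measurable_horiz 0 j)

/-! #### Faces of `Γ_pq` -/

theorem square_face {H K : Subgroup G} {n : ℕ} (k : Fin (n + 2)) (u w : Fin (n + 1) → H)
    (v : Fin (n + 2) → K) (e : ∀ j, (u j : G) * v j.succ = v j.castSucc * w j) (j : Fin n) :
    ((barFace k u j : H) : G) * v (k.succAbove j.succ)
      = v (k.succAbove j.castSucc) * ((barFace k w j : H) : G) := by
  induction k using Fin.cases with
  | zero =>
    have := e j.succ
    simpa [barFace] using this
  | succ m =>
    simp only [barFace, Fin.cases_succ]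
    rcases lt_trichotomy (j : ℕ) m with h | h | h
    · rw [Fin.contractNth_apply_of_lt _ _ _ _ h, Fin.contractNth_apply_of_lt _ _ _ _ h]
      have a : m.succ.succAbove j.succ = j.castSucc.succ := by
        rw [Fin.succAbove_of_castSucc_lt _ _ (by simp [Fin.lt_def]; omega)]; ext; simp
      have b : m.succ.succAbove j.castSucc = j.castSucc.castSucc := by
        rw [Fin.succAbove_of_castSucc_lt _ _ (by simp [Fin.lt_def]; omega)]
      rw [a, b]
      exact e j.castSucc
    · rw [Fin.contractNth_apply_of_eq _ _ _ _ h, Fin.contractNth_apply_of_eq _ _ _ _ h]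
      have a : m.succ.succAbove j.succ = j.succ.succ := by
        rw [Fin.succAbove_of_le_castSucc _ _ (by simp [Fin.le_def]; omega)]
      have b : m.succ.succAbove j.castSucc = j.castSucc.castSucc := by
        rw [Fin.succAbove_of_castSucc_lt _ _ (by simp [Fin.lt_def]; omega)]
      have e1 := e j.castSucc
      have e2 := e j.succ
      have c : (j.castSucc.succ : Fin (n + 2)) = j.succ.castSucc := by ext; simp
      rw [c] at e1
      rw [a, b, Subgroup.coe_mul, Subgroup.coe_mul, mul_assoc, e2, ← mul_assoc, e1, mul_assoc]
    · rw [Fin.contractNth_apply_of_gt _ _ _ _ h, Fin.contractNth_apply_of_gt _ _ _ _ h]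
      have a : m.succ.succAbove j.succ = j.succ.succ := by
        rw [Fin.succAbove_of_le_castSucc _ _ (by simp [Fin.le_def]; omega)]
      have b : m.succ.succAbove j.castSucc = j.succ.castSucc := by
        rw [Fin.succAbove_of_le_castSucc _ _ (by simp [Fin.le_def]; omega)]; ext; simp
      rw [a, b]
      exact e j.succ

/-- The horizontal face `∂ᵏ`: remove the `k`-th column of vertices, multiplying the adjacent
horizontal edges. -/
def hFace (p q : ℕ) (k : Fin (q + 2)) (X : M.Gam p (q + 1)) : M.Gam p q :=
  ⟨(fun i j => X.vert i (k.succAbove j), fun i => barFace k (X.horiz i)), fun i j =>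
    square_face k (X.horiz i.castSucc) (X.horiz i.succ) (X.vert i) (X.2 i) j⟩

/-- The vertical face `∂ᵏ`: remove the `k`-th row of vertices, multiplying the adjacent vertical
edges. -/
def vFace (p q : ℕ) (k : Fin (p + 2)) (X : M.Gam (p + 1) q) : M.Gam p q :=
  ⟨(fun i j => barFace k (fun a => X.vert a j) i, fun i j => X.horiz (k.succAbove i) j),
    fun i j => (square_face k (fun a => X.vert a j.castSucc) (fun a => X.vert a j.succ)
      (fun a => X.horiz a j) (fun a => (X.2 a j).symm) i).symm⟩

theorem measurable_hCoeff (p q : ℕ) (k : Fin (q + 2)) :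
    Measurable fun X : M.Gam p (q + 1) => ((faceCoeff k (X.horiz 0) : M.G₂) : G) :=
  measurable_subtype_coe.comp ((measurable_faceCoeff k).comp
    (measurable_pi_lambda _ fun j => Gam.measurable_horiz 0 j))

theorem measurable_vCoeff (p q : ℕ) (k : Fin (p + 2)) :
    Measurable fun X : M.Gam (p + 1) q => ((faceCoeff k (fun i => X.vert i 0) : M.G₁) : G) :=
  measurable_subtype_coe.comp ((measurable_faceCoeff k).comp
    (measurable_pi_lambda _ fun i => Gam.measurable_vert i 0))

/-! #### The bicomplex `L(Γ_pq, A)`, `p, q ≥ 0`, and its total complex -/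

section Bicomplex

variable (A : Type*) [AddCommGroup A] [TopologicalSpace A] [IsTopologicalAddGroup A] [PolishSpace A]
  [MeasurableSpace A] [BorelSpace A] [DistribMulAction G A] [ContinuousSMul G A]

/-- `L(Γ_pq, A)`. -/
abbrev Cochain (p q : ℕ) : Type _ := M.Gam p q →ₘ[M.measure p q] A

/-- `(dʰ F)(X) = s₀₁ · F(∂₀ X) + ∑_{k ≥ 1} (-1)ᵏ F(∂ₖ X)`. -/
def dh (p q : ℕ) : M.Cochain A p q →+ M.Cochain A p (q + 1) :=
  ∑ k : Fin (q + 2), (-1 : ℤ) ^ (k : ℕ) •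
    lPull (M.measure p (q + 1)) (M.measure p q) (M.hFace p q k)
      (fun X => ((faceCoeff k (X.horiz 0) : M.G₂) : G)) (M.measurable_hCoeff p q k)

/-- `(dᵛ F)(X) = g₁₀ · F(∂₀ X) + ∑_{k ≥ 1} (-1)ᵏ F(∂ₖ X)`. -/
def dv (p q : ℕ) : M.Cochain A p q →+ M.Cochain A (p + 1) q :=
  ∑ k : Fin (p + 2), (-1 : ℤ) ^ (k : ℕ) •
    lPull (M.measure (p + 1) q) (M.measure p q) (M.vFace p q k)
      (fun X => ((faceCoeff k (fun i => X.vert i 0) : M.G₁) : G)) (M.measurable_vCoeff p q k)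

/-- The bidegrees `(p, q)` with `p + q = n`. -/
abbrev Bidegree (n : ℕ) : Type := {x : ℕ × ℕ // x.1 + x.2 = n}

/-- `Dⁿ(A) = ⨁_{p + q = n} L(Γ_pq, A)`. -/
abbrev TotCochain (n : ℕ) : Type _ := (x : Bidegree n) → M.Cochain A x.1.1 x.1.2

/-- The contribution of `dʰ` to the component of bidegree `(p, q)`. -/
def hPart (n : ℕ) : ∀ p q : ℕ, p + q = n + 1 → (M.TotCochain A n →+ M.Cochain A p q)
  | _, 0, _ => 0
  | p, q + 1, h => (M.dh A p q).comp
      (Pi.evalAddMonoidHom (fun x : Bidegree n => M.Cochain A x.1.1 x.1.2) ⟨(p, q), by omega⟩)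

/-- The contribution of `dᵛ` to the component of bidegree `(p, q)`. -/
def vPart (n : ℕ) : ∀ p q : ℕ, p + q = n + 1 → (M.TotCochain A n →+ M.Cochain A p q)
  | 0, _, _ => 0
  | p + 1, q, h => (M.dv A p q).comp
      (Pi.evalAddMonoidHom (fun x : Bidegree n => M.Cochain A x.1.1 x.1.2) ⟨(p, q), by omega⟩)

/-- The total coboundary `d = dʰ + (-1)^q dᵛ` on `L(Γ_pq, A)`. -/
def totCoboundary (n : ℕ) : M.TotCochain A n →+ M.TotCochain A (n + 1) :=
  AddMonoidHom.pi fun x =>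
    M.hPart A n x.1.1 x.1.2 x.2 + (-1 : ℤ) ^ x.1.2 • M.vPart A n x.1.1 x.1.2 x.2

end Bicomplex

/-! #### The map `I`: signed sums over lattice paths -/

/-- A lattice path with `n` steps is a word `w`, where `w t = true` means that step `t` goes down
and `w t = false` that it goes right. These are the paths with `p` steps down. -/
def latticePaths (n p : ℕ) : Finset (Fin n → Bool) :=
  {w | (Finset.univ.filter fun t => w t = true).card = p}

/-- The number of steps down (`b = true`) or right (`b = false`) before step `t`. -/
def stepsBefore {n : ℕ} (w : Fin n → Bool) (b : Bool) (t : Fin n) : ℕ :=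
  (Finset.univ.filter fun u => u < t ∧ w u = b).card

/-- The number of squares above the path: above a step to the right that comes after `a` steps
down there are `a` squares. -/
def squaresAbove {n : ℕ} (w : Fin n → Bool) : ℕ :=
  ∑ t ∈ Finset.univ.filter (fun t => w t = false), stepsBefore w true t

variable {M}

/-- The edge of `X` that a path starting in the top left corner follows in step `t`. (The value `1`
outside the grid does not occur for paths from the top left to the bottom right corner.) -/
def Gam.edge {p q n : ℕ} (X : M.Gam p q) (w : Fin n → Bool) (t : Fin n) : G :=
  let i := stepsBefore w true t
  let j := stepsBefore w false t
  if w t = true then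
    if h : i < p ∧ j < q + 1 then (X.vert ⟨i, h.1⟩ ⟨j, h.2⟩ : G) else 1
  else
    if h : i < p + 1 ∧ j < q then (X.horiz ⟨i, h.1⟩ ⟨j, h.2⟩ : G) else 1

theorem Gam.measurable_edge {p q n : ℕ} (w : Fin n → Bool) :
    Measurable fun X : M.Gam p q => X.edge w := by
  refine measurable_pi_lambda _ fun t => ?_
  simp only [Gam.edge]
  split_ifs
  · exact measurable_subtype_coe.comp (Gam.measurable_vert _ _)
  · exact measurable_const
  · exact measurable_subtype_coe.comp (Gam.measurable_horiz _ _)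
  · exact measurable_const

variable (M)

section Maps

variable (A : Type*) [AddCommGroup A] [TopologicalSpace A] [IsTopologicalAddGroup A] [PolishSpace A]
  [MeasurableSpace A] [BorelSpace A] [DistribMulAction G A] [ContinuousSMul G A]

/-- The Borel function `X ↦ ∑_{paths in X} Sign(path) F(path)` on `Γ_pq`. -/
def pathSum (n p q : ℕ) : BorelCochain G A n →+ borelFun (M.Gam p q) A :=
  ∑ w ∈ latticePaths n p, (-1 : ℤ) ^ squaresAbove w •
    borelPull (fun X : M.Gam p q => X.edge w) (Gam.measurable_edge w)
      (fun _ => (1 : G)) measurable_const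

/-- The map `I` from Borel functions on `Gⁿ` to `Dⁿ(A)`. -/
def mapI (n : ℕ) : BorelCochain G A n →+ M.TotCochain A n :=
  AddMonoidHom.pi fun x =>
    (borelClass (M.measure x.1.1 x.1.2)).comp (M.pathSum A n x.1.1 x.1.2)

end Maps

/-! #### The map `I'` -/

/-- The diagonals of the boxes along the diagonal of an element of `Γ_nn`. -/
def diag (n : ℕ) (X : M.Gam n n) : Fin n → G :=
  fun k => (X.horiz k.castSucc k : G) * (X.vert k k.succ : G)

/-- The grid all of whose edges are the unit. -/
def unitGrid (p q : ℕ) : M.Gam p q :=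
  ⟨(fun _ _ => 1, fun _ _ => 1), fun _ _ => by simp⟩

open Classical in
/-- The element `X(x₁, …, xₙ)` of `Γ_nn` with `x₁, …, xₙ` in the boxes along the diagonal, which
exists for almost all `(x₁, …, xₙ)`; the unit grid when it does not exist. -/
def ofDiag (n : ℕ) (x : Fin n → G) : M.Gam n n :=
  if h : ∃ X : M.Gam n n, M.diag n X = x then h.choose else M.unitGrid n n

/-- The lower left corner of `X ∈ Γ_nn`: the `p` final rows and the `q` first columns, where
`p + q = n`. -/
def corner (n p q : ℕ) (h : p + q = n) (X : M.Gam n n) : M.Gam p q :=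
  ⟨(fun i j => X.vert ⟨q + i, by omega⟩ ⟨j, by omega⟩,
    fun i j => X.horiz ⟨q + i, by omega⟩ ⟨j, by omega⟩),
    fun i j => X.2 ⟨q + i, by omega⟩ ⟨j, by omega⟩⟩

/-- The product of the first `q` edges of the left column of `X`, leading from the top left corner
of `X` to the top left vertex of its lower left corner with `q` columns. -/
def leftProd (n q : ℕ) (h : q ≤ n) (X : M.Gam n n) : G :=
  (List.ofFn fun a : Fin q => (X.vert ⟨a, by omega⟩ 0 : G)).prod

theorem measurable_leftProd (n q : ℕ) (h : q ≤ n) : Measurable (M.leftProd n q h) := by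
  have key : ∀ (m : ℕ) (f : Fin m → M.Gam n n → G), (∀ a, Measurable (f a)) →
      Measurable fun X => (List.ofFn fun a => f a X).prod := by
    intro m
    induction m with
    | zero => intro f _; simp
    | succ m ih =>
      intro f hf
      simp only [List.ofFn_succ, List.prod_cons]
      exact (hf 0).mul (ih (fun a => f a.succ) fun a => hf a.succ)
  exact key q _ fun a => measurable_subtype_coe.comp (Gam.measurable_vert _ _)

section Maps

variable (A : Type*) [AddCommGroup A] [TopologicalSpace A] [IsTopologicalAddGroup A] [PolishSpace A]
  [MeasurableSpace A] [BorelSpace A] [DistribMulAction G A] [ContinuousSMul G A]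

/-- The map `I'`: `I'(F)(x₁, …, xₙ) = ∑_{i=0}^n (g₁₀ ⋯ g_{i0}) · F(Pᵢ X(x₁, …, xₙ))`, where `Pᵢ X`
is the lower left corner of `X` with `n - i` rows and `i` columns. -/
def mapI' (n : ℕ) : M.TotCochain A n →+ LCochain G A n :=
  (lPull (haarPow G n) (M.measure n n) (M.ofDiag n) (fun _ => (1 : G)) measurable_const).comp
    (∑ i : Fin (n + 1),
      (lPull (M.measure n n) (M.measure (n - i) i) (M.corner n (n - i) i (by omega))
        (M.leftProd n i (by omega)) (M.measurable_leftProd n i (by omega))).comp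
      (Pi.evalAddMonoidHom (fun x : Bidegree n => M.Cochain A x.1.1 x.1.2)
        ⟨(n - i, i), by simp only; omega⟩))

end Maps

end MatchedPair

end

/-! Everything is made homogeneous. An element `x` of `G` is read as the row `xG₂` and as the column
`xG₁`. Since `G₁ ∩ G₂` is trivial, a row and a column have at most one common vertex `vtx`; since
`G₁G₂` is conull, almost all pairs have one. Up to null sets, `Γ_pq` is therefore the space of `p +
1` rows and `q + 1` columns modulo `G`, just as `Gⁿ` is the space of `n + 1` points modulo `G`.
Cochains become equivariant functions on lists: `homog` turns the coboundary of `G` into the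
simplicial coboundary `cbd`, and `homog₂` turns the total coboundary into `tot`. The diagonal
vertices of a grid represent all its rows and all its columns, so `I'` becomes the Alexander-Whitney
map `aw`, and `I` becomes the signed shuffle sum `sh`. The identities `aw_tot` and `sh_cbd` make
both cochain transformations.

The dictionary rests on null sets. `image_null_iff` compares `G₁ × G₂` with `G`, `ae_grid_of_ae` and
`ae_of_ae_grid` compare `Γ_pq` with independent rows and columns, and `ae_grid_comp_of_ae` allows
rows and columns to be taken from the same tuple of points.

The map `j` is bijective on cohomology because a Borel cocycle that vanishes almost everywhere is
the coboundary of a Borel cochain that vanishes almost everywhere (`exists_borelCoboundary_eq`). The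
primitive is an iterated cone. Its cone points are chosen in a Borel and equivariant way by
`exists_measurable_selection`, so generic that the cocycle vanishes on every simplex of the
subdivision.

The composite `I' ∘ I` agrees with `j` on cohomology (`mapI'_mapI_sub_mem`): the defect, the
identity minus shuffles followed by Alexander-Whitney, commutes with `cbd` and vanishes on single
points, so the cone homotopy `cone_cbd` provides a primitive.

Injectivity of `I'` (`mem_coboundaries_of_mapI'`) uses a third list, of points that may serve as
rows and as columns. A total cocycle whose image under `aw` is a coboundary extends to a cocycle
`ext₀` on three lists that vanishes when the third list is long. Prepending a generic point to the
third list contracts that direction, and `exists_tot_eq` descends to the empty third list, where the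
original cocycle appears as a total coboundary.

As `j` is bijective and agrees with `I' ∘ I`, the map `I'` is also surjective, and `I` is then
bijective as well. -/

noncomputable section

/-! ### Cochains on lists -/

section ListCochains

variable {Z A : Type*} [AddCommGroup A]

/-- The simplicial coboundary of a function on lists of vertices. -/
def cbd : (List Z → A) → List Z → A
  | _, [] => 0
  | Φ, a :: l => Φ l - cbd (fun l' => Φ (a :: l')) l

@[simp] theorem cbd_nil (Φ : List Z → A) : cbd Φ [] = 0 := by rw [cbd]

theorem cbd_cons (Φ : List Z → A) (a : Z) (l : List Z) :
    cbd Φ (a :: l) = Φ l - cbd (fun l' => Φ (a :: l')) l := by rw [cbd]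

theorem cbd_add (Φ Ψ : List Z → A) (l : List Z) :
    cbd (fun l => Φ l + Ψ l) l = cbd Φ l + cbd Ψ l := by
  induction l generalizing Φ Ψ with
  | nil => simp
  | cons a l ih => simp only [cbd_cons, ih]; abel

theorem cbd_zsmul (n : ℤ) (Φ : List Z → A) (l : List Z) :
    cbd (fun l => n • Φ l) l = n • cbd Φ l := by
  induction l generalizing Φ with
  | nil => simp
  | cons a l ih => simp only [cbd_cons, ih, smul_sub]

theorem cbd_neg (Φ : List Z → A) (l : List Z) : cbd (fun l => - Φ l) l = - cbd Φ l := by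
  have := cbd_zsmul (-1) Φ l
  simpa using this

theorem cbd_sub (Φ Ψ : List Z → A) (l : List Z) :
    cbd (fun l => Φ l - Ψ l) l = cbd Φ l - cbd Ψ l := by
  simp only [sub_eq_add_neg]
  rw [cbd_add, cbd_neg]

/-- Only the faces of `l` enter. Identities between cochains hold on generic lists only, and
genericity passes to sublists; this is the form in which such identities are differentiated. -/
theorem cbd_congr {Φ Ψ : List Z → A} {l : List Z}
    (h : ∀ l', l'.Sublist l → l'.length + 1 = l.length → Φ l' = Ψ l') : cbd Φ l = cbd Ψ l := by
  induction l generalizing Φ Ψ with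
  | nil => simp
  | cons a l ih =>
    rw [cbd_cons, cbd_cons, h l (List.sublist_cons_self a l) (by simp)]
    congr 1
    exact ih fun l' hl hl' => h _ (hl.cons_cons a) (by simpa using hl')

theorem cbd_const_zero (l : List Z) : cbd (fun _ => (0 : A)) l = 0 := by
  have := cbd_zsmul (0 : ℤ) (fun _ : List Z => (0 : A)) l
  simpa using this

theorem cbd_eq_zero {Φ : List Z → A} {l : List Z}
    (h : ∀ l', l'.Sublist l → l'.length + 1 = l.length → Φ l' = 0) : cbd Φ l = 0 :=
  (cbd_congr h).trans (cbd_const_zero l)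

/-- Splitting off the head twice produces `cbd Φ l` once with each sign. What remains is the same
statement for the shorter list, with the head frozen in `Φ`. -/
theorem cbd_cbd (Φ : List Z → A) (l : List Z) : cbd (cbd Φ) l = 0 := by
  induction l generalizing Φ with
  | nil => simp
  | cons a l ih =>
    rw [cbd_cons]
    simp only [cbd_cons]
    rw [cbd_sub, ih]
    abel

theorem cbd_comm {Y : Type*} (Ψ : List Z → List Y → A) (α : List Z) (β : List Y) :
    cbd (fun α' => cbd (Ψ α') β) α = cbd (fun β' => cbd (fun α' => Ψ α' β') α) β := by
  induction α generalizing Ψ with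
  | nil => simp [cbd_const_zero]
  | cons a α ih =>
    simp only [cbd_cons]
    rw [cbd_sub, ih]

/-- A face omits an entry of `α` or an entry of `ζ`, and the position of the latter is shifted by
`α.length`. This Leibniz rule allows a third list to be moved into the rows or the columns. -/
theorem cbd_append (Φ : List Z → A) (α ζ : List Z) :
    cbd Φ (α ++ ζ) = cbd (fun α' => Φ (α' ++ ζ)) α
      + (-1 : ℤ) ^ α.length • cbd (fun ζ' => Φ (α ++ ζ')) ζ := by
  induction α generalizing Φ with
  | nil => simp
  | cons a α ih =>
    simp only [List.cons_append, cbd_cons, ih, List.length_cons, pow_succ]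
    simp only [mul_neg, mul_one, neg_smul]
    abel

theorem cbd_length_smul (Φ : List Z → A) (l : List Z) :
    cbd (fun l' => (-1 : ℤ) ^ l'.length • Φ l') l = -((-1 : ℤ) ^ l.length • cbd Φ l) := by
  cases l with
  | nil => simp
  | cons a l =>
    rw [← cbd_zsmul, ← cbd_neg]
    refine cbd_congr fun l' _ hl => ?_
    rw [← hl, pow_succ]
    simp

/-- All faces have the same length, so the sign is constant. It is expressed through `l.length + 1`,
which has the parity of the length of a face, to avoid truncated subtraction. -/
theorem cbd_length_mul_smul (k : ℕ) (Φ : List Z → A) (l : List Z) :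
    cbd (fun l' => (-1 : ℤ) ^ (k * l'.length) • Φ l') l
      = (-1 : ℤ) ^ (k * (l.length + 1)) • cbd Φ l := by
  rw [← cbd_zsmul]
  refine cbd_congr fun l' _ hl => ?_
  rw [← hl]
  congr 1
  have : k * (l'.length + 1 + 1) = k * l'.length + 2 * k := by ring
  rw [this, pow_add, pow_mul (-1 : ℤ) 2 k]
  simp

theorem cbd_eq_sum (Φ : List Z → A) (l : List Z) :
    cbd Φ l = ∑ k ∈ Finset.range l.length, (-1 : ℤ) ^ k • Φ (l.eraseIdx k) := by
  induction l generalizing Φ with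
  | nil => simp
  | cons a l ih =>
    rw [cbd_cons, ih, List.length_cons, Finset.sum_range_succ', add_comm]
    simp only [List.eraseIdx_cons_succ, pow_succ, List.eraseIdx_cons_zero]
    simp [sub_eq_add_neg]

theorem cbd_two_of_const (Φ : List Z → A) (x : A) (l : List Z) (hl : l.length = 2)
    (h : ∀ l', l'.length = 1 → Φ l' = x) : cbd Φ l = 0 := by
  match l, hl with
  | [a, b], _ => simp [cbd_cons, h [a] rfl, h [b] rfl]

/-! ### Bicomplexes of functions on pairs of lists -/

/-- The total coboundary of a function of a list of rows and a list of columns. -/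
def tot {Y : Type*} (Ψ : List Z → List Y → A) (α : List Z) (β : List Y) : A :=
  cbd (Ψ α) β + (-1 : ℤ) ^ (β.length + 1) • cbd (fun α' => Ψ α' β) α

/-- The Alexander-Whitney map. -/
def aw : (List Z → List Z → A) → List Z → A
  | _, [] => 0
  | Ψ, z :: l => Ψ (z :: l) [z] + aw (fun α β => Ψ α (z :: β)) l

@[simp] theorem aw_nil (Ψ : List Z → List Z → A) : aw Ψ [] = 0 := by rw [aw]

theorem aw_cons (Ψ : List Z → List Z → A) (z : Z) (l : List Z) :
    aw Ψ (z :: l) = Ψ (z :: l) [z] + aw (fun α β => Ψ α (z :: β)) l := by rw [aw]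

theorem aw_eq_sum (Ψ : List Z → List Z → A) (l : List Z) :
    aw Ψ l = ∑ i ∈ Finset.range l.length, Ψ (l.drop i) (l.take (i + 1)) := by
  induction l generalizing Ψ with
  | nil => simp
  | cons a l ih =>
    rw [aw_cons, ih, List.length_cons, Finset.sum_range_succ', add_comm]
    simp

theorem aw_congr {Ψ Ψ' : List Z → List Z → A} {l : List Z}
    (h : ∀ α β, α.Sublist l → β.Sublist l → α.length + β.length = l.length + 1 → α ≠ [] → β ≠ [] →
      Ψ α β = Ψ' α β) : aw Ψ l = aw Ψ' l := by
  rw [aw_eq_sum, aw_eq_sum]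
  refine Finset.sum_congr rfl fun i hi => ?_
  have hi' := Finset.mem_range.mp hi
  refine h _ _ (List.drop_sublist i l) (List.take_sublist _ l) (by simp; omega) ?_ ?_
  · intro h0
    have := congrArg List.length h0
    simp at this
    omega
  · intro h0
    have := congrArg List.length h0
    rw [List.length_take, List.length_nil] at this
    omega

theorem aw_zsmul (n : ℤ) (Ψ : List Z → List Z → A) (l : List Z) :
    aw (fun α β => n • Ψ α β) l = n • aw Ψ l := by
  simp only [aw_eq_sum, Finset.smul_sum]

theorem aw_sub (Ψ Ψ' : List Z → List Z → A) (l : List Z) :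
    aw (fun α β => Ψ α β - Ψ' α β) l = aw Ψ l - aw Ψ' l := by
  simp only [aw_eq_sum, Finset.sum_sub_distrib]

theorem cbd_aw_comm {Y : Type*} (Ψ : List Y → List Z → List Z → A) (l : List Z) (γ : List Y) :
    cbd (fun γ' => aw (Ψ γ') l) γ = aw (fun α β => cbd (fun γ' => Ψ γ' α β) γ) l := by
  induction γ generalizing Ψ with
  | nil =>
    simp only [cbd_nil]
    rw [aw_eq_sum]; simp
  | cons c γ ih =>
    simp only [cbd_cons]
    rw [aw_sub, ih]

/-- Freezing the first column lowers the column degree by one and reverses the sign of the total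
coboundary. This recursion drives `aw_tot`. -/
theorem tot_cons_right {Y : Type*} (Ψ : List Z → List Y → A) (b : Y) (α : List Z) (β : List Y) :
    tot Ψ α (b :: β) = Ψ α β - tot (fun α β => Ψ α (b :: β)) α β := by
  simp only [tot, cbd_cons, List.length_cons, pow_succ (-1 : ℤ) (β.length + 1)]
  simp only [mul_neg, mul_one, neg_smul]
  abel

/-- The cochain property of the Alexander-Whitney map, with the boundary terms at empty lists kept.
They vanish for `homog₂`, but the one with empty row list is exactly what makes `cbd_twist` work. -/
theorem aw_tot (Ψ : List Z → List Z → A) (l : List Z) :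
    aw (tot Ψ) l = cbd (aw Ψ) l + Ψ l [] + (-1 : ℤ) ^ (l.length + 1) • Ψ [] l := by
  induction l generalizing Ψ with
  | nil => simp
  | cons z l ih =>
    have h1 : aw (fun α β => tot Ψ α (z :: β)) l
        = aw Ψ l - aw (tot fun α β => Ψ α (z :: β)) l := by
      simp only [tot_cons_right]
      exact aw_sub _ _ _
    rw [aw_cons, h1, ih, cbd_cons]
    simp only [aw_cons]
    rw [cbd_add]
    simp only [tot, cbd_cons, List.length_cons, List.length_nil, cbd_nil]
    simp only [pow_succ (-1 : ℤ) (l.length + 1)]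
    simp
    abel

/-! ### Shuffles -/

/-- `x` when both lists are empty, and `0` otherwise. -/
def ifNil {Y : Type*} (α : List Z) (β : List Y) (x : A) : A :=
  match α, β with
  | [], [] => x
  | _, _ => 0

variable {Y X : Type*} (v : Z → Y → X)

/-- The signed sum of the values of `Φ` on the monotone paths in a grid with given rows and
columns; `v a b` is the vertex in row `a` and column `b`. -/
def sh : (List X → A) → List Z → List Y → A
  | _, [], _ => 0
  | _, _ :: _, [] => 0
  | Φ, a :: α, b :: β => ifNil α β (Φ [v a b])
      + (-1 : ℤ) ^ β.length • sh (fun l => Φ (v a b :: l)) α (b :: β)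
      + sh (fun l => Φ (v a b :: l)) (a :: α) β
termination_by _ α β => α.length + β.length

@[simp] theorem sh_nil_left (Φ : List X → A) (β : List Y) : sh v Φ [] β = 0 := by rw [sh]

@[simp] theorem sh_nil_right (Φ : List X → A) (α : List Z) : sh v Φ α [] = 0 := by
  cases α <;> rw [sh]

theorem sh_cons_cons (Φ : List X → A) (a : Z) (α : List Z) (b : Y) (β : List Y) :
    sh v Φ (a :: α) (b :: β) = ifNil α β (Φ [v a b])
      + (-1 : ℤ) ^ β.length • sh v (fun l => Φ (v a b :: l)) α (b :: β)
      + sh v (fun l => Φ (v a b :: l)) (a :: α) β := by rw [sh]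

theorem ifNil_sub (α : List Z) (β : List Y) (x y : A) :
    ifNil α β (x - y) = ifNil α β x - ifNil α β y := by
  unfold ifNil; split <;> simp

theorem sh_sub (Φ Φ' : List X → A) (α : List Z) (β : List Y) :
    sh v (fun l => Φ l - Φ' l) α β = sh v Φ α β - sh v Φ' α β := by
  induction hn : α.length + β.length using Nat.strong_induction_on generalizing α β Φ Φ' with
  | _ n ih =>
    match α, β with
    | [], β => simp
    | a :: α, [] => simp
    | a :: α, b :: β =>
      rw [sh_cons_cons, sh_cons_cons, sh_cons_cons, ifNil_sub,
        ih _ (by subst hn; simp) _ _ _ _ rfl, ih _ (by subst hn; simp) _ _ _ _ rfl, smul_sub]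
      abel

theorem cbd_ifNil_right (α : List Z) (β : List Y) (x : A) :
    cbd (fun β' => ifNil α β' x) β = match α, β with | [], [_] => x | _, _ => 0 := by
  match α, β with
  | [], [] => simp
  | [], [b] => simp [cbd_cons, ifNil]
  | [], b :: b' :: β =>
    refine cbd_eq_zero fun l' _ hl => ?_
    match l', hl with
    | [], hl => simp at hl
    | _ :: _, _ => rfl
  | a :: α, β => exact cbd_const_zero β

theorem cbd_ifNil_left (α : List Z) (β : List Y) (x : A) :
    cbd (fun α' => ifNil α' β x) α = match α, β with | [_], [] => x | _, _ => 0 := by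
  match α, β with
  | [], [] => simp
  | [a], [] => simp [cbd_cons, ifNil]
  | a :: a' :: α, [] =>
    refine cbd_eq_zero fun l' _ hl => ?_
    match l', hl with
    | [], hl => simp at hl
    | _ :: _, _ => rfl
  | [], b :: β => simp
  | [_], b :: β =>
    refine cbd_eq_zero fun l' _ hl => ?_
    cases l' <;> rfl
  | _ :: _ :: _, b :: β =>
    refine cbd_eq_zero fun l' _ hl => ?_
    cases l' <;> rfl

/-- `x` when both lists have one element, and `0` otherwise. -/
def ifSingle (α : List Z) (β : List Y) (x : A) : A :=
  match α, β with
  | [_], [_] => x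
  | _, _ => 0

/-- Induction along the first step of a path. The induction hypotheses for a first step down and a
first step right both contribute the paths in the grid on the tails `α` and `β`; these are the faces
that omit a corner, and they cancel. The extra term is the value on the empty list, which is zero
for homogeneous cochains. -/
theorem sh_cbd (Φ : List X → A) (α : List Z) (β : List Y) :
    sh v (cbd Φ) α β = tot (sh v Φ) α β + ifSingle α β (Φ []) := by
  induction hn : α.length + β.length using Nat.strong_induction_on generalizing α β Φ with
  | _ n ih =>
    match α, β with
    | [], β =>
      simp only [sh_nil_left, tot, cbd_nil, smul_zero, add_zero, ifSingle]
      exact (cbd_eq_zero fun _ _ _ => sh_nil_left _ _ _).symm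
    | a :: α, [] =>
      simp only [sh_nil_right, tot, cbd_nil, ifSingle, cbd_const_zero]
      simp
    | a :: α, b :: β =>
      rw [sh_cons_cons]
      simp only [cbd_cons]
      rw [sh_sub, sh_sub, ih (α.length + (b :: β).length) (by subst hn; simp) _ α (b :: β) rfl,
        ih ((a :: α).length + β.length) (by subst hn; simp) _ (a :: α) β rfl]
      simp only [tot, cbd_cons, List.length_cons, cbd_nil, sub_zero]
      simp only [sh_cons_cons]
      rw [cbd_add, cbd_add, cbd_add, cbd_add, cbd_zsmul, cbd_length_smul, cbd_ifNil_right,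
        cbd_ifNil_left]
      simp only [pow_succ, mul_neg, mul_one, neg_smul, neg_neg, smul_sub, smul_add]
      have hs : ∀ (k : ℕ) (x : A), (-1 : ℤ) ^ k • (-1 : ℤ) ^ k • x = x := by
        intro k x
        rw [smul_smul, ← mul_pow]; simp
      simp only [hs]
      -- The exceptional terms and their coboundaries distinguish tails with no, one, and at least
      -- two entries.
      rcases α with _ | ⟨a', _ | ⟨a'', α⟩⟩ <;> rcases β with _ | ⟨b', _ | ⟨b'', β⟩⟩ <;>
        simp [ifNil, ifSingle] <;> abel

end ListCochains

end

noncomputable section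

/-! ### Cone homotopies -/

section Cone

variable {Z A : Type*} [AddCommGroup A]

/-- The homotopy obtained by iterated coning off, the cone point over `l` being `c l`;
`cone e c n` is meant for lists of length `n`. -/
def cone (e : (List Z → A) → List Z → A) (c : List Z → Z) : ℕ → (List Z → A) → List Z → A
  | 0, _, _ => 0
  | 1, _, _ => 0
  | n + 2, Φ, l => e (fun l' => Φ (c l :: l')) l - cbd (cone e c (n + 1) fun l' => Φ (c l :: l')) l

/-- The subdivision operator that belongs to the cone points `c`. -/
def subdiv (e : (List Z → A) → List Z → A) (c : List Z → Z) : ℕ → (List Z → A) → List Z → A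
  | 0, Φ, l => e Φ l
  | 1, Φ, l => e Φ l
  | n + 2, Φ, l => cbd (subdiv e c (n + 1) fun l' => Φ (c l :: l')) l

variable {e : (List Z → A) → List Z → A} {c : List Z → Z}

theorem cone_sub (he : ∀ Φ Ψ l, e (fun l => Φ l - Ψ l) l = e Φ l - e Ψ l) (n : ℕ)
    (Φ Ψ : List Z → A) (l : List Z) :
    cone e c n (fun l => Φ l - Ψ l) l = cone e c n Φ l - cone e c n Ψ l := by
  induction n generalizing Φ Ψ l with
  | zero => simp [cone]
  | succ n ih =>
    cases n with
    | zero => simp [cone]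
    | succ n =>
      simp only [cone]
      rw [he, cbd_congr (fun l' _ _ => ih _ _ l'), cbd_sub]
      abel

/-- The coboundary of `Φ` on `c l :: l'` is `Φ l'` minus the coboundary of `Φ` with `c l` frozen.
The first term gives `e Φ`; the second is treated by the induction hypothesis on the faces of `l`,
the cone point of `l` staying in front. Unrolled, the cone points run over chains of faces, as in a
barycentric subdivision. -/
theorem cone_cbd (he : ∀ Φ Ψ l, e (fun l => Φ l - Ψ l) l = e Φ l - e Ψ l)
    (hd : ∀ Φ l, e (cbd Φ) l = cbd (e Φ) l) (n : ℕ) (Φ : List Z → A) (l : List Z)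
    (hl : l.length = n + 1) :
    cone e c (n + 1) (cbd Φ) l + cbd (cone e c n Φ) l = e Φ l - subdiv e c (n + 1) Φ l := by
  induction n generalizing Φ l with
  | zero =>
    simp only [cone, subdiv, sub_self, zero_add]
    exact cbd_const_zero l
  | succ n ih =>
    have h1 : (fun l' => cbd Φ (c l :: l'))
        = fun l' => Φ l' - cbd (fun l'' => Φ (c l :: l'')) l' := by
      funext l'; rw [cbd_cons]
    simp only [cone, subdiv]
    rw [h1, he, hd]
    have h2 : cbd (cone e c (n + 1) fun l' => Φ l' - cbd (fun l'' => Φ (c l :: l'')) l') l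
        = cbd (fun l' => cone e c (n + 1) Φ l' - (e (fun l'' => Φ (c l :: l'')) l'
            - subdiv e c (n + 1) (fun l'' => Φ (c l :: l'')) l'
            - cbd (cone e c n fun l'' => Φ (c l :: l'')) l')) l := by
      refine cbd_congr fun l' _ h => ?_
      rw [cone_sub he, ← ih _ l' (by omega)]
      abel
    rw [h2, cbd_sub, cbd_sub, cbd_sub, cbd_cbd]
    abel

/-- Passing to faces until the end, the subdivision operator applies `e` only to lists with at most
one entry. -/
theorem subdiv_eq_zero (h : ∀ Φ l, l.length ≤ 1 → e Φ l = 0) (n : ℕ) (Φ : List Z → A)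
    (l : List Z) (hl : l.length = n) : subdiv e c n Φ l = 0 := by
  induction n generalizing Φ l with
  | zero => exact h _ _ (by omega)
  | succ n ih =>
    cases n with
    | zero => exact h _ _ (by omega)
    | succ n => exact cbd_eq_zero fun l' _ h' => ih _ _ (by omega)

end Cone

/-! ### The defect of the composite of shuffles and Alexander-Whitney -/

section Shuffle

variable {Z A : Type*} [AddCommGroup A]

/-- The difference of the identity and of the composite of the shuffle and the Alexander-Whitney
map. -/
def shuffleDefect (v : Z → Z → Z) (Φ : List Z → A) (l : List Z) : A :=
  if l = [] then 0 else Φ l - aw (sh v Φ) l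

theorem shuffleDefect_sub (v : Z → Z → Z) (Φ Ψ : List Z → A) (l : List Z) :
    shuffleDefect v (fun l => Φ l - Ψ l) l = shuffleDefect v Φ l - shuffleDefect v Ψ l := by
  unfold shuffleDefect
  split_ifs
  · simp
  · rw [aw_congr (fun α β _ _ _ _ _ => sh_sub v Φ Ψ α β), aw_sub]
    exact sub_sub_sub_comm _ _ _ _

theorem shuffleDefect_of_length_le_one (v : Z → Z → Z) (hv : ∀ a, v a a = a) (Φ : List Z → A)
    (l : List Z) (hl : l.length ≤ 1) : shuffleDefect v Φ l = 0 := by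
  match l, hl with
  | [], _ => simp [shuffleDefect]
  | [a], _ => simp [shuffleDefect, aw_cons, sh_cons_cons, ifNil, hv]

/-- Combines `sh_cbd` and `aw_tot`: `sh` vanishes on empty lists, and `ifSingle` does not occur once
the list has two entries. On shorter lists both sides are zero, because `v a a = a` and because the
defect is set to zero on the empty list. -/
theorem shuffleDefect_cbd (v : Z → Z → Z) (hv : ∀ a, v a a = a) (Φ : List Z → A) (l : List Z) :
    shuffleDefect v (cbd Φ) l = cbd (shuffleDefect v Φ) l := by
  match l with
  | [] => simp [shuffleDefect]
  | [a] =>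
    rw [shuffleDefect_of_length_le_one v hv _ _ (by simp), cbd_eq_zero]
    intro l' _ h
    exact shuffleDefect_of_length_le_one v hv _ _ (by simp at h; simp [h])
  | a :: b :: l =>
    have h1 : cbd (shuffleDefect v Φ) (a :: b :: l)
        = cbd (fun l => Φ l - aw (sh v Φ) l) (a :: b :: l) := by
      refine cbd_congr fun l' _ h => ?_
      rw [shuffleDefect, if_neg]
      rintro rfl
      simp at h
    have h2 : aw (sh v (cbd Φ)) (a :: b :: l) = aw (tot (sh v Φ)) (a :: b :: l) := by
      refine aw_congr fun α β _ _ h _ _ => ?_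
      rw [sh_cbd]
      have : ifSingle α β (Φ []) = 0 := by
        unfold ifSingle
        split
        · simp at h
        · rfl
      rw [this, add_zero]
    rw [h1, cbd_sub, shuffleDefect, if_neg (by simp), h2, aw_tot]
    simp

end Shuffle

/-! ### Resolving the total complex -/

section Staircase

variable {Z A : Type*} [AddCommGroup A]

/-- The total coboundary of a function of three lists. -/
def del (f : List Z → List Z → List Z → A) (α β ζ : List Z) : A :=
  cbd (fun β' => f α β' ζ) β + (-1 : ℤ) ^ β.length • cbd (fun ζ' => f α β ζ') ζ
    + (-1 : ℤ) ^ (β.length + ζ.length + 1) • cbd (fun α' => f α' β ζ) α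

theorem del_add (f g : List Z → List Z → List Z → A) (α β ζ : List Z) :
    del (fun α β ζ => f α β ζ + g α β ζ) α β ζ = del f α β ζ + del g α β ζ := by
  simp only [del, cbd_add, smul_add]
  abel

theorem del_sub (f g : List Z → List Z → List Z → A) (α β ζ : List Z) :
    del (fun α β ζ => f α β ζ - g α β ζ) α β ζ = del f α β ζ - del g α β ζ := by
  simp only [del, cbd_sub, smul_sub]
  abel

theorem del_nil_right (f : List Z → List Z → List Z → A) (α β : List Z) :
    del f α β [] = tot (fun α β => f α β []) α β := by
  simp [del, tot]

theorem neg_one_pow_smul_smul (k : ℕ) (x : A) : (-1 : ℤ) ^ k • (-1 : ℤ) ^ k • x = x := by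
  rw [smul_smul, ← mul_pow]; simp

/-- The three simplicial coboundaries square to zero and commute by `cbd_comm`. The signs depend on
the lengths of the lists in such a way that each mixed term occurs twice, with opposite signs. -/
theorem del_del (f : List Z → List Z → List Z → A) (α β ζ : List Z) :
    del (del f) α β ζ = 0 := by
  have e1 : cbd (fun β' => del f α β' ζ) β
      = -((-1 : ℤ) ^ β.length • cbd (fun β' => cbd (fun ζ' => f α β' ζ') ζ) β)
        + -((-1 : ℤ) ^ (β.length + ζ.length + 1) • cbd (fun β' => cbd (fun α' => f α' β' ζ) α) β)
      := by
    simp only [del]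
    rw [cbd_add, cbd_add, cbd_length_smul]
    rw [cbd_cbd, zero_add]
    congr 1
    have h2 : (fun l' : List Z => (-1 : ℤ) ^ (l'.length + ζ.length + 1)
          • cbd (fun α' => f α' l' ζ) α)
        = fun l' => (-1 : ℤ) ^ l'.length • ((-1 : ℤ) ^ (ζ.length + 1)
          • cbd (fun α' => f α' l' ζ) α) := by
      funext l'; rw [smul_smul, ← pow_add, add_assoc]
    rw [h2, cbd_length_smul, cbd_zsmul, smul_smul, ← pow_add, add_assoc]
  have e2 : cbd (fun ζ' => del f α β ζ') ζ
      = cbd (fun ζ' => cbd (fun β' => f α β' ζ') β) ζ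
        + -((-1 : ℤ) ^ (β.length + ζ.length + 1) • cbd (fun ζ' => cbd (fun α' => f α' β ζ') α) ζ)
      := by
    simp only [del]
    rw [cbd_add, cbd_add, cbd_zsmul]
    rw [cbd_cbd, smul_zero, add_zero]
    congr 1
    have h2 : (fun l' : List Z => (-1 : ℤ) ^ (β.length + l'.length + 1)
          • cbd (fun α' => f α' β l') α)
        = fun l' => (-1 : ℤ) ^ l'.length • ((-1 : ℤ) ^ (β.length + 1)
          • cbd (fun α' => f α' β l') α) := by
      funext l'; rw [smul_smul, ← pow_add]; congr 2; ring
    rw [h2, cbd_length_smul, cbd_zsmul, smul_smul, ← pow_add]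
    congr 3; ring
  have e3 : cbd (fun α' => del f α' β ζ) α
      = cbd (fun α' => cbd (fun β' => f α' β' ζ) β) α
        + (-1 : ℤ) ^ β.length • cbd (fun α' => cbd (fun ζ' => f α' β ζ') ζ) α := by
    simp only [del]
    rw [cbd_add, cbd_add, cbd_zsmul, cbd_zsmul]
    rw [cbd_cbd, smul_zero, add_zero]
  rw [del, e1, e2, e3, cbd_comm (fun α' β' => f α' β' ζ), cbd_comm (fun α' ζ' => f α' β ζ'),
    cbd_comm (fun ζ' β' => f α β' ζ')]
  simp only [smul_add, smul_neg, pow_add, pow_one, smul_smul]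
  have h : (-1 : ℤ) ^ β.length * (-1) ^ β.length = 1 := by rw [← mul_pow]; simp
  have h3 : ((-1 : ℤ) ^ β.length * ((-1) ^ β.length * (-1) ^ ζ.length * -1))
      = -(-1) ^ ζ.length := by rw [← mul_assoc, ← mul_assoc, h]; ring
  have h4 : ((-1 : ℤ) ^ β.length * (-1) ^ ζ.length * -1 * (-1) ^ β.length)
      = -(-1) ^ ζ.length := by rw [mul_right_comm, mul_right_comm ((-1 : ℤ) ^ β.length), h]; ring
  rw [h3, h4]
  abel

theorem cbd_ite_nil (Φ : List Z → A) (l : List Z) :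
    cbd (fun l => if l = [] then 0 else Φ l) l = cbd Φ l - if l.length = 1 then Φ [] else 0 := by
  match l with
  | [] => simp
  | [a] => simp [cbd_cons]
  | a :: b :: l =>
    simp only [List.length_cons, Nat.add_eq_right, Nat.add_eq_zero_iff, one_ne_zero, and_false,
      if_false, sub_zero]
    refine cbd_congr fun l' _ h => if_neg ?_
    rintro rfl
    simp at h

theorem cbd_ite_single (x : A) (l : List Z) :
    cbd (fun l => if l.length = 1 then x else 0) l = 0 := by
  by_cases hl : l.length = 2
  · exact cbd_two_of_const _ x l hl fun l' h => if_pos h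
  · exact cbd_eq_zero fun l' _ h => if_neg (by omega)

/-- A twisted concatenation in the first variable. -/
def twist (Ψ : List Z → List Z → A) (α α' β' : List Z) : A :=
  (-1 : ℤ) ^ (α.length * β'.length) • Ψ (α ++ α') β'

/-- This is `cbd_append` in the rows. Thanks to the sign in `twist`, the row part and the column
part combine into a multiple of the total coboundary of `Ψ`, and the remainder is a coboundary in
the frozen rows `α`. -/
theorem tot_twist (Ψ : List Z → List Z → A) (α α' β' : List Z) :
    tot (twist Ψ α) α' β' = (-1 : ℤ) ^ (α.length * (β'.length + 1)) • tot Ψ (α ++ α') β'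
      + (-1 : ℤ) ^ α.length • cbd (fun α => twist Ψ α α' β') α := by
  have h0 : cbd (twist Ψ α α') β'
      = (-1 : ℤ) ^ (α.length * (β'.length + 1)) • cbd (Ψ (α ++ α')) β' :=
    cbd_length_mul_smul _ _ _
  simp only [tot, h0]
  simp only [twist]
  rw [cbd_zsmul, cbd_append]
  have h : cbd (fun α => (-1 : ℤ) ^ (α.length * β'.length) • Ψ (α ++ α') β') α
      = (-1 : ℤ) ^ (β'.length * (α.length + 1)) • cbd (fun α => Ψ (α ++ α') β') α := by
    rw [← cbd_length_mul_smul]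
    simp only [mul_comm]
  rw [h]
  simp only [smul_add, smul_smul, ← pow_add]
  rcases Nat.even_or_odd α.length with ha | ha <;> rcases Nat.even_or_odd β'.length with hb | hb <;>
    simp [pow_add, pow_mul, mul_add, ha.neg_one_pow, hb.neg_one_pow] <;> abel

/-- Apply `aw_tot` to `twist Ψ α`. The cocycle condition leaves only the coboundary in the frozen
rows, and the boundary term with empty row list is `Ψ α ζ` up to sign. So `aw (twist Ψ α)` trades `Ψ
α ζ` for terms with fewer frozen rows, ending at `aw Ψ ζ`. -/
theorem cbd_twist (Ψ : List Z → List Z → A) (hΨ : ∀ α, Ψ α [] = 0) (α ζ : List Z)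
    (h : ∀ α' β', α'.Sublist ζ → β'.Sublist ζ → tot Ψ (α ++ α') β' = 0) :
    cbd (aw (twist Ψ α)) ζ = (-1 : ℤ) ^ α.length • cbd (fun α => aw (twist Ψ α) ζ) α
      + (-1 : ℤ) ^ (ζ.length + α.length * ζ.length) • Ψ α ζ := by
  have h1 := aw_tot (twist Ψ α) ζ
  rw [aw_congr (Ψ' := fun α' β' => (-1 : ℤ) ^ α.length • cbd (fun α => twist Ψ α α' β') α),
    aw_zsmul, ← cbd_aw_comm] at h1
  · rw [h1]
    simp only [twist, hΨ, smul_zero, add_zero, List.append_nil, smul_smul, pow_add]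
    simp
  · intro α' β' ha hb _ _ _
    rw [tot_twist, h α' β' ha hb, smul_zero, zero_add]

/-- The extension of a cocycle `Ψ` of the total complex to three lists. -/
def ext₁ (Ψ : List Z → List Z → A) (α β ζ : List Z) : A := if β = [] then 0 else Ψ α (β ++ ζ)

/-- The correction term for `ext₁` that comes from the Alexander-Whitney map. -/
def ext₂ (Ψ : List Z → List Z → A) (α β ζ : List Z) : A :=
  if β.length = 1 then if α = [] then 0 else
    -((-1 : ℤ) ^ ((α.length + 1) * (ζ.length + 1)) • aw (twist Ψ α) ζ) else 0

/-- A function of the third list as a function of three lists. -/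
def ext₃ (η : List Z → A) (α β ζ : List Z) : A :=
  if β.length = 1 then if α.length = 1 then η ζ else 0 else 0

/-- Without the cut-off at empty `β` this would be the pull-back of `Ψ` along concatenation, a
cocycle whenever `Ψ` is one. The cut-off is felt exactly when `β` is a singleton. -/
theorem del_ext₁ (Ψ : List Z → List Z → A) (α β ζ : List Z) (hβ : β ≠ []) :
    del (ext₁ Ψ) α β ζ = tot Ψ α (β ++ ζ) - if β.length = 1 then Ψ α ζ else 0 := by
  simp only [del, ext₁, hβ, if_false, tot]
  rw [cbd_ite_nil, cbd_append, List.length_append, List.nil_append]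
  abel

/-- By `cbd_twist` this cancels the defect of `ext₁`. For a singleton `α`, removing the last frozen
row leaves `aw Ψ ζ`, which `ext₃` cancels in turn. -/
theorem del_ext₂ (Ψ : List Z → List Z → A) (hΨ : ∀ α, Ψ α [] = 0)
    (α β ζ : List Z) (hα : α ≠ [])
    (h : ∀ α' β', α'.Sublist ζ → β'.Sublist ζ → tot Ψ (α ++ α') β' = 0) :
    del (ext₂ Ψ) α β ζ = if β.length = 1 then Ψ α ζ - if α.length = 1 then aw Ψ ζ else 0 else 0 := by
  have h1 : cbd (fun β' => ext₂ Ψ α β' ζ) β = 0 := cbd_ite_single _ _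
  by_cases hb : β.length = 1
  · have hz : cbd (fun ζ' => ext₂ Ψ α β ζ') ζ
        = -((-1 : ℤ) ^ ((α.length + 1) * ζ.length) • cbd (aw (twist Ψ α)) ζ) := by
      rw [← cbd_zsmul, ← cbd_neg]
      refine cbd_congr fun ζ' _ hl => ?_
      simp only [ext₂, hb, hα, if_true, if_false, hl]
    have ha : cbd (fun α' => ext₂ Ψ α' β ζ) α
        = -((-1 : ℤ) ^ (α.length * (ζ.length + 1)) • (cbd (fun α => aw (twist Ψ α) ζ) α
          - if α.length = 1 then aw Ψ ζ else 0)) := by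
      have e : (twist Ψ ([] : List Z)) = Ψ := by funext α' β'; simp [twist]
      have e2 := cbd_ite_nil (fun α => aw (twist Ψ α) ζ) α
      rw [e] at e2
      rw [← e2, ← cbd_zsmul, ← cbd_neg]
      refine cbd_congr fun α' _ hl => ?_
      simp only [ext₂, hb, if_true, hl]
      split_ifs <;> simp
    rw [if_pos hb, del, h1, hz, ha, hb, cbd_twist Ψ hΨ α ζ h]
    split_ifs with h3
    · rw [h3]
      simp only [smul_add, smul_smul, smul_neg, ← pow_add, smul_sub]
      rcases Nat.even_or_odd ζ.length with hc | hc <;>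
        simp [pow_add, pow_mul, mul_add, hc.neg_one_pow] <;> abel
    · simp only [smul_add, smul_smul, smul_neg, ← pow_add, smul_sub]
      rcases Nat.even_or_odd α.length with hc | hc <;>
        rcases Nat.even_or_odd ζ.length with hc' | hc' <;>
        simp [pow_add, pow_mul, mul_add, add_mul, hc.neg_one_pow, hc'.neg_one_pow]
  · have hz : cbd (fun ζ' => ext₂ Ψ α β ζ') ζ = 0 := cbd_eq_zero fun _ _ _ => if_neg hb
    have ha : cbd (fun α' => ext₂ Ψ α' β ζ) α = 0 := cbd_eq_zero fun _ _ _ => if_neg hb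
    rw [del, h1, hz, ha, if_neg hb]
    simp

theorem del_ext₃ (η : List Z → A) (α β ζ : List Z) :
    del (ext₃ η) α β ζ =
      if β.length = 1 then if α.length = 1 then - cbd η ζ else 0 else 0 := by
  have h1 : cbd (fun β' => ext₃ η α β' ζ) β = 0 := cbd_ite_single _ _
  have ha : cbd (fun α' => ext₃ η α' β ζ) α = 0 := by
    by_cases hb : β.length = 1
    · simp only [ext₃, hb, if_true]
      exact cbd_ite_single _ _
    · exact cbd_eq_zero fun _ _ _ => if_neg hb
  rw [del, h1, ha]
  split_ifs with hb hc
  · simp [ext₃, hb, hc]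
  · have : cbd (fun ζ' => ext₃ η α β ζ') ζ = 0 := cbd_eq_zero fun _ _ _ => by simp [ext₃, hc]
    rw [this]; simp
  · have : cbd (fun ζ' => ext₃ η α β ζ') ζ = 0 := cbd_eq_zero fun _ _ _ => by simp [ext₃, hb]
    rw [this]; simp

/-- A cocycle `Ψ` of the total complex whose image under the Alexander-Whitney map is the
coboundary of `η`, as a cocycle on three lists. -/
def ext₀ (Ψ : List Z → List Z → A) (η : List Z → A) (α β ζ : List Z) : A :=
  ext₁ Ψ α β ζ + ext₂ Ψ α β ζ - ext₃ η α β ζ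

theorem del_ext₀ (Ψ : List Z → List Z → A) (η : List Z → A) (hΨ : ∀ α, Ψ α [] = 0)
    (α β ζ : List Z) (hα : α ≠ []) (hβ : β ≠ [])
    (h : ∀ α' β', α'.Sublist ζ → β'.Sublist ζ → tot Ψ (α ++ α') β' = 0)
    (h' : tot Ψ α (β ++ ζ) = 0) (hη : aw Ψ ζ = cbd η ζ) :
    del (ext₀ Ψ η) α β ζ = 0 := by
  have e := del_sub (fun α β ζ => ext₁ Ψ α β ζ + ext₂ Ψ α β ζ) (ext₃ η) α β ζ
  rw [del_add] at e
  refine e.trans ?_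
  rw [del_ext₁ Ψ α β ζ hβ, del_ext₂ Ψ hΨ α β ζ hα h, del_ext₃, h', hη]
  split_ifs <;> simp
  abel

theorem ext₀_nil (Ψ : List Z → List Z → A) (η : List Z → A) (hΨ : ∀ α, Ψ α [] = 0)
    (hη : η [] = 0) (α β : List Z) : ext₀ Ψ η α β [] = Ψ α β := by
  unfold ext₀ ext₁ ext₂ ext₃
  by_cases hβ : β = [] <;> simp [hβ, hη, hΨ]

end Staircase

end

noncomputable section

/-! ### Nonsingular maps -/

section Nonsingular

variable {α β : Type*} [MeasurableSpace α] [MeasurableSpace β] {μ : Measure α} {ν : Measure β}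
  [SigmaFinite μ] [SigmaFinite ν]

theorem measurePreserving_cons (μ : Measure α) [SigmaFinite μ] (n : ℕ) :
    MeasurePreserving (fun p : α × (Fin n → α) => (Fin.cons p.1 p.2 : Fin (n + 1) → α))
      (μ.prod (Measure.pi fun _ => μ)) (Measure.pi fun _ => μ) := by
  have h := (measurePreserving_piFinSuccAbove (fun _ : Fin (n + 1) => μ) 0).symm
  convert h using 1
  funext p i
  refine Fin.cases ?_ (fun i => ?_) i <;> simp [MeasurableEquiv.piFinSuccAbove]

theorem measurePreserving_uncons (μ : Measure α) [SigmaFinite μ] (n : ℕ) :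
    MeasurePreserving (fun w : Fin (n + 1) → α => (w 0, Fin.tail w))
      (Measure.pi fun _ => μ) (μ.prod (Measure.pi fun _ => μ)) := by
  have h := measurePreserving_piFinSuccAbove (fun _ : Fin (n + 1) => μ) 0
  convert h using 1
  funext w
  rfl

theorem quasiMeasurePreserving_pi {f : α → β} (hf : Measure.QuasiMeasurePreserving f μ ν) (n : ℕ) :
    Measure.QuasiMeasurePreserving (fun (w : Fin n → α) i => f (w i))
      (Measure.pi fun _ => μ) (Measure.pi fun _ => ν) := by
  induction n with
  | zero =>
    have hm : Measurable fun (w : Fin 0 → α) i => f (w i) := measurable_pi_lambda _ fun i => i.elim0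
    refine ⟨hm, ?_⟩
    rw [Measure.pi_of_empty (fun _ : Fin 0 => μ), Measure.pi_of_empty (fun _ : Fin 0 => ν),
      Measure.map_dirac' hm]
    rw [Subsingleton.elim (fun i : Fin 0 => f (isEmptyElim i)) fun i => isEmptyElim i]
  | succ n ih =>
    have h := (measurePreserving_cons ν n).quasiMeasurePreserving.comp
      ((QuasiMeasurePreserving.prodMap hf ih).comp (measurePreserving_uncons μ n).quasiMeasurePreserving)
    convert h using 1
    funext w i
    refine Fin.cases ?_ (fun i => ?_) i <;> simp [Fin.tail]

/-- A projection to some coordinates followed by a relabelling. Injectivity is essential: a repeated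
coordinate would send everything into a diagonal. -/
theorem quasiMeasurePreserving_comp_injective (μ : Measure α) [SigmaFinite μ] {n N : ℕ}
    (f : Fin n → Fin N) (hf : Function.Injective f) :
    Measure.QuasiMeasurePreserving (fun (w : Fin N → α) i => w (f i))
      (Measure.pi fun _ => μ) (Measure.pi fun _ => μ) := by
  classical
  let p : Fin N → Prop := fun x => x ∈ Set.range f
  have h1 := (measurePreserving_piEquivPiSubtypeProd (fun _ : Fin N => μ) p).quasiMeasurePreserving
  have h2 : Measure.QuasiMeasurePreserving (fun (w : Fin N → α) (i : {x // p x}) => w i)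
      (Measure.pi fun _ => μ) (Measure.pi fun _ => μ) := by
    convert QuasiMeasurePreserving.fst h1
    rfl
  have h3 := (measurePreserving_piCongrLeft (fun _ : Fin n => μ)
    (Equiv.ofInjective f hf).symm).quasiMeasurePreserving
  have h4 := h3.comp h2
  convert h4 using 1
  funext w i
  simp only [Function.comp]
  have e := (MeasurableEquiv.piCongrLeft_apply_apply (β := fun _ : Fin n => α)
    (Equiv.ofInjective f hf).symm (fun (i : {x // p x}) => w i) ⟨f i, i, rfl⟩)
  have e2 : (Equiv.ofInjective f hf).symm ⟨f i, i, rfl⟩ = i := by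
    rw [Equiv.symm_apply_eq]; rfl
  rw [e2] at e
  exact e.symm

theorem ae_of_forall_prod {p : β → Prop} (hμ : μ ≠ 0)
    (h : ∀ᵐ x ∂(μ.prod ν), p x.2) : ∀ᵐ y ∂ν, p y := by
  have h1 := Measure.ae_ae_of_ae_prod h
  have : (ae μ).NeBot := ae_neBot.mpr hμ
  exact h1.exists.choose_spec

end Nonsingular

/-! ### Null sets of a group, partial products and consecutive quotients -/

section GroupMeasure

variable {H : Type*} [Group H] [MeasurableSpace H] [MeasurableMul₂ H] [MeasurableInv H]

/-- Fubini for the pairs with `x * y ∈ s`, with `x` distributed by `μ` and `y` by `ν`. For fixed `x`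
the section is a left translate of `s`, controlled by the quasi-invariance of `ν`. For fixed `y` it
is a right translate, and right translations preserve the null sets of the left-invariant `μ`. -/
theorem null_iff_of_quasiInvariant (μ ν : Measure H) [SFinite μ] [μ.IsMulLeftInvariant]
    [SFinite ν] (hμ : μ ≠ 0) (hν : ν ≠ 0)
    (hinv : ∀ (g : H) (s : Set H), MeasurableSet s → ν s = 0 → ν ((fun x => g * x) ⁻¹' s) = 0)
    {s : Set H} (hs : MeasurableSet s) : ν s = 0 ↔ μ s = 0 := by
  have : (ae μ).NeBot := ae_neBot.mpr hμ
  have : (ae ν).NeBot := ae_neBot.mpr hν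
  have hm : MeasurableSet {x : H × H | x.1 * x.2 ∉ s} :=
    (measurable_fst.mul measurable_snd) hs.compl
  have hc := Measure.ae_ae_comm (μ := μ) (ν := ν) (p := fun x y => x * y ∉ s) hm
  have e1 : ∀ x, (∀ᵐ y ∂ν, x * y ∉ s) ↔ ν ((fun y => x * y) ⁻¹' s) = 0 := by
    intro x
    rw [ae_iff]
    simp [Set.preimage]
  have e2 : ∀ y, (∀ᵐ x ∂μ, x * y ∉ s) ↔ μ s = 0 := by
    intro y
    rw [← measure_mul_right_null μ y, ae_iff]
    simp [Set.preimage]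
  constructor
  · intro h
    obtain ⟨y, hy⟩ := (hc.mp (Filter.Eventually.of_forall fun x => (e1 x).mpr (hinv x s hs h))).exists
    exact (e2 y).mp hy
  · intro h
    obtain ⟨x, hx⟩ := (hc.mpr (Filter.Eventually.of_forall fun y => (e2 y).mpr h)).exists
    have := hinv x⁻¹ _ ((measurable_const_mul x) hs) ((e1 x).mp hx)
    simpa [Set.preimage] using this

variable (μ : Measure H) [SigmaFinite μ] [μ.IsMulLeftInvariant]

/-- The first entry and the consecutive quotients. -/
theorem quasiMeasurePreserving_smul_skew {X : Type*} [MeasurableSpace X] (ν : Measure X)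
    [SigmaFinite ν] (f : X → H) (hf : Measurable f) :
    Measure.QuasiMeasurePreserving (fun p : H × X => (f p.2 * p.1, p.2)) (μ.prod ν) (μ.prod ν) := by
  have h : MeasurePreserving (fun p : X × H => (p.1, f p.1 * p.2)) (ν.prod μ) (ν.prod μ) :=
    (MeasurePreserving.id ν).skew_product ((hf.comp measurable_fst).mul measurable_snd)
      (Filter.Eventually.of_forall fun x => map_mul_left_eq_self μ (f x))
  have := Measure.measurePreserving_swap.comp (h.comp (Measure.measurePreserving_swap (μ := μ)
    (ν := ν)))
  exact this.quasiMeasurePreserving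

theorem quasiMeasurePreserving_smul_pi {X : Type*} [MeasurableSpace X] (ν : Measure X)
    [SigmaFinite ν] (n : ℕ) (f : X → H) (hf : Measurable f) :
    Measure.QuasiMeasurePreserving
      (fun p : X × (Fin n → H) => (p.1, fun i => f p.1 * p.2 i))
      (ν.prod (Measure.pi fun _ => μ)) (ν.prod (Measure.pi fun _ => μ)) := by
  have h : MeasurePreserving (fun p : X × (Fin n → H) => (p.1, fun i => f p.1 * p.2 i))
      (ν.prod (Measure.pi fun _ => μ)) (ν.prod (Measure.pi fun _ => μ)) := by
    refine (MeasurePreserving.id ν).skew_product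
      (g := fun x (w : Fin n → H) i => f x * w i) ?_ ?_
    · refine measurable_pi_lambda _ fun i => ?_
      exact (hf.comp measurable_fst).mul ((measurable_pi_apply i).comp measurable_snd)
    · refine Filter.Eventually.of_forall fun x => ?_
      exact (measurePreserving_pi (fun _ => μ) (fun _ => μ)
        (f := fun _ : Fin n => fun y => f x * y) fun _ => measurePreserving_mul_left μ (f x)).map_eq
  exact h.quasiMeasurePreserving

/-- The consecutive quotients `w₀, w₀⁻¹ w₁, w₁⁻¹ w₂, …`. -/
def quotients {n : ℕ} (w : Fin n → H) (i : Fin n) : H :=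
  if h : (i : ℕ) = 0 then w i else (w ⟨i - 1, by omega⟩)⁻¹ * w i

/-- The partial products `g₀, g₀ g₁, g₀ g₁ g₂, …`. -/
def products {n : ℕ} (g : Fin n → H) (i : Fin n) : H :=
  (List.ofFn fun a : Fin (i + 1) => g ⟨a, by omega⟩).prod

theorem quotients_cons {n : ℕ} (a : H) (w : Fin n → H) :
    quotients (Fin.cons a w : Fin (n + 1) → H)
      = Fin.cons a (quotients fun i => a⁻¹ * w i) := by
  funext i
  refine Fin.cases (by simp [quotients]) (fun i => ?_) i
  simp only [quotients, Fin.val_succ, Nat.add_eq_zero_iff, one_ne_zero, and_false, dite_false,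
    Fin.cons_succ]
  split_ifs with h
  · have : (⟨(i : ℕ) + 1 - 1, by omega⟩ : Fin (n + 1)) = 0 := by ext; simp [h]
    rw [this]; simp
  · have : (⟨(i : ℕ) + 1 - 1, by omega⟩ : Fin (n + 1)) = Fin.succ ⟨i - 1, by omega⟩ := by
      ext; simp; omega
    rw [this, Fin.cons_succ]; simp [mul_assoc]

theorem products_cons {n : ℕ} (a : H) (g : Fin n → H) :
    products (Fin.cons a g : Fin (n + 1) → H) = Fin.cons a fun i => a * products g i := by
  funext i
  refine Fin.cases (by simp [products]) (fun i => ?_) i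
  simp only [products, Fin.cons_succ]
  have : (List.ofFn fun b : Fin ((i.succ : Fin (n + 1)) + 1) =>
      (Fin.cons a g : Fin (n + 1) → H) ⟨b, by omega⟩)
      = a :: List.ofFn fun b : Fin (i + 1) => g ⟨b, by omega⟩ := by
    rw [List.ofFn_succ]
    rfl
  rw [this, List.prod_cons]

/-- With the first entry split off, the map is a fibrewise left translation of the others followed
by the same map in fewer variables. -/
theorem quasiMeasurePreserving_quotients (n : ℕ) :
    Measure.QuasiMeasurePreserving (quotients : (Fin n → H) → Fin n → H)
      (Measure.pi fun _ => μ) (Measure.pi fun _ => μ) := by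
  induction n with
  | zero =>
    rw [Subsingleton.elim (quotients : (Fin 0 → H) → Fin 0 → H) id]
    exact .id _
  | succ n ih =>
    have h := (measurePreserving_cons μ n).quasiMeasurePreserving.comp
      ((QuasiMeasurePreserving.prodMap (.id μ) ih).comp
        ((quasiMeasurePreserving_smul_pi μ μ n _ measurable_inv).comp
          (measurePreserving_uncons μ n).quasiMeasurePreserving))
    convert h using 1
    funext w
    conv_lhs => rw [← Fin.cons_self_tail w, quotients_cons]
    rfl

theorem quasiMeasurePreserving_products (n : ℕ) :
    Measure.QuasiMeasurePreserving (products : (Fin n → H) → Fin n → H)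
      (Measure.pi fun _ => μ) (Measure.pi fun _ => μ) := by
  induction n with
  | zero =>
    rw [Subsingleton.elim (products : (Fin 0 → H) → Fin 0 → H) id]
    exact .id _
  | succ n ih =>
    have h := (measurePreserving_cons μ n).quasiMeasurePreserving.comp
      ((quasiMeasurePreserving_smul_pi μ μ n _ measurable_id).comp
        ((QuasiMeasurePreserving.prodMap (.id μ) ih).comp
          (measurePreserving_uncons μ n).quasiMeasurePreserving))
    convert h using 1
    funext w
    conv_lhs => rw [← Fin.cons_self_tail w, products_cons]
    rfl

end GroupMeasure

end

noncomputable section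

namespace MatchedPair

variable {G : Type*} [Group G] [TopologicalSpace G] [IsTopologicalGroup G] [LocallyCompactSpace G]
  [T2Space G] [SecondCountableTopology G] [MeasurableSpace G] [BorelSpace G]
  (M : MatchedPair G)

instance : SecondCountableTopology M.G₁ :=
  TopologicalSpace.Subtype.secondCountableTopology (M.G₁ : Set G)

instance : SecondCountableTopology M.G₂ :=
  TopologicalSpace.Subtype.secondCountableTopology (M.G₂ : Set G)

/-! ### The decomposition of almost all elements of `G` -/

theorem eq_of_mul_eq {g g' : M.G₁} {s s' : M.G₂} (h : (g : G) * s = g' * s') :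
    g = g' ∧ s = s' := by
  have := M.unique_square (s := 1) (g := g) (g' := g') (h := g) (t := 1) (t' := s * s'⁻¹)
    (by simp) (by simp [← mul_assoc, h])
  refine ⟨this.1, ?_⟩
  have h2 := this.2
  exact (mul_inv_eq_one.mp h2.symm)

/-- Lusin-Souslin: an injective Borel map between standard Borel spaces is an embedding. Hence
`G₁G₂` is Borel, and so is the decomposition of its elements. -/
theorem measurableEmbedding_mul :
    MeasurableEmbedding fun p : M.G₁ × M.G₂ => (p.1 : G) * p.2 := by
  have := standardBorelSpace_group G
  have : StandardBorelSpace M.G₁ := M.isClosed₁.measurableSet.standardBorel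
  have : StandardBorelSpace M.G₂ := M.isClosed₂.measurableSet.standardBorel
  refine Measurable.measurableEmbedding (by fun_prop) ?_
  intro p q h
  exact Prod.ext (M.eq_of_mul_eq h).1 (M.eq_of_mul_eq h).2

/-- The elements of `G₁ G₂`. -/
def Splits (x : G) : Prop := ∃ p : M.G₁ × M.G₂, (p.1 : G) * p.2 = x

open Classical in
/-- The components in `G₁` and `G₂` of an element of `G₁ G₂`. -/
def split (x : G) : M.G₁ × M.G₂ := if h : M.Splits x then h.choose else 1

variable {M}

theorem Splits.split_mul {x : G} (h : M.Splits x) :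
    ((M.split x).1 : G) * (M.split x).2 = x := by
  rw [split, dif_pos h]
  exact h.choose_spec

variable (M)

theorem splits_mul (g : M.G₁) (s : M.G₂) : M.Splits ((g : G) * s) := ⟨(g, s), rfl⟩

theorem split_mul (g : M.G₁) (s : M.G₂) : M.split ((g : G) * s) = (g, s) := by
  have := (M.splits_mul g s).split_mul
  exact Prod.ext (M.eq_of_mul_eq this).1 (M.eq_of_mul_eq this).2

theorem measurableSet_splits : MeasurableSet {x | M.Splits x} :=
  M.measurableEmbedding_mul.measurableSet_range

theorem measurable_split : Measurable M.split := by
  intro E hE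
  have h1 : M.split ⁻¹' E = ((fun p : M.G₁ × M.G₂ => (p.1 : G) * p.2) '' E)
      ∪ ({x | M.Splits x}ᶜ ∩ {_x | (1 : M.G₁ × M.G₂) ∈ E}) := by
    ext x
    by_cases hx : M.Splits x
    · obtain ⟨⟨g, s⟩, rfl⟩ := hx
      simp only [Set.mem_preimage, split_mul, Set.mem_union, Set.mem_image, Set.mem_inter_iff,
        Set.mem_compl_iff, Set.mem_ofPred_eq, splits_mul, not_true_eq_false, false_and, or_false]
      constructor
      · intro h; exact ⟨_, h, rfl⟩
      · rintro ⟨p, hp, h⟩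
        have := M.eq_of_mul_eq h
        rwa [← this.1, ← this.2]
    · have h2 : ¬ ∃ p ∈ E, ((p.1 : M.G₁) : G) * p.2 = x := fun ⟨p, _, hp⟩ => hx ⟨p, hp⟩
      have h3 : M.split x = 1 := dif_neg hx
      simp only [Set.mem_preimage, h3, Set.mem_union, Set.mem_image, h2,
        Set.mem_inter_iff, Set.mem_compl_iff, Set.mem_ofPred_eq, hx, not_false_eq_true, true_and,
        false_or]
  rw [h1]
  refine (M.measurableEmbedding_mul.measurableSet_image.mpr hE).union
    (M.measurableSet_splits.compl.inter ?_)
  exact MeasurableSet.const _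

theorem ae_splits : ∀ᵐ x ∂(Measure.haar : Measure G), M.Splits x := by
  rw [ae_iff]
  convert M.haar_compl using 2
  ext x
  simp only [Set.mem_ofPred_eq, Set.mem_compl_iff, Set.mem_mul, Splits]
  refine not_congr ⟨?_, ?_⟩
  · rintro ⟨p, rfl⟩; exact ⟨_, p.1.2, _, p.2.2, rfl⟩
  · rintro ⟨g, hg, s, hs, rfl⟩; exact ⟨(⟨g, hg⟩, ⟨s, hs⟩), rfl⟩

/-- The measure on `G₁ × G₂` obtained from a finite measure equivalent to Haar measure. -/
theorem image_null_iff {E : Set (M.G₁ × M.G₂)} (hE : MeasurableSet E) :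
    (Measure.haar : Measure G) ((fun p : M.G₁ × M.G₂ => (p.1 : G) * (p.2 : G)⁻¹) '' E) = 0 ↔
      ((Measure.haar : Measure M.G₁).prod (Measure.haar : Measure M.G₂)) E = 0 := by
  -- A finite measure with the null sets of Haar measure: its pull-back is then finite, as suits the
  -- uniqueness of the invariant measure class.
  obtain ⟨lam, hfin, h1, h2⟩ := exists_isFiniteMeasure_absolutelyContinuous (Measure.haar : Measure G)
  have hnull : ∀ s, lam s = 0 ↔ (Measure.haar : Measure G) s = 0 := fun s => ⟨fun h => h1 h, fun h => h2 h⟩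
  have hemb : MeasurableEmbedding fun p : M.G₁ × M.G₂ => (p.1 : G) * (p.2 : G)⁻¹ := by
    have := M.measurableEmbedding_mul.comp
      ((MeasurableEquiv.refl M.G₁).prodCongr (MeasurableEquiv.inv M.G₂)).measurableEmbedding
    convert this using 1
    rfl
  -- With the inverse on the second factor, a left translation of `G₁ × G₂` corresponds to a left
  -- translation by an element of `G₁` and a right translation by an element of `G₂`. Both preserve
  -- Haar null sets, so the pull-back is quasi-invariant.
  set ψ := fun p : M.G₁ × M.G₂ => (p.1 : G) * (p.2 : G)⁻¹ with hψ
  let ν : Measure (M.G₁ × M.G₂) := lam.comap ψ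
  have hν : ∀ E, ν E = lam (ψ '' E) := fun E => hemb.comap_apply lam E
  have : IsFiniteMeasure ν := ⟨by rw [hν]; exact measure_lt_top _ _⟩
  rw [← hnull, ← hν]
  have : MeasurableMul₂ (M.G₁ × M.G₂) :=
    ⟨((measurable_fst.comp measurable_fst).mul (measurable_fst.comp measurable_snd)).prodMk
      ((measurable_snd.comp measurable_fst).mul (measurable_snd.comp measurable_snd))⟩
  have : MeasurableInv (M.G₁ × M.G₂) :=
    ⟨(measurable_fst.inv).prodMk (measurable_snd.inv)⟩
  refine null_iff_of_quasiInvariant _ ν ?_ ?_ ?_ hE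
  · exact NeZero.ne _
  · intro h0
    have : lam (ψ '' Set.univ) = 0 := by rw [← hν, h0]; rfl
    rw [hnull] at this
    have h3 : ∀ᵐ x ∂(Measure.haar : Measure G), x ∉ ψ '' Set.univ := measure_eq_zero_iff_ae_notMem.mp this
    have : (ae (Measure.haar : Measure G)).NeBot := ae_neBot.mpr (NeZero.ne _)
    obtain ⟨x, hx, ⟨g, s⟩, rfl⟩ := (h3.and M.ae_splits).exists
    exact hx ⟨(g, s⁻¹), trivial, by simp [hψ]⟩
  · intro p E hE h0
    rw [hν, hnull] at h0 ⊢
    have h3 : ψ '' ((fun x => p * x) ⁻¹' E)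
        = (fun x => x * (p.2 : G)) ⁻¹' ((fun x => (p.1 : G) * x * (p.2 : G)⁻¹ * (p.2 : G)⁻¹) ⁻¹' (ψ '' E)) := by
      ext x
      simp only [Set.mem_image, Set.mem_preimage]
      constructor
      · rintro ⟨q, hq, rfl⟩
        exact ⟨_, hq, by simp [hψ, mul_assoc]⟩
      · rintro ⟨q, hq, h⟩
        refine ⟨p⁻¹ * q, by simpa using hq, ?_⟩
        have : x = (p.1 : G)⁻¹ * ψ q * p.2 := by rw [h]; group
        rw [this]
        simp [hψ, mul_assoc]
    have h4 : ψ '' ((fun x => p * x) ⁻¹' E)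
        = (fun x => (p.1 : G) * x) ⁻¹' ((fun x => x * (p.2 : G)⁻¹) ⁻¹' (ψ '' E)) := by
      rw [h3]
      ext x
      simp [mul_assoc]
    rw [h4, measure_preimage_mul, measure_mul_right_null]
    exact h0

theorem quasiMeasurePreserving_mul :
    Measure.QuasiMeasurePreserving (fun p : M.G₁ × M.G₂ => (p.1 : G) * p.2)
      ((Measure.haar : Measure M.G₁).prod (Measure.haar : Measure M.G₂)) Measure.haar := by
  have h1 : Measure.QuasiMeasurePreserving (fun p : M.G₁ × M.G₂ => (p.1 : G) * (p.2 : G)⁻¹)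
      ((Measure.haar : Measure M.G₁).prod (Measure.haar : Measure M.G₂)) Measure.haar := by
    have hm : Measurable fun p : M.G₁ × M.G₂ => (p.1 : G) * (p.2 : G)⁻¹ := by fun_prop
    refine ⟨hm, Measure.AbsolutelyContinuous.mk fun E hE h0 => ?_⟩
    rw [Measure.map_apply hm hE, ← M.image_null_iff (hm hE)]
    exact measure_mono_null (Set.image_preimage_subset _ _) h0
  have h2 := h1.comp (QuasiMeasurePreserving.prodMap
    (.id (Measure.haar : Measure M.G₁)) (quasiMeasurePreserving_inv (Measure.haar : Measure M.G₂)))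
  convert h2 using 1
  funext p
  simp

theorem quasiMeasurePreserving_split :
    Measure.QuasiMeasurePreserving M.split Measure.haar
      ((Measure.haar : Measure M.G₁).prod (Measure.haar : Measure M.G₂)) := by
  refine ⟨M.measurable_split, Measure.AbsolutelyContinuous.mk fun E hE h0 => ?_⟩
  rw [Measure.map_apply M.measurable_split hE]
  have hq := QuasiMeasurePreserving.prodMap
    (.id (Measure.haar : Measure M.G₁)) (quasiMeasurePreserving_inv (Measure.haar : Measure M.G₂))
  have h1 := hq.preimage_null h0
  rw [← M.image_null_iff (hq.measurable hE)] at h1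
  refine measure_mono_null (fun x hx => ?_) (measure_union_null h1 (ae_iff.mp M.ae_splits))
  by_cases h : M.Splits x
  · left
    refine ⟨((M.split x).1, (M.split x).2⁻¹), ?_, ?_⟩
    · simpa [Prod.map] using hx
    · simpa using h.split_mul
  · right; exact h

end MatchedPair

end

noncomputable section

/-! ### Faces and consecutive quotients -/

section Faces

variable {H : Type*} [Group H]

theorem succAbove_castSucc_of_lt {n : ℕ} {k : Fin (n + 1)} {j : Fin n} (h : (j : ℕ) < k) :
    k.succ.succAbove j.castSucc = j.castSucc.castSucc ∧
      k.succ.succAbove j.succ = j.castSucc.succ := by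
  constructor
  · rw [Fin.succAbove_of_castSucc_lt _ _ (by simp [Fin.lt_def]; omega)]
  · rw [Fin.succAbove_of_castSucc_lt _ _ (by simp [Fin.lt_def]; omega)]; ext; simp

/-- Consecutive quotients telescope: multiplying two adjacent edges omits the vertex between them.
All faces thereby become deletions of vertices. -/
theorem barFace_quot {n : ℕ} (k : Fin (n + 2)) (v : Fin (n + 2) → H) (j : Fin n) :
    barFace k (fun j : Fin (n + 1) => (v j.castSucc)⁻¹ * v j.succ) j
      = (v (k.succAbove j.castSucc))⁻¹ * v (k.succAbove j.succ) := by
  induction k using Fin.cases with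
  | zero => simp [barFace]
  | succ m =>
    simp only [barFace, Fin.cases_succ]
    rcases lt_trichotomy (j : ℕ) m with h | h | h
    · rw [Fin.contractNth_apply_of_lt _ _ _ _ h, (succAbove_castSucc_of_lt h).1,
        (succAbove_castSucc_of_lt h).2]
    · rw [Fin.contractNth_apply_of_eq _ _ _ _ h]
      have a : m.succ.succAbove j.succ = j.succ.succ := by
        rw [Fin.succAbove_of_le_castSucc _ _ (by simp [Fin.le_def]; omega)]
      have b : m.succ.succAbove j.castSucc = j.castSucc.castSucc := by
        rw [Fin.succAbove_of_castSucc_lt _ _ (by simp [Fin.lt_def]; omega)]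
      have c : (j.castSucc.succ : Fin (n + 2)) = j.succ.castSucc := by ext; simp
      rw [a, b, c, mul_assoc, mul_inv_cancel_left]
    · rw [Fin.contractNth_apply_of_gt _ _ _ _ h]
      have a : m.succ.succAbove j.succ = j.succ.succ := by
        rw [Fin.succAbove_of_le_castSucc _ _ (by simp [Fin.le_def]; omega)]
      have b : m.succ.succAbove j.castSucc = j.succ.castSucc := by
        rw [Fin.succAbove_of_le_castSucc _ _ (by simp [Fin.le_def]; omega)]; ext; simp
      rw [a, b]

theorem coe_barFace {K : Subgroup H} {n : ℕ} (k : Fin (n + 2)) (u : Fin (n + 1) → K) (j : Fin n) :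
    ((barFace k u j : K) : H) = barFace k (fun j => (u j : H)) j := by
  induction k using Fin.cases with
  | zero => simp [barFace]
  | succ m =>
    simp only [barFace, Fin.cases_succ, Fin.contractNth]
    split_ifs <;> simp

theorem partialProd_succ_eq_products {n : ℕ} (f : Fin n → H) (i : Fin n) :
    Fin.partialProd f i.succ = products f i := by
  rw [Fin.partialProd, products]
  congr 1
  apply List.ext_getElem
  · simp
  · intro k h1 h2
    rw [List.getElem_take, List.getElem_ofFn, List.getElem_ofFn]

end Faces

namespace MatchedPair

variable {G : Type*} [Group G] [TopologicalSpace G] [IsTopologicalGroup G] [LocallyCompactSpace G]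
  [T2Space G] [SecondCountableTopology G] [MeasurableSpace G] [BorelSpace G]
  (M : MatchedPair G)

/-! ### Vertices

An element `x` of `G` represents the row `x G₂` and the column `x G₁`. -/

/-- The row `x G₂` and the column `y G₁` intersect. -/
def Meet (x y : G) : Prop := M.Splits (y⁻¹ * x)

/-- The common element of the row `x G₂` and of the column `y G₁`. -/
def vtx (x y : G) : G := y * (M.split (y⁻¹ * x)).1

variable {M}

theorem Meet.row {x y : G} (h : M.Meet x y) : x⁻¹ * M.vtx x y ∈ M.G₂ := by
  have := h.split_mul
  have e : x⁻¹ * M.vtx x y = ((M.split (y⁻¹ * x)).2 : G)⁻¹ := by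
    have : x = y * ((M.split (y⁻¹ * x)).1 * (M.split (y⁻¹ * x)).2) := by rw [this]; group
    rw [vtx]
    nth_rewrite 1 [this]
    group
  rw [e]
  exact M.G₂.inv_mem (SetLike.coe_mem _)

variable (M)

theorem vtx_col (x y : G) : y⁻¹ * M.vtx x y ∈ M.G₁ := by
  simp [vtx]

/-- Two common elements of a row and a column differ by an element of `G₁ ∩ G₂`, so any common
element is the vertex. -/
theorem meet_and_vtx_eq {x y v : G} (h2 : x⁻¹ * v ∈ M.G₂) (h1 : y⁻¹ * v ∈ M.G₁) :
    M.Meet x y ∧ M.vtx x y = v := by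
  have e : y⁻¹ * x = ((⟨y⁻¹ * v, h1⟩ : M.G₁) : G) * ((⟨x⁻¹ * v, h2⟩ : M.G₂)⁻¹ : M.G₂) := by
    simp
  refine ⟨?_, ?_⟩
  · rw [Meet, e]; exact M.splits_mul _ _
  · rw [vtx, e, split_mul]; simp

@[simp] theorem vtx_self (x : G) : M.vtx x x = x :=
  (M.meet_and_vtx_eq (v := x) (by simp) (by simp)).2

theorem meet_smul (g x y : G) : M.Meet (g * x) (g * y) ↔ M.Meet x y := by
  simp [Meet, mul_assoc]

/-- Valid also where row and column do not meet, since the default value depends on `y⁻¹ * x` only.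
The shuffle homotopy is therefore equivariant on all lists, not just on generic ones. -/
theorem vtx_smul (g x y : G) : M.vtx (g * x) (g * y) = g * M.vtx x y := by
  simp [vtx, mul_assoc]

variable {M}

theorem Meet.congr {x x' y y' : G} (h : M.Meet x y) (hx : x⁻¹ * x' ∈ M.G₂) (hy : y⁻¹ * y' ∈ M.G₁) :
    M.Meet x' y' ∧ M.vtx x' y' = M.vtx x y := by
  refine M.meet_and_vtx_eq ?_ ?_
  · have := M.G₂.mul_mem (M.G₂.inv_mem hx) h.row
    simpa [mul_assoc] using this
  · have := M.G₁.mul_mem (M.G₁.inv_mem hy) (M.vtx_col x y)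
    simpa [mul_assoc] using this

variable (M)

theorem measurable_vtx : Measurable fun p : G × G => M.vtx p.1 p.2 := by
  have h : Measurable fun p : G × G => p.2⁻¹ * p.1 := measurable_snd.inv.mul measurable_fst
  exact measurable_snd.mul (measurable_subtype_coe.comp
    (measurable_fst.comp (M.measurable_split.comp h)))

theorem measurableSet_meet : MeasurableSet {p : G × G | M.Meet p.1 p.2} := by
  have h : Measurable fun p : G × G => p.2⁻¹ * p.1 := measurable_snd.inv.mul measurable_fst
  exact h M.measurableSet_splits

/-! ### Grids with given rows and columns -/

variable {p q : ℕ}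

/-- All given rows and columns intersect. -/
def Good (x : Fin (p + 1) → G) (y : Fin (q + 1) → G) : Prop := ∀ i j, M.Meet (x i) (y j)

open Classical in
/-- The grid with given rows and columns. -/
def grid (x : Fin (p + 1) → G) (y : Fin (q + 1) → G) : M.Gam p q :=
  if h : M.Good x y then
    ⟨(fun i j => ⟨(M.vtx (x i.castSucc) (y j))⁻¹ * M.vtx (x i.succ) (y j), by
        have := M.G₁.mul_mem (M.G₁.inv_mem (M.vtx_col (x i.castSucc) (y j)))
          (M.vtx_col (x i.succ) (y j))
        simpa [mul_assoc] using this⟩,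
      fun i j => ⟨(M.vtx (x i) (y j.castSucc))⁻¹ * M.vtx (x i) (y j.succ), by
        have := M.G₂.mul_mem (M.G₂.inv_mem (h i j.castSucc).row) (h i j.succ).row
        simpa [mul_assoc] using this⟩),
      fun i j => by simp [mul_assoc]⟩
  else M.unitGrid p q

variable {M}

theorem Good.coe_vert {x : Fin (p + 1) → G} {y : Fin (q + 1) → G} (h : M.Good x y) (i : Fin p)
    (j : Fin (q + 1)) : ((M.grid x y).vert i j : G)
      = (M.vtx (x i.castSucc) (y j))⁻¹ * M.vtx (x i.succ) (y j) := by
  simp only [grid, dif_pos h, Gam.vert]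

theorem Good.coe_horiz {x : Fin (p + 1) → G} {y : Fin (q + 1) → G} (h : M.Good x y)
    (i : Fin (p + 1)) (j : Fin q) : ((M.grid x y).horiz i j : G)
      = (M.vtx (x i) (y j.castSucc))⁻¹ * M.vtx (x i) (y j.succ) := by
  simp only [grid, dif_pos h, Gam.horiz]

theorem Gam.ext' {X Y : M.Gam p q} (h1 : ∀ i j, (X.vert i j : G) = Y.vert i j)
    (h2 : ∀ i j, (X.horiz i j : G) = Y.horiz i j) : X = Y := by
  refine Subtype.ext (Prod.ext ?_ ?_)
  · funext i j; exact Subtype.ext (h1 i j)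
  · funext i j; exact Subtype.ext (h2 i j)

/-- The vertices depend on the cosets only. This freedom in the representatives is what the Fubini
arguments for `Γ_pq` exploit. -/
theorem Good.congr {x x' : Fin (p + 1) → G} {y y' : Fin (q + 1) → G} (h : M.Good x y)
    (hx : ∀ i, (x i)⁻¹ * x' i ∈ M.G₂) (hy : ∀ j, (y j)⁻¹ * y' j ∈ M.G₁) :
    M.Good x' y' ∧ M.grid x' y' = M.grid x y := by
  have h' : M.Good x' y' := fun i j => ((h i j).congr (hx i) (hy j)).1
  have e : ∀ i j, M.vtx (x' i) (y' j) = M.vtx (x i) (y j) :=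
    fun i j => ((h i j).congr (hx i) (hy j)).2
  refine ⟨h', Gam.ext' (fun i j => ?_) fun i j => ?_⟩
  · rw [h.coe_vert, h'.coe_vert, e, e]
  · rw [h.coe_horiz, h'.coe_horiz, e, e]

theorem good_congr_iff {x x' : Fin (p + 1) → G} {y y' : Fin (q + 1) → G}
    (hx : ∀ i, (x i)⁻¹ * x' i ∈ M.G₂) (hy : ∀ j, (y j)⁻¹ * y' j ∈ M.G₁) :
    M.Good x y ↔ M.Good x' y' := by
  refine ⟨fun h => (h.congr hx hy).1, fun h => (h.congr (fun i => ?_) fun j => ?_).1⟩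
  · have := M.G₂.inv_mem (hx i); simpa using this
  · have := M.G₁.inv_mem (hy j); simpa using this

variable (M)

theorem good_smul (g : G) (x : Fin (p + 1) → G) (y : Fin (q + 1) → G) :
    M.Good (fun i => g * x i) (fun j => g * y j) ↔ M.Good x y := by
  simp only [Good, meet_smul]

variable {M}

theorem Good.grid_smul {x : Fin (p + 1) → G} {y : Fin (q + 1) → G} (h : M.Good x y) (g : G) :
    M.grid (fun i => g * x i) (fun j => g * y j) = M.grid x y := by
  have h' := (M.good_smul g x y).mpr h
  refine Gam.ext' (fun i j => ?_) fun i j => ?_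
  · rw [h.coe_vert, h'.coe_vert, vtx_smul, vtx_smul]; simp [mul_assoc]
  · rw [h.coe_horiz, h'.coe_horiz, vtx_smul, vtx_smul]; simp [mul_assoc]

/-- The vertex `(i, j)` of a grid whose top left vertex is the unit. -/
def Gam.vertex (X : M.Gam p q) (i : Fin (p + 1)) (j : Fin (q + 1)) : G :=
  Fin.partialProd (fun a => (X.vert a 0 : G)) i * Fin.partialProd (fun b => (X.horiz i b : G)) j

theorem Gam.vertex_succ_right (X : M.Gam p q) (i : Fin (p + 1)) (j : Fin q) :
    X.vertex i j.succ = X.vertex i j.castSucc * X.horiz i j := by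
  rw [vertex, vertex, Fin.partialProd_succ, mul_assoc]

theorem Gam.vertex_succ_left (X : M.Gam p q) (i : Fin p) (j : Fin (q + 1)) :
    X.vertex i.succ j = X.vertex i.castSucc j * X.vert i j := by
  induction j using Fin.induction with
  | zero => simp [vertex, Fin.partialProd_succ]
  | succ j ih =>
    have := X.2 i j
    rw [vertex_succ_right, ih, vertex_succ_right, mul_assoc, mul_assoc]
    congr 1
    exact this.symm

theorem Gam.vertex_col (X : M.Gam p q) (i : Fin (p + 1)) (j : Fin (q + 1)) :
    (X.vertex 0 j)⁻¹ * X.vertex i j ∈ M.G₁ := by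
  induction i using Fin.induction with
  | zero => simp
  | succ i ih =>
    rw [vertex_succ_left, ← mul_assoc]
    exact M.G₁.mul_mem ih (SetLike.coe_mem _)

theorem Gam.vertex_row (X : M.Gam p q) (i : Fin (p + 1)) (j : Fin (q + 1)) :
    (X.vertex i 0)⁻¹ * X.vertex i j ∈ M.G₂ := by
  induction j using Fin.induction with
  | zero => simp
  | succ j ih =>
    rw [vertex_succ_right, ← mul_assoc]
    exact M.G₂.mul_mem ih (SetLike.coe_mem _)

/-- A row is determined by any one of its vertices, and so is a column. One vertex on each thus
suffices to recover the grid; it may lie on the left column, the top row or the diagonal. -/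
theorem Gam.good_and_grid_eq (X : M.Gam p q) (c : G) (x : Fin (p + 1) → G) (y : Fin (q + 1) → G)
    (hx : ∀ i, ∃ j, (x i)⁻¹ * (c * X.vertex i j) ∈ M.G₂)
    (hy : ∀ j, ∃ i, (y j)⁻¹ * (c * X.vertex i j) ∈ M.G₁) :
    M.Good x y ∧ M.grid x y = X ∧ ∀ i j, M.vtx (x i) (y j) = c * X.vertex i j := by
  have hx' : ∀ i j, (x i)⁻¹ * (c * X.vertex i j) ∈ M.G₂ := by
    intro i j
    obtain ⟨j', h⟩ := hx i
    have := M.G₂.mul_mem h (M.G₂.mul_mem (M.G₂.inv_mem (X.vertex_row i j')) (X.vertex_row i j))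
    simpa [mul_assoc] using this
  have hy' : ∀ i j, (y j)⁻¹ * (c * X.vertex i j) ∈ M.G₁ := by
    intro i j
    obtain ⟨i', h⟩ := hy j
    have := M.G₁.mul_mem h (M.G₁.mul_mem (M.G₁.inv_mem (X.vertex_col i' j)) (X.vertex_col i j))
    simpa [mul_assoc] using this
  have hG : M.Good x y := fun i j => (M.meet_and_vtx_eq (hx' i j) (hy' i j)).1
  have hv : ∀ i j, M.vtx (x i) (y j) = c * X.vertex i j :=
    fun i j => (M.meet_and_vtx_eq (hx' i j) (hy' i j)).2
  refine ⟨hG, Gam.ext' (fun i j => ?_) fun i j => ?_, hv⟩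
  · rw [hG.coe_vert, hv, hv, vertex_succ_left]; simp [mul_assoc]
  · rw [hG.coe_horiz, hv, hv, vertex_succ_right]; simp [mul_assoc]

theorem Gam.good_and_grid_vertex (X : M.Gam p q) :
    M.Good (fun i => X.vertex i 0) (fun j => X.vertex 0 j) ∧
      M.grid (fun i => X.vertex i 0) (fun j => X.vertex 0 j) = X ∧
      ∀ i j, M.vtx (X.vertex i 0) (X.vertex 0 j) = X.vertex i j := by
  have := X.good_and_grid_eq 1 (fun i => X.vertex i 0) (fun j => X.vertex 0 j)
    (fun i => ⟨0, by simp⟩) (fun j => ⟨0, by simp⟩)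
  simpa using this

theorem Good.vtx_eq {x : Fin (p + 1) → G} {y : Fin (q + 1) → G} (h : M.Good x y)
    (i : Fin (p + 1)) (j : Fin (q + 1)) :
    M.vtx (x i) (y j) = M.vtx (x 0) (y 0) * (M.grid x y).vertex i j := by
  have h1 : ∀ i, M.vtx (x i) (y 0) = M.vtx (x 0) (y 0) * (M.grid x y).vertex i 0 := by
    intro i
    induction i using Fin.induction with
    | zero => simp [Gam.vertex]
    | succ i ih => rw [Gam.vertex_succ_left, ← mul_assoc, ← ih, h.coe_vert]; simp
  induction j using Fin.induction with
  | zero => exact h1 i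
  | succ j ih => rw [Gam.vertex_succ_right, ← mul_assoc, ← ih, h.coe_horiz]; simp

/-! ### Faces, corners and diagonals of a grid -/

theorem Good.comp {x : Fin (p + 1) → G} {y : Fin (q + 1) → G} (h : M.Good x y) {p' q' : ℕ}
    (f : Fin (p' + 1) → Fin (p + 1)) (g : Fin (q' + 1) → Fin (q + 1)) :
    M.Good (x ∘ f) (y ∘ g) := fun i j => h (f i) (g j)

theorem Good.hFace_grid {x : Fin (p + 1) → G} {y : Fin (q + 2) → G} (h : M.Good x y)
    (k : Fin (q + 2)) : M.hFace p q k (M.grid x y) = M.grid x (y ∘ k.succAbove) := by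
  have h' : M.Good x (y ∘ k.succAbove) := h.comp id k.succAbove
  refine Gam.ext' (fun i j => ?_) fun i j => ?_
  · rw [h'.coe_vert]
    exact h.coe_vert i (k.succAbove j)
  · rw [h'.coe_horiz]
    change ((barFace k ((M.grid x y).horiz i) j : M.G₂) : G) = _
    rw [coe_barFace]
    simp only [h.coe_horiz]
    exact barFace_quot k (fun j => M.vtx (x i) (y j)) j

theorem Good.vFace_grid {x : Fin (p + 2) → G} {y : Fin (q + 1) → G} (h : M.Good x y)
    (k : Fin (p + 2)) : M.vFace p q k (M.grid x y) = M.grid (x ∘ k.succAbove) y := by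
  have h' : M.Good (x ∘ k.succAbove) y := h.comp k.succAbove id
  refine Gam.ext' (fun i j => ?_) fun i j => ?_
  · rw [h'.coe_vert]
    change ((barFace k (fun a => (M.grid x y).vert a j) i : M.G₁) : G) = _
    rw [coe_barFace]
    simp only [h.coe_vert]
    exact barFace_quot k (fun i => M.vtx (x i) (y j)) i
  · rw [h'.coe_horiz]
    exact h.coe_horiz (k.succAbove i) j

theorem Good.corner_grid {n : ℕ} {x y : Fin (n + 1) → G} (h : M.Good x y) (hpq : p + q = n) :
    M.corner n p q hpq (M.grid x y) =
      M.grid (fun i : Fin (p + 1) => x ⟨q + i, by omega⟩) (fun j : Fin (q + 1) => y ⟨j, by omega⟩) := by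
  have h' : M.Good (fun i : Fin (p + 1) => x ⟨q + i, by omega⟩)
    (fun j : Fin (q + 1) => y ⟨j, by omega⟩) := fun i j => h _ _
  refine Gam.ext' (fun i j => ?_) fun i j => ?_
  · rw [h'.coe_vert]
    exact h.coe_vert ⟨q + i, by omega⟩ ⟨j, by omega⟩
  · rw [h'.coe_horiz]
    exact h.coe_horiz ⟨q + i, by omega⟩ ⟨j, by omega⟩

theorem Good.diag_grid {n : ℕ} {x y : Fin (n + 1) → G} (h : M.Good x y) (k : Fin n) :
    M.diag n (M.grid x y) k
      = (M.vtx (x k.castSucc) (y k.castSucc))⁻¹ * M.vtx (x k.succ) (y k.succ) := by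
  rw [diag, h.coe_horiz, h.coe_vert]
  simp [mul_assoc]

theorem Gam.vertex_diag {n : ℕ} (X : M.Gam n n) (k : Fin (n + 1)) :
    X.vertex k k = Fin.partialProd (M.diag n X) k := by
  induction k using Fin.induction with
  | zero => simp [vertex]
  | succ k ih =>
    rw [Fin.partialProd_succ, ← ih, vertex_succ_left, vertex_succ_right, diag, mul_assoc]

/-- Every row and every column of a square grid contains a diagonal vertex, and the diagonal
vertices are the partial products of the diagonals. So a single list of points gives both the rows
and the columns of `X(x₁, …, xₙ)`. -/
theorem Gam.grid_diag {n : ℕ} (X : M.Gam n n) :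
    M.Good (Fin.partialProd (M.diag n X)) (Fin.partialProd (M.diag n X)) ∧
      M.grid (Fin.partialProd (M.diag n X)) (Fin.partialProd (M.diag n X)) = X := by
  have := X.good_and_grid_eq 1 (Fin.partialProd (M.diag n X)) (Fin.partialProd (M.diag n X))
    (fun i => ⟨i, by simp [vertex_diag]⟩) (fun i => ⟨i, by simp [vertex_diag]⟩)
  exact ⟨this.1, this.2.1⟩

variable (M)

theorem diag_injective (n : ℕ) : Function.Injective (M.diag n) := by
  intro X Y h
  rw [← X.grid_diag.2, ← Y.grid_diag.2, h]

variable {M}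

theorem Good.ofDiag_eq {n : ℕ} {z : Fin (n + 1) → G} (h : M.Good z z) :
    M.ofDiag n (fun k => (z k.castSucc)⁻¹ * z k.succ) = M.grid z z := by
  have h1 : ∃ X : M.Gam n n, M.diag n X = fun k => (z k.castSucc)⁻¹ * z k.succ :=
    ⟨M.grid z z, funext fun k => by simp [h.diag_grid]⟩
  refine M.diag_injective n ?_
  rw [ofDiag, dif_pos h1, h1.choose_spec]
  funext k
  simp [h.diag_grid]

theorem leftProd_eq {n q : ℕ} (h : q ≤ n) (X : M.Gam n n) :
    M.leftProd n q h X = X.vertex ⟨q, by omega⟩ 0 := by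
  rw [leftProd, Gam.vertex, Fin.partialProd_zero, mul_one, Fin.partialProd]
  congr 1
  apply List.ext_getElem
  · simp; omega
  · intro k h1 h2
    rw [List.getElem_take, List.getElem_ofFn, List.getElem_ofFn]

variable (M)

theorem measurableSet_good : MeasurableSet {z : (Fin (p + 1) → G) × (Fin (q + 1) → G) |
    M.Good z.1 z.2} := by
  simp only [Good, Set.ofPred_forall]
  refine MeasurableSet.iInter fun i => MeasurableSet.iInter fun j => ?_
  have h : Measurable fun z : (Fin (p + 1) → G) × (Fin (q + 1) → G) => (z.1 i, z.2 j) := by fun_prop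
  exact h M.measurableSet_meet

theorem measurable_grid : Measurable fun z : (Fin (p + 1) → G) × (Fin (q + 1) → G) =>
    M.grid z.1 z.2 := by
  classical
  have hv : ∀ i j, Measurable fun z : (Fin (p + 1) → G) × (Fin (q + 1) → G) =>
      M.vtx (z.1 i) (z.2 j) := by
    intro i j
    have h : Measurable fun z : (Fin (p + 1) → G) × (Fin (q + 1) → G) => (z.1 i, z.2 j) := by
      fun_prop
    exact M.measurable_vtx.comp h
  refine Measurable.subtype_mk (h := fun z => (M.grid z.1 z.2).2)
    (f := fun z : (Fin (p + 1) → G) × (Fin (q + 1) → G) => (M.grid z.1 z.2).1) ?_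
  refine Measurable.prodMk ?_ ?_
  · refine measurable_pi_lambda _ fun i => measurable_pi_lambda _ fun j => ?_
    refine Measurable.subtype_mk (h := fun z => ((M.grid z.1 z.2).vert i j).2)
      (f := fun z : (Fin (p + 1) → G) × (Fin (q + 1) → G) => ((M.grid z.1 z.2).vert i j : G)) ?_
    have : (fun z : (Fin (p + 1) → G) × (Fin (q + 1) → G) => ((M.grid z.1 z.2).vert i j : G))
        = fun z => if M.Good z.1 z.2 then
          (M.vtx (z.1 i.castSucc) (z.2 j))⁻¹ * M.vtx (z.1 i.succ) (z.2 j) else 1 := by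
      funext z
      split_ifs with h
      · exact h.coe_vert i j
      · simp only [grid, dif_neg h]; rfl
    rw [this]
    exact Measurable.ite M.measurableSet_good ((hv _ _).inv.mul (hv _ _)) measurable_const
  · refine measurable_pi_lambda _ fun i => measurable_pi_lambda _ fun j => ?_
    refine Measurable.subtype_mk (h := fun z => ((M.grid z.1 z.2).horiz i j).2)
      (f := fun z : (Fin (p + 1) → G) × (Fin (q + 1) → G) => ((M.grid z.1 z.2).horiz i j : G)) ?_
    have : (fun z : (Fin (p + 1) → G) × (Fin (q + 1) → G) => ((M.grid z.1 z.2).horiz i j : G))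
        = fun z => if M.Good z.1 z.2 then
          (M.vtx (z.1 i) (z.2 j.castSucc))⁻¹ * M.vtx (z.1 i) (z.2 j.succ) else 1 := by
      funext z
      split_ifs with h
      · exact h.coe_horiz i j
      · simp only [grid, dif_neg h]; rfl
    rw [this]
    exact Measurable.ite M.measurableSet_good ((hv _ _).inv.mul (hv _ _)) measurable_const

end MatchedPair

end

noncomputable section

/-! ### Rearrangements of products and fibrewise nonsingular maps -/

section Nonsingular

variable {α β γ δ : Type*} [MeasurableSpace α] [MeasurableSpace β] [MeasurableSpace γ]
  [MeasurableSpace δ]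

theorem measurePreserving_prod_comm_middle (μ : Measure α) (ν : Measure β) (ρ : Measure γ)
    (τ : Measure δ) [SFinite μ] [SFinite ν] [SFinite ρ] [SFinite τ] :
    MeasurePreserving (fun x : (α × β) × (γ × δ) => ((x.1.1, x.2.1), (x.1.2, x.2.2)))
      ((μ.prod ν).prod (ρ.prod τ)) ((μ.prod ρ).prod (ν.prod τ)) := by
  have h1 := measurePreserving_prodAssoc μ ν (ρ.prod τ)
  have h2 := (MeasurePreserving.id μ).prod (measurePreserving_prodAssoc ν ρ τ).symm
  have h3 := (MeasurePreserving.id μ).prod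
    ((Measure.measurePreserving_swap (μ := ν) (ν := ρ)).prod (MeasurePreserving.id τ))
  have h4 := (MeasurePreserving.id μ).prod (measurePreserving_prodAssoc ρ ν τ)
  have h5 := (measurePreserving_prodAssoc μ ρ (ν.prod τ)).symm
  exact h5.comp (h4.comp (h3.comp (h2.comp h1)))

/-- Only the fibres over `β` have to be nonsingular: Fubini is applied in one order for the target
and in the other for the source. -/
theorem quasiMeasurePreserving_skew {α' : Type*} [MeasurableSpace α'] {μ : Measure α}
    {μ' : Measure α'} {ν : Measure β} [SFinite μ] [SFinite μ'] [SFinite ν] {g : α × β → α'}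
    (hg : Measurable g) (h : ∀ y, Measure.QuasiMeasurePreserving (fun x => g (x, y)) μ μ') :
    Measure.QuasiMeasurePreserving (fun p => (g p, p.2)) (μ.prod ν) (μ'.prod ν) := by
  have hm : Measurable fun p : α × β => (g p, p.2) := hg.prodMk measurable_snd
  refine ⟨hm, Measure.AbsolutelyContinuous.mk fun E hE h0 => ?_⟩
  rw [Measure.map_apply hm hE]
  have h1 : ∀ᵐ x ∂μ', ∀ᵐ y ∂ν, (x, y) ∉ E :=
    Measure.ae_ae_of_ae_prod (measure_eq_zero_iff_ae_notMem.mp h0)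
  rw [Measure.ae_ae_comm (p := fun x y => (x, y) ∉ E) hE.compl] at h1
  have h2 : ∀ᵐ y ∂ν, ∀ᵐ x ∂μ, (g (x, y), y) ∉ E := h1.mono fun y hy => (h y).ae hy
  rw [← Measure.ae_ae_comm (p := fun x y => (g (x, y), y) ∉ E) (hm hE.compl)] at h2
  have h3 := (Measure.ae_prod_iff_ae_ae (μ := μ) (ν := ν) (p := fun p => (g p, p.2) ∉ E)
    (hm hE.compl)).mpr h2
  exact measure_eq_zero_iff_ae_notMem.mpr h3

theorem measurePreserving_zip (μ : Measure α) (ν : Measure β) [SigmaFinite μ] [SigmaFinite ν]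
    (n : ℕ) : MeasurePreserving (fun (p : (Fin n → α) × (Fin n → β)) i => (p.1 i, p.2 i))
      ((Measure.pi fun _ => μ).prod (Measure.pi fun _ => ν)) (Measure.pi fun _ => μ.prod ν) :=
  (measurePreserving_arrowProdEquivProdArrow α β (Fin n) (fun _ => μ) fun _ => ν).symm

theorem measurePreserving_unzip (μ : Measure α) (ν : Measure β) [SigmaFinite μ] [SigmaFinite ν]
    (n : ℕ) : MeasurePreserving (fun (p : Fin n → α × β) => (fun i => (p i).1, fun i => (p i).2))
      (Measure.pi fun _ => μ.prod ν) ((Measure.pi fun _ => μ).prod (Measure.pi fun _ => ν)) :=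
  measurePreserving_arrowProdEquivProdArrow α β (Fin n) (fun _ => μ) fun _ => ν

end Nonsingular

section Products

variable {H : Type*} [Group H]

theorem coe_products {K : Subgroup H} {n : ℕ} (g : Fin n → K) (i : Fin n) :
    ((products g i : K) : H) = products (fun i => (g i : H)) i := by
  simp only [products]
  rw [← Subgroup.coe_subtype, map_list_prod, List.map_ofFn]
  rfl

theorem cons_one_quotients {n : ℕ} (u : Fin n → H) (i : Fin n) :
    ((Fin.cons 1 u : Fin (n + 1) → H) i.castSucc)⁻¹ * (Fin.cons 1 u : Fin (n + 1) → H) i.succ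
      = quotients u i := by
  rw [Fin.cons_succ, quotients]
  split_ifs with h
  · have : i.castSucc = 0 := by ext; simpa using h
    rw [this]; simp
  · have : i.castSucc = Fin.succ (⟨i - 1, by omega⟩ : Fin n) := by ext; simp; omega
    rw [this, Fin.cons_succ]

end Products

instance (G : Type*) [Group G] [TopologicalSpace G] [IsTopologicalGroup G] [LocallyCompactSpace G]
    [T2Space G] [SecondCountableTopology G] [MeasurableSpace G] [BorelSpace G] (n : ℕ) :
    SigmaFinite (haarPow G n) :=
  inferInstanceAs (SigmaFinite (Measure.pi fun _ : Fin n => (Measure.haar : Measure G)))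

namespace MatchedPair

variable {G : Type*} [Group G] [TopologicalSpace G] [IsTopologicalGroup G] [LocallyCompactSpace G]
  [T2Space G] [SecondCountableTopology G] [MeasurableSpace G] [BorelSpace G]
  (M : MatchedPair G) {p q : ℕ}

/-! ### The measure class of `Γ_pq` in terms of rows and columns -/

/-- The product of Haar measures on `G₁^p × G₂^q`. -/
abbrev haarProd (p q : ℕ) : Measure ((Fin p → M.G₁) × (Fin q → M.G₂)) :=
  (Measure.pi fun _ : Fin p => (Measure.haar : Measure M.G₁)).prod
    (Measure.pi fun _ : Fin q => (Measure.haar : Measure M.G₂))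

variable {M} in
/-- A tuple in a subgroup as a tuple in `G`, with the unit put in front. -/
def base {K : Subgroup G} {n : ℕ} (u : Fin n → K) : Fin (n + 1) → G := Fin.cons 1 fun i => (u i : G)

theorem Good.leftTop_grid {u : Fin p → M.G₁} {w : Fin q → M.G₂} (h : M.Good (base u) (base w)) :
    M.leftTop p q (M.grid (base u) (base w)) = (quotients u, quotients w) := by
  have hu : ∀ i, M.vtx (base u i) (base w 0) = base u i := by
    intro i
    refine (M.meet_and_vtx_eq (v := base u i) (by simp) ?_).2
    refine Fin.cases ?_ (fun i => ?_) i <;> simp [base]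
  have hw : ∀ j, M.vtx (base u 0) (base w j) = base w j := by
    intro j
    refine (M.meet_and_vtx_eq (v := base w j) ?_ (by simp)).2
    refine Fin.cases ?_ (fun i => ?_) j <;> simp [base]
  refine Prod.ext (funext fun i => Subtype.ext ?_) (funext fun j => Subtype.ext ?_)
  · refine (h.coe_vert i 0).trans ?_
    rw [hu, hu, base, cons_one_quotients]
    simp only [quotients]
    split_ifs <;> simp
  · refine (h.coe_horiz 0 j).trans ?_
    rw [hw, hw, base, cons_one_quotients]
    simp only [quotients]
    split_ifs <;> simp

theorem good_base_leftTop (X : M.Gam p q) :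
    M.Good (base (products (M.leftTop p q X).1)) (base (products (M.leftTop p q X).2)) ∧
      M.grid (base (products (M.leftTop p q X).1)) (base (products (M.leftTop p q X).2)) = X := by
  have h1 : base (products (M.leftTop p q X).1) = fun i => X.vertex i 0 := by
    funext i
    refine Fin.cases (by simp [base, Gam.vertex]) (fun i => ?_) i
    simp only [base, Fin.cons_succ, coe_products, Gam.vertex, Fin.partialProd_zero, mul_one,
      partialProd_succ_eq_products]
    rfl
  have h2 : base (products (M.leftTop p q X).2) = fun j => X.vertex 0 j := by
    funext j
    refine Fin.cases (by simp [base, Gam.vertex]) (fun j => ?_) j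
    simp only [base, Fin.cons_succ, coe_products, Gam.vertex, Fin.partialProd_zero, one_mul,
      partialProd_succ_eq_products]
    rfl
  rw [h1, h2]
  exact ⟨X.good_and_grid_vertex.1, X.good_and_grid_vertex.2.1⟩

/-- Partial products turn the left column and the top row of edges into vertices, with the unit in
the corner, and consecutive quotients go back. Both are nonsingular, so the transported measure on
`Γ_pq` has the null sets of rows and columns through the unit vertex. -/
theorem ae_measure_iff {P : M.Gam p q → Prop} :
    (∀ᵐ X ∂(M.measure p q), P X) ↔
      ∀ᵐ z ∂(M.haarProd p q), M.Good (base z.1) (base z.2) → P (M.grid (base z.1) (base z.2)) := by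
  have e : (∀ᵐ X ∂(M.measure p q), P X) ↔ M.haarProd p q (M.leftTop p q '' {X | ¬ P X}) = 0 := by
    rw [ae_iff, measure, (M.measurableEmbedding_leftTop p q).comap_apply]
  rw [e]
  constructor
  · intro h
    have hq := QuasiMeasurePreserving.prodMap
      (quasiMeasurePreserving_quotients (Measure.haar : Measure M.G₁) p)
      (quasiMeasurePreserving_quotients (Measure.haar : Measure M.G₂) q)
    have h1 := hq.ae (measure_eq_zero_iff_ae_notMem.mp h)
    filter_upwards [h1] with z hz hG
    by_contra hP
    exact hz ⟨_, hP, hG.leftTop_grid⟩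
  · intro h
    have hq := QuasiMeasurePreserving.prodMap
      (quasiMeasurePreserving_products (Measure.haar : Measure M.G₁) p)
      (quasiMeasurePreserving_products (Measure.haar : Measure M.G₂) q)
    have h1 := hq.ae h
    refine measure_eq_zero_iff_ae_notMem.mpr ?_
    filter_upwards [h1] with z hz
    rintro ⟨X, hX, rfl⟩
    have h2 := M.good_base_leftTop X
    have h3 := hz h2.1
    exact hX (h2.2 ▸ h3)

theorem ae_meet : ∀ᵐ z ∂((Measure.haar : Measure G).prod (Measure.haar : Measure G)),
    M.Meet z.1 z.2 := by
  have hq : Measure.QuasiMeasurePreserving (fun z : G × G => z.2⁻¹ * z.1)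
      ((Measure.haar : Measure G).prod (Measure.haar : Measure G)) Measure.haar := by
    refine QuasiMeasurePreserving.prod_of_left (measurable_snd.inv.mul measurable_fst) ?_
    exact Filter.Eventually.of_forall fun y =>
      (measurePreserving_mul_left _ y⁻¹).quasiMeasurePreserving
  exact hq.ae M.ae_splits

theorem quasiMeasurePreserving_mul_left_pi (n : ℕ) (g : G) :
    Measure.QuasiMeasurePreserving (fun (w : Fin n → G) i => g * w i) (haarPow G n) (haarPow G n) :=
  quasiMeasurePreserving_pi (measurePreserving_mul_left _ g).quasiMeasurePreserving n

/-- The map that sends independent rows and columns to the rows and columns through the unit. -/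
theorem ae_good_and_of_ae {P : M.Gam p q → Prop} (h : ∀ᵐ X ∂(M.measure p q), P X) (x₀ y₀ : G)
    (h₀ : M.Meet x₀ y₀) :
    ∀ᵐ z ∂((haarPow G p).prod (haarPow G q)),
      M.Good (Fin.cons x₀ z.1 : Fin (p + 1) → G) (Fin.cons y₀ z.2 : Fin (q + 1) → G) →
        P (M.grid (Fin.cons x₀ z.1 : Fin (p + 1) → G) (Fin.cons y₀ z.2 : Fin (q + 1) → G)) := by
  rw [ae_measure_iff] at h
  have hs1 : Measure.QuasiMeasurePreserving (fun x : G => (M.split x).1) Measure.haar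
      (Measure.haar : Measure M.G₁) := QuasiMeasurePreserving.fst M.quasiMeasurePreserving_split
  -- A column matters modulo `G₁` on the right, so its representative in `G₂` comes from a
  -- decomposition in `G₂G₁`. Decomposing the inverse in `G₁G₂` provides it.
  have hs2 : Measure.QuasiMeasurePreserving (fun x : G => (M.split x⁻¹).2⁻¹) Measure.haar
      (Measure.haar : Measure M.G₂) :=
    (quasiMeasurePreserving_inv (Measure.haar : Measure M.G₂)).comp
      ((QuasiMeasurePreserving.snd M.quasiMeasurePreserving_split).comp
        (quasiMeasurePreserving_inv (Measure.haar : Measure G)))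
  set v := M.vtx x₀ y₀ with hv
  have hq1 := (quasiMeasurePreserving_pi hs1 p).comp (quasiMeasurePreserving_mul_left_pi p v⁻¹)
  have hq2 := (quasiMeasurePreserving_pi hs2 q).comp (quasiMeasurePreserving_mul_left_pi q v⁻¹)
  have h1 := (QuasiMeasurePreserving.prodMap hq1 hq2).ae h
  have hsp : ∀ n, ∀ᵐ x ∂(haarPow G n), ∀ i, M.Splits (v⁻¹ * x i) ∧ M.Splits (v⁻¹ * x i)⁻¹ := by
    intro n
    rw [ae_all_iff]
    intro i
    have := Measure.quasiMeasurePreserving_eval (μ := fun _ : Fin n => (Measure.haar : Measure G)) i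
    have h2 := (measurePreserving_mul_left (Measure.haar : Measure G) v⁻¹).quasiMeasurePreserving
    have h3 := h2.comp this
    have h4 := (quasiMeasurePreserving_inv (Measure.haar : Measure G)).comp h3
    filter_upwards [h3.ae M.ae_splits, h4.ae M.ae_splits] with x hx hx'
    exact ⟨hx, hx'⟩
  filter_upwards [h1, Measure.quasiMeasurePreserving_fst.ae (hsp p),
    Measure.quasiMeasurePreserving_snd.ae (hsp q)] with z hz hzp hzq hG
  have e := hG.congr (x' := fun i => v * base (fun i => (M.split (v⁻¹ * z.1 i)).1) i)
    (y' := fun j => v * base (fun j => (M.split (v⁻¹ * z.2 j)⁻¹).2⁻¹) j) ?_ ?_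
  · have hG' := e.1
    rw [good_smul] at hG'
    rw [← e.2, hG'.grid_smul]
    exact hz hG'
  · intro i
    refine Fin.cases ?_ (fun i => ?_) i
    · simpa [base] using h₀.row
    · have := (hzp i).1.split_mul
      have e : (z.1 i)⁻¹ * (v * (M.split (v⁻¹ * z.1 i)).1) = ((M.split (v⁻¹ * z.1 i)).2 : G)⁻¹ := by
        rw [eq_inv_iff_mul_eq_one, mul_assoc, mul_assoc, this]; group
      simp only [base, Fin.cons_succ, e]
      exact M.G₂.inv_mem (SetLike.coe_mem _)
  · intro j
    refine Fin.cases ?_ (fun j => ?_) j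
    · simpa [base] using M.vtx_col x₀ y₀
    · have := (hzq j).2.split_mul
      have e : (z.2 j)⁻¹ * (v * ((M.split (v⁻¹ * z.2 j)⁻¹).2⁻¹ : M.G₂))
          = ((M.split (v⁻¹ * z.2 j)⁻¹).1 : G) := by
        have h5 : (z.2 j)⁻¹ * v = (v⁻¹ * z.2 j)⁻¹ := by group
        rw [← mul_assoc, h5]
        nth_rewrite 1 [← this]
        simp
      simp only [base, Fin.cons_succ, e]
      exact (SetLike.coe_mem _)

/-- The first row and the first column meet almost surely. Fubini over this pair reduces to
`ae_good_and_of_ae`, where they are fixed; measurability of `P` is needed to return to the product.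
-/
theorem ae_grid_of_ae {P : M.Gam p q → Prop} (hP : MeasurableSet {X | P X})
    (h : ∀ᵐ X ∂(M.measure p q), P X) :
    ∀ᵐ z ∂((haarPow G (p + 1)).prod (haarPow G (q + 1))),
      M.Good z.1 z.2 → P (M.grid z.1 z.2) := by
  have hm : MeasurableSet {z : (Fin (p + 1) → G) × (Fin (q + 1) → G) |
      M.Good z.1 z.2 → P (M.grid z.1 z.2)} := by
    have : {z : (Fin (p + 1) → G) × (Fin (q + 1) → G) | M.Good z.1 z.2 → P (M.grid z.1 z.2)}
        = {z | M.Good z.1 z.2}ᶜ ∪ (fun z => M.grid z.1 z.2) ⁻¹' {X | P X} := by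
      ext z; simp [imp_iff_not_or]
    rw [this]
    exact M.measurableSet_good.compl.union (M.measurable_grid hP)
  have hu := QuasiMeasurePreserving.prodMap
    (measurePreserving_uncons (Measure.haar : Measure G) p).quasiMeasurePreserving
    (measurePreserving_uncons (Measure.haar : Measure G) q).quasiMeasurePreserving
  have hs := (measurePreserving_prod_comm_middle (Measure.haar : Measure G) (haarPow G p)
    (Measure.haar : Measure G) (haarPow G q)).quasiMeasurePreserving
  have key : ∀ᵐ z ∂(((Measure.haar : Measure G).prod (Measure.haar : Measure G)).prod
      ((haarPow G p).prod (haarPow G q))),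
      M.Good (Fin.cons z.1.1 z.2.1 : Fin (p + 1) → G) (Fin.cons z.1.2 z.2.2 : Fin (q + 1) → G) →
        P (M.grid (Fin.cons z.1.1 z.2.1 : Fin (p + 1) → G)
          (Fin.cons z.1.2 z.2.2 : Fin (q + 1) → G)) := by
    have hc : ∀ n : ℕ, Measurable fun z : G × (Fin n → G) => (Fin.cons z.1 z.2 : Fin (n + 1) → G) :=
      fun n => (measurePreserving_cons (Measure.haar : Measure G) n).measurable
    have hmc : Measurable fun z : (G × G) × (Fin p → G) × (Fin q → G) =>
        ((Fin.cons z.1.1 z.2.1 : Fin (p + 1) → G), (Fin.cons z.1.2 z.2.2 : Fin (q + 1) → G)) := by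
      refine Measurable.prodMk ?_ ?_
      · exact (hc p).comp (by fun_prop : Measurable fun z : (G × G) × (Fin p → G) × (Fin q → G) =>
          (z.1.1, z.2.1))
      · exact (hc q).comp (by fun_prop : Measurable fun z : (G × G) × (Fin p → G) × (Fin q → G) =>
          (z.1.2, z.2.2))
    refine (Measure.ae_prod_iff_ae_ae (p := fun z : (G × G) × (Fin p → G) × (Fin q → G) =>
      M.Good (Fin.cons z.1.1 z.2.1 : Fin (p + 1) → G) (Fin.cons z.1.2 z.2.2 : Fin (q + 1) → G) →
        P (M.grid (Fin.cons z.1.1 z.2.1 : Fin (p + 1) → G)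
          (Fin.cons z.1.2 z.2.2 : Fin (q + 1) → G))) (hmc hm)).mpr ?_
    filter_upwards [M.ae_meet] with z hz
    exact M.ae_good_and_of_ae h z.1 z.2 hz
  have h1 := (hs.comp hu).ae key
  filter_upwards [h1] with z hz
  simpa [Fin.cons_self_tail] using hz

/-- Fix a first row and a first column that are good for almost all others. Elements of `G₁` and
`G₂` describing a grid are completed by random factors from the complementary subgroups to generic
elements of `G`. These factors do not change the cosets, so they can be discarded. -/
theorem ae_of_ae_grid {P : M.Gam p q → Prop}
    (h : ∀ᵐ z ∂((haarPow G (p + 1)).prod (haarPow G (q + 1))),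
      M.Good z.1 z.2 → P (M.grid z.1 z.2)) :
    ∀ᵐ X ∂(M.measure p q), P X := by
  rw [ae_measure_iff]
  have hu := QuasiMeasurePreserving.prodMap
    (measurePreserving_cons (Measure.haar : Measure G) p).quasiMeasurePreserving
    (measurePreserving_cons (Measure.haar : Measure G) q).quasiMeasurePreserving
  have hs := (measurePreserving_prod_comm_middle (Measure.haar : Measure G)
    (Measure.haar : Measure G) (haarPow G p) (haarPow G q)).quasiMeasurePreserving
  have h1 := Measure.ae_ae_of_ae_prod ((hu.comp hs).ae h)
  have : (ae ((Measure.haar : Measure G).prod (Measure.haar : Measure G))).NeBot :=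
    ae_neBot.mpr (NeZero.ne _)
  obtain ⟨⟨x₀, y₀⟩, h₀, hxy⟩ := (M.ae_meet.and h1).exists
  set v := M.vtx x₀ y₀ with hv
  have hl1 : Measure.QuasiMeasurePreserving (fun a : M.G₁ × M.G₂ => v * ((a.1 : G) * a.2))
      ((Measure.haar : Measure M.G₁).prod (Measure.haar : Measure M.G₂)) Measure.haar :=
    (measurePreserving_mul_left _ v).quasiMeasurePreserving.comp M.quasiMeasurePreserving_mul
  have hl2 : Measure.QuasiMeasurePreserving
      (fun a : M.G₁ × M.G₂ => v * ((a.1 : G) * ((a.2⁻¹ : M.G₂) : G))⁻¹)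
      ((Measure.haar : Measure M.G₁).prod (Measure.haar : Measure M.G₂)) Measure.haar :=
    (measurePreserving_mul_left _ v).quasiMeasurePreserving.comp
      ((quasiMeasurePreserving_inv (Measure.haar : Measure G)).comp
        (M.quasiMeasurePreserving_mul.comp (QuasiMeasurePreserving.prodMap
          (.id (Measure.haar : Measure M.G₁))
          (quasiMeasurePreserving_inv (Measure.haar : Measure M.G₂)))))
  have hz1 := (measurePreserving_zip (Measure.haar : Measure M.G₁)
    (Measure.haar : Measure M.G₂) p).quasiMeasurePreserving
  have hz2 := (measurePreserving_zip (Measure.haar : Measure M.G₁)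
    (Measure.haar : Measure M.G₂) q).quasiMeasurePreserving.comp
      (Measure.measurePreserving_swap (μ := (Measure.pi fun _ : Fin q => (Measure.haar : Measure M.G₂)))
        (ν := (Measure.pi fun _ : Fin q => (Measure.haar : Measure M.G₁)))).quasiMeasurePreserving
  have hs' := (measurePreserving_prod_comm_middle
    (Measure.pi fun _ : Fin p => (Measure.haar : Measure M.G₁))
    (Measure.pi fun _ : Fin q => (Measure.haar : Measure M.G₂))
    (Measure.pi fun _ : Fin p => (Measure.haar : Measure M.G₂))
    (Measure.pi fun _ : Fin q => (Measure.haar : Measure M.G₁))).quasiMeasurePreserving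
  have htot := (QuasiMeasurePreserving.prodMap ((quasiMeasurePreserving_pi hl1 p).comp hz1)
    ((quasiMeasurePreserving_pi hl2 q).comp hz2)).comp hs'
  have h2 := Measure.ae_ae_of_ae_prod (htot.ae hxy)
  have : (ae ((Measure.pi fun _ : Fin p => (Measure.haar : Measure M.G₂)).prod
    (Measure.pi fun _ : Fin q => (Measure.haar : Measure M.G₁)))).NeBot :=
    ae_neBot.mpr (NeZero.ne _)
  filter_upwards [h2] with z hz hG
  -- One good choice of representatives suffices, as the grid does not depend on it.
  obtain ⟨⟨s, g⟩, hsg⟩ := hz.exists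
  have e := ((M.good_smul v _ _).mpr hG).congr
    (x' := (Fin.cons x₀ fun i => v * ((z.1 i : G) * s i) : Fin (p + 1) → G))
    (y' := (Fin.cons y₀ fun j => v * ((g j : G) * (((z.2 j)⁻¹ : M.G₂) : G))⁻¹ : Fin (q + 1) → G))
    ?_ ?_
  · have h3 := hsg e.1
    have h4 : P (M.grid (Fin.cons x₀ fun i => v * ((z.1 i : G) * s i) : Fin (p + 1) → G)
        (Fin.cons y₀ fun j => v * ((g j : G) * (((z.2 j)⁻¹ : M.G₂) : G))⁻¹ : Fin (q + 1) → G)) := h3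
    rwa [e.2, hG.grid_smul] at h4
  · intro i
    refine Fin.cases ?_ (fun i => ?_) i
    · have := M.G₂.inv_mem h₀.row
      simpa [base, hv] using this
    · simp [base, mul_assoc]
  · intro j
    refine Fin.cases ?_ (fun j => ?_) j
    · have := M.G₁.inv_mem (M.vtx_col x₀ y₀)
      simpa [base, hv] using this
    · simp [base, mul_assoc]

end MatchedPair

end

noncomputable section

/-! ### Homogeneous coordinates on `Gⁿ` -/

section Homogeneous

variable {G : Type*} [Group G] [TopologicalSpace G] [IsTopologicalGroup G] [LocallyCompactSpace G]
  [T2Space G] [SecondCountableTopology G] [MeasurableSpace G] [BorelSpace G]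

/-- The quotients of consecutive entries. -/
def steps {H : Type*} [Group H] {n : ℕ} (z : Fin (n + 1) → H) (k : Fin n) : H :=
  (z k.castSucc)⁻¹ * z k.succ

theorem steps_smul {H : Type*} [Group H] {n : ℕ} (g : H) (z : Fin (n + 1) → H) :
    steps (fun i => g * z i) = steps z := by
  funext k; simp [steps, mul_assoc]

theorem steps_partialProd {H : Type*} [Group H] {n : ℕ} (x : Fin n → H) :
    steps (Fin.partialProd x) = x := by
  funext k; simp [steps, Fin.partialProd_succ]

theorem partialProd_steps {H : Type*} [Group H] {n : ℕ} (z : Fin (n + 1) → H) (i : Fin (n + 1)) :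
    Fin.partialProd (steps z) i = (z 0)⁻¹ * z i := by
  induction i using Fin.induction with
  | zero => simp
  | succ i ih => rw [Fin.partialProd_succ, ih]; simp [steps]

theorem partialProd_eq_cons_products {H : Type*} [Group H] {n : ℕ} (x : Fin n → H) :
    Fin.partialProd x = (Fin.cons 1 (products x) : Fin (n + 1) → H) := by
  funext i
  refine Fin.cases (by simp) (fun i => ?_) i
  rw [partialProd_succ_eq_products, Fin.cons_succ]

theorem quasiMeasurePreserving_mul_partialProd (n : ℕ) :
    Measure.QuasiMeasurePreserving
      (fun (p : G × (Fin n → G)) (i : Fin (n + 1)) => p.1 * Fin.partialProd p.2 i)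
      (Measure.haar.prod (haarPow G n)) (haarPow G (n + 1)) := by
  have h1 := QuasiMeasurePreserving.prodMap (.id (Measure.haar : Measure G))
    (quasiMeasurePreserving_products (Measure.haar : Measure G) n)
  have h2 := quasiMeasurePreserving_smul_pi (Measure.haar : Measure G) (Measure.haar : Measure G) n
    id measurable_id
  have h3 := (measurePreserving_cons (Measure.haar : Measure G) n).quasiMeasurePreserving
  convert h3.comp (h2.comp h1) using 1
  rotate_left
  · rfl
  · rfl
  funext p i
  rw [partialProd_eq_cons_products]
  refine Fin.cases (by simp) (fun i => ?_) i
  simp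

theorem quasiMeasurePreserving_steps (n : ℕ) :
    Measure.QuasiMeasurePreserving (steps : (Fin (n + 1) → G) → Fin n → G)
      (haarPow G (n + 1)) (haarPow G n) := by
  have h1 := (measurePreserving_uncons (Measure.haar : Measure G) n).quasiMeasurePreserving
  have h2 := quasiMeasurePreserving_smul_pi (Measure.haar : Measure G) (Measure.haar : Measure G) n
    (fun x => x⁻¹) measurable_inv
  have h3 := quasiMeasurePreserving_quotients (Measure.haar : Measure G) n
  have h4 := h3.comp ((Measure.quasiMeasurePreserving_snd).comp (h2.comp h1))
  convert h4 using 1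
  rotate_left
  · rfl
  · rfl
  funext z k
  simp only [Function.comp_apply]
  rw [← cons_one_quotients, ← steps, ← steps_smul (z 0)⁻¹ z]
  congr 1
  funext i
  refine Fin.cases (by simp) (fun i => ?_) i
  simp [Fin.tail]

/-- Homogeneous coordinates contain a superfluous base point. In the coordinates base point and
edges the property no longer involves the base point, so it can be dropped. -/
theorem ae_of_ae_steps {n : ℕ} {P : (Fin n → G) → Prop}
    (h : ∀ᵐ z ∂(haarPow G (n + 1)), P (steps z)) : ∀ᵐ x ∂(haarPow G n), P x := by
  have h1 := (quasiMeasurePreserving_mul_partialProd n).ae h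
  simp only [steps_smul, steps_partialProd] at h1
  exact ae_of_forall_prod (NeZero.ne (Measure.haar : Measure G)) h1

theorem barFace_steps {H : Type*} [Group H] {n : ℕ} (k : Fin (n + 2)) (z : Fin (n + 2) → H) :
    barFace k (steps z) = steps (z ∘ k.succAbove) := by
  funext j
  exact barFace_quot k z j

theorem quasiMeasurePreserving_barFace (n : ℕ) (k : Fin (n + 2)) :
    Measure.QuasiMeasurePreserving (barFace k) (haarPow G (n + 1)) (haarPow G n) := by
  refine ⟨measurable_barFace k, Measure.AbsolutelyContinuous.mk fun E hE h0 => ?_⟩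
  rw [Measure.map_apply (measurable_barFace k) hE]
  refine measure_eq_zero_iff_ae_notMem.mpr (ae_of_ae_steps (P := fun x => barFace k x ∉ E) ?_)
  have h1 := (quasiMeasurePreserving_steps (G := G) n).comp
    (quasiMeasurePreserving_comp_injective (Measure.haar : Measure G) k.succAbove
      Fin.succAbove_right_injective)
  filter_upwards [h1.ae (measure_eq_zero_iff_ae_notMem.mp h0)] with z hz
  rw [barFace_steps]
  exact hz

theorem quasiMeasurePreserving_append (m n : ℕ) :
    Measure.QuasiMeasurePreserving (fun p : (Fin m → G) × (Fin n → G) => Fin.append p.1 p.2)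
      ((haarPow G m).prod (haarPow G n)) (haarPow G (m + n)) := by
  have h1 := (measurePreserving_sumPiEquivProdPi_symm
    (fun _ : Fin m ⊕ Fin n => (Measure.haar : Measure G))).quasiMeasurePreserving
  have h2 := (measurePreserving_piCongrLeft (fun _ : Fin (m + n) => (Measure.haar : Measure G))
    finSumFinEquiv).quasiMeasurePreserving
  convert h2.comp h1 using 1
  rotate_left
  · rfl
  · rfl
  funext p i
  refine Fin.addCases (fun i => ?_) (fun i => ?_) i
  · have := MeasurableEquiv.piCongrLeft_apply_apply finSumFinEquiv (β := fun _ => G)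
      ((MeasurableEquiv.sumPiEquivProdPi fun _ : Fin m ⊕ Fin n => G).symm p) (Sum.inl i)
    simp only [finSumFinEquiv_apply_left] at this
    rw [Function.comp_apply, this]
    simp [MeasurableEquiv.sumPiEquivProdPi, Equiv.sumPiEquivProdPi]
  · have := MeasurableEquiv.piCongrLeft_apply_apply finSumFinEquiv (β := fun _ => G)
      ((MeasurableEquiv.sumPiEquivProdPi fun _ : Fin m ⊕ Fin n => G).symm p) (Sum.inr i)
    simp only [finSumFinEquiv_apply_right] at this
    rw [Function.comp_apply, this]
    simp [MeasurableEquiv.sumPiEquivProdPi, Equiv.sumPiEquivProdPi]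

end Homogeneous

namespace MatchedPair

variable {G : Type*} [Group G] [TopologicalSpace G] [IsTopologicalGroup G] [LocallyCompactSpace G]
  [T2Space G] [SecondCountableTopology G] [MeasurableSpace G] [BorelSpace G]
  (M : MatchedPair G) {p q : ℕ}

/-- The quotient of the two components runs through `G₂G₁`, which is conull. A single point can so
represent a row and a column that are generic as a pair. -/
theorem quasiMeasurePreserving_mul_mul :
    Measure.QuasiMeasurePreserving
      (fun z : G × M.G₂ × M.G₁ => (z.1 * (z.2.1 : G), z.1 * (z.2.2 : G)))
      ((Measure.haar : Measure G).prod
        ((Measure.haar : Measure M.G₂).prod (Measure.haar : Measure M.G₁)))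
      ((Measure.haar : Measure G).prod (Measure.haar : Measure G)) := by
  have h1 := quasiMeasurePreserving_skew (μ := (Measure.haar : Measure G))
    (μ' := (Measure.haar : Measure G))
    (ν := (Measure.haar : Measure M.G₂).prod (Measure.haar : Measure M.G₁))
    (g := fun z => z.1 * (z.2.1 : G)) (by fun_prop)
    (fun y => quasiMeasurePreserving_mul_right (Measure.haar : Measure G) (y.1 : G))
  have h2 : Measure.QuasiMeasurePreserving (fun z : M.G₂ × M.G₁ => (z.1 : G)⁻¹ * (z.2 : G))
      ((Measure.haar : Measure M.G₂).prod (Measure.haar : Measure M.G₁)) Measure.haar := by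
    have h3 := (quasiMeasurePreserving_inv (Measure.haar : Measure G)).comp
      (M.quasiMeasurePreserving_mul.comp ((QuasiMeasurePreserving.prodMap
        (quasiMeasurePreserving_inv (Measure.haar : Measure M.G₁))
        (.id (Measure.haar : Measure M.G₂))).comp
          (Measure.measurePreserving_swap (μ := (Measure.haar : Measure M.G₂))
            (ν := (Measure.haar : Measure M.G₁))).quasiMeasurePreserving))
    convert h3 using 1
    funext z
    simp
  have hs := (Measure.measurePreserving_swap (μ := (Measure.haar : Measure G))
    (ν := (Measure.haar : Measure G))).quasiMeasurePreserving
  have h4 := hs.comp ((quasiMeasurePreserving_smul_skew (Measure.haar : Measure G)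
    (Measure.haar : Measure G) id measurable_id).comp hs)
  convert h4.comp ((QuasiMeasurePreserving.prodMap (.id (Measure.haar : Measure G)) h2).comp h1)
    using 1
  funext z
  simp [mul_assoc]

theorem quasiMeasurePreserving_vtx :
    Measure.QuasiMeasurePreserving (fun z : G × G => M.vtx z.1 z.2)
      ((Measure.haar : Measure G).prod (Measure.haar : Measure G)) Measure.haar := by
  have hs : Measure.QuasiMeasurePreserving (fun x : G => (M.split x).1) Measure.haar
      (Measure.haar : Measure M.G₁) := QuasiMeasurePreserving.fst M.quasiMeasurePreserving_split
  have hm : Measurable fun z : G × G => (M.split (z.2⁻¹ * z.1)).1 :=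
    measurable_fst.comp (M.measurable_split.comp (measurable_snd.inv.mul measurable_fst))
  have h1 := quasiMeasurePreserving_skew (μ := (Measure.haar : Measure G))
    (μ' := (Measure.haar : Measure M.G₁)) (ν := (Measure.haar : Measure G))
    (g := fun z => (M.split (z.2⁻¹ * z.1)).1) hm
    (fun y => hs.comp (measurePreserving_mul_left _ y⁻¹).quasiMeasurePreserving)
  have h2 : Measure.QuasiMeasurePreserving (fun z : M.G₁ × G => z.2 * (z.1 : G))
      ((Measure.haar : Measure M.G₁).prod (Measure.haar : Measure G)) Measure.haar := by
    refine QuasiMeasurePreserving.prod_of_right (by fun_prop) ?_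
    exact Filter.Eventually.of_forall fun g =>
      quasiMeasurePreserving_mul_right (Measure.haar : Measure G) (g : G)
  exact h2.comp h1

theorem ae_good : ∀ᵐ z ∂((haarPow G (p + 1)).prod (haarPow G (q + 1))), M.Good z.1 z.2 := by
  simp only [Good, ae_all_iff]
  intro i j
  exact (QuasiMeasurePreserving.prodMap
    (Measure.quasiMeasurePreserving_eval (μ := fun _ : Fin (p + 1) => (Measure.haar : Measure G)) i)
    (Measure.quasiMeasurePreserving_eval (μ := fun _ : Fin (q + 1) => (Measure.haar : Measure G))
      j)).ae M.ae_meet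

/-- A property that holds almost everywhere on `Γ_pq` holds for almost all independent rows and
columns. -/
theorem ae_grid_of_ae' {P : M.Gam p q → Prop} (h : ∀ᵐ X ∂(M.measure p q), P X) :
    ∀ᵐ z ∂((haarPow G (p + 1)).prod (haarPow G (q + 1))),
      M.Good z.1 z.2 ∧ P (M.grid z.1 z.2) := by
  -- The exceptional set is enlarged to a measurable null set, because `ae_grid_of_ae` needs a
  -- measurable property.
  have h0 : ∀ᵐ X ∂(M.measure p q), X ∉ toMeasurable (M.measure p q) {X | ¬ P X} := by
    rw [← measure_eq_zero_iff_ae_notMem, measure_toMeasurable]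
    exact h
  have h1 := M.ae_grid_of_ae (P := fun X => X ∉ toMeasurable (M.measure p q) {X | ¬ P X})
    (measurableSet_toMeasurable _ _).compl h0
  filter_upwards [h1, M.ae_good] with z hz hG
  refine ⟨hG, ?_⟩
  by_contra hP
  exact hz hG (subset_toMeasurable _ _ hP)

/-- The same when the rows and columns may share coordinates. -/
theorem ae_grid_comp_of_ae {P : M.Gam p q → Prop} (h : ∀ᵐ X ∂(M.measure p q), P X) {N : ℕ}
    (f : Fin (p + 1) → Fin N) (g : Fin (q + 1) → Fin N) (hf : Function.Injective f)
    (hg : Function.Injective g) :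
    ∀ᵐ w ∂(haarPow G N), M.Good (w ∘ f) (w ∘ g) ∧ P (M.grid (w ∘ f) (w ∘ g)) := by
  have h1 := (QuasiMeasurePreserving.prodMap
    (quasiMeasurePreserving_comp_injective (Measure.haar : Measure G) f hf)
    (quasiMeasurePreserving_comp_injective (Measure.haar : Measure G) g hg)).ae
    (M.ae_grid_of_ae' h)
  -- A shared coordinate lies on the diagonal, a null set in general, so independence has to be
  -- restored. Replacing `w` by `w * s` as a row and by `w * g` as a column keeps both cosets and
  -- makes the pair generic.
  have hz := (measurePreserving_zip (Measure.haar : Measure G)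
    ((Measure.haar : Measure M.G₂).prod (Measure.haar : Measure M.G₁)) N).quasiMeasurePreserving
  have hu := (measurePreserving_unzip (Measure.haar : Measure G)
    (Measure.haar : Measure G) N).quasiMeasurePreserving
  have h2 := (hu.comp ((quasiMeasurePreserving_pi M.quasiMeasurePreserving_mul_mul N).comp hz)).ae h1
  have h3 := Measure.ae_ae_of_ae_prod h2
  have : (ae (Measure.pi fun _ : Fin N =>
    (Measure.haar : Measure M.G₂).prod (Measure.haar : Measure M.G₁))).NeBot :=
    ae_neBot.mpr (NeZero.ne _)
  filter_upwards [h3] with w hw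
  obtain ⟨u, hG, hP⟩ := hw.exists
  have e := hG.congr (x' := w ∘ f) (y' := w ∘ g) (fun i => by simp) (fun j => by simp)
  refine ⟨e.1, ?_⟩
  rw [e.2]
  exact hP

/-! ### Nonsingular maps between the spaces `Γ_pq` and `Gⁿ` -/

/-- In terms of rows and columns such a map is a coordinate projection. Faces and corners are of
this kind. -/
theorem quasiMeasurePreserving_of_grid {p' q' : ℕ} (F : M.Gam p q → M.Gam p' q')
    (hF : Measurable F) (f : Fin (p' + 1) → Fin (p + 1)) (g : Fin (q' + 1) → Fin (q + 1))
    (hf : Function.Injective f) (hg : Function.Injective g)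
    (h : ∀ x y, M.Good x y → F (M.grid x y) = M.grid (x ∘ f) (y ∘ g)) :
    Measure.QuasiMeasurePreserving F (M.measure p q) (M.measure p' q') := by
  refine ⟨hF, Measure.AbsolutelyContinuous.mk fun E hE h0 => ?_⟩
  rw [Measure.map_apply hF hE]
  refine measure_eq_zero_iff_ae_notMem.mpr (M.ae_of_ae_grid (P := fun X => F X ∉ E) ?_)
  have h1 := (QuasiMeasurePreserving.prodMap
    (quasiMeasurePreserving_comp_injective (Measure.haar : Measure G) f hf)
    (quasiMeasurePreserving_comp_injective (Measure.haar : Measure G) g hg)).ae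
    (M.ae_grid_of_ae' (measure_eq_zero_iff_ae_notMem.mp h0))
  filter_upwards [h1] with z hz hG
  rw [h _ _ hG]
  exact hz.2

theorem measurable_gam {Ω : Type*} [MeasurableSpace Ω] {F : Ω → M.Gam p q}
    (h1 : ∀ i j, Measurable fun ω => (F ω).vert i j)
    (h2 : ∀ i j, Measurable fun ω => (F ω).horiz i j) : Measurable F :=
  Measurable.subtype_mk (h := fun ω => (F ω).2) (f := fun ω => (F ω).1)
    ((measurable_pi_lambda _ fun i => measurable_pi_lambda _ fun j => h1 i j).prodMk
      (measurable_pi_lambda _ fun i => measurable_pi_lambda _ fun j => h2 i j))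

theorem quasiMeasurePreserving_hFace (p q : ℕ) (k : Fin (q + 2)) :
    Measure.QuasiMeasurePreserving (M.hFace p q k) (M.measure p (q + 1)) (M.measure p q) := by
  refine M.quasiMeasurePreserving_of_grid _ ?_ id k.succAbove Function.injective_id
    Fin.succAbove_right_injective fun x y h => h.hFace_grid k
  refine M.measurable_gam (fun i j => Gam.measurable_vert i (k.succAbove j)) fun i j => ?_
  exact (measurable_pi_apply j).comp ((measurable_barFace k).comp
    (measurable_pi_lambda _ fun j => Gam.measurable_horiz i j))

theorem quasiMeasurePreserving_vFace (p q : ℕ) (k : Fin (p + 2)) :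
    Measure.QuasiMeasurePreserving (M.vFace p q k) (M.measure (p + 1) q) (M.measure p q) := by
  refine M.quasiMeasurePreserving_of_grid _ ?_ k.succAbove id Fin.succAbove_right_injective
    Function.injective_id fun x y h => h.vFace_grid k
  refine M.measurable_gam (fun i j => ?_) fun i j => Gam.measurable_horiz (k.succAbove i) j
  exact (measurable_pi_apply i).comp ((measurable_barFace k).comp
    (measurable_pi_lambda _ fun i => Gam.measurable_vert i j))

theorem quasiMeasurePreserving_corner (n p q : ℕ) (h : p + q = n) :
    Measure.QuasiMeasurePreserving (M.corner n p q h) (M.measure n n) (M.measure p q) := by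
  refine M.quasiMeasurePreserving_of_grid _ ?_ (fun i => ⟨q + i, by omega⟩)
    (fun j => ⟨j, by omega⟩) ?_ ?_ fun x y hG => hG.corner_grid h
  · exact M.measurable_gam (fun i j => Gam.measurable_vert _ _)
      fun i j => Gam.measurable_horiz _ _
  · intro i j hij
    simp only [Fin.mk.injEq] at hij
    ext; omega
  · intro i j hij
    simp only [Fin.mk.injEq] at hij
    ext; omega

theorem measurable_diag (n : ℕ) : Measurable (M.diag n) := by
  refine measurable_pi_lambda _ fun k => ?_
  exact (measurable_subtype_coe.comp (Gam.measurable_horiz _ _)).mul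
    (measurable_subtype_coe.comp (Gam.measurable_vert _ _))

theorem standardBorelSpace_gam : StandardBorelSpace (M.Gam p q) := by
  have := standardBorelSpace_group G
  have : StandardBorelSpace M.G₁ := M.isClosed₁.measurableSet.standardBorel
  have : StandardBorelSpace M.G₂ := M.isClosed₂.measurableSet.standardBorel
  have hm : MeasurableSet {X : (Fin p → Fin (q + 1) → M.G₁) × (Fin (p + 1) → Fin q → M.G₂) |
      ∀ (i : Fin p) (j : Fin q), (X.2 i.castSucc j : G) * (X.1 i j.succ : G)
        = (X.1 i j.castSucc : G) * (X.2 i.succ j : G)} := by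
    simp only [Set.ofPred_forall]
    refine MeasurableSet.iInter fun i => MeasurableSet.iInter fun j => ?_
    exact measurableSet_eq_fun (by fun_prop) (by fun_prop)
  exact hm.standardBorel

theorem measurableEmbedding_diag (n : ℕ) : MeasurableEmbedding (M.diag n) := by
  have := standardBorelSpace_group G
  have := M.standardBorelSpace_gam (p := n) (q := n)
  exact (M.measurable_diag n).measurableEmbedding (M.diag_injective n)

/-- The inverse of the measurable embedding `M.diag n`, extended by a constant outside its range. -/
theorem measurable_ofDiag (n : ℕ) : Measurable (M.ofDiag n) := by
  classical
  have : M.ofDiag n = Function.extend (M.diag n) id fun _ => M.unitGrid n n := by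
    funext x
    by_cases h : ∃ X, M.diag n X = x
    · obtain ⟨X, rfl⟩ := h
      rw [(M.diag_injective n).extend_apply]
      refine M.diag_injective n ?_
      have h1 : ∃ Y, M.diag n Y = M.diag n X := ⟨X, rfl⟩
      rw [ofDiag, dif_pos h1, h1.choose_spec]
      rfl
    · rw [ofDiag, dif_neg h, Function.extend_apply' _ _ _ h]
  rw [this]
  exact (M.measurableEmbedding_diag n).measurable_extend measurable_id measurable_const

theorem quasiMeasurePreserving_ofDiag (n : ℕ) :
    Measure.QuasiMeasurePreserving (M.ofDiag n) (haarPow G n) (M.measure n n) := by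
  refine ⟨M.measurable_ofDiag n, Measure.AbsolutelyContinuous.mk fun E hE h0 => ?_⟩
  rw [Measure.map_apply (M.measurable_ofDiag n) hE]
  refine measure_eq_zero_iff_ae_notMem.mpr (ae_of_ae_steps (P := fun x => M.ofDiag n x ∉ E) ?_)
  filter_upwards [M.ae_grid_comp_of_ae (measure_eq_zero_iff_ae_notMem.mp h0) id id
    Function.injective_id Function.injective_id] with z hz
  have := hz.1.ofDiag_eq
  exact this ▸ hz.2

/-- The diagonal vertices come from disjoint pairs of one row and one column, so for independent
rows and columns they are independent generic points of `G`; the diagonals are their consecutive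
quotients. -/
theorem quasiMeasurePreserving_diag (n : ℕ) :
    Measure.QuasiMeasurePreserving (M.diag n) (M.measure n n) (haarPow G n) := by
  refine ⟨M.measurable_diag n, Measure.AbsolutelyContinuous.mk fun E hE h0 => ?_⟩
  rw [Measure.map_apply (M.measurable_diag n) hE]
  refine measure_eq_zero_iff_ae_notMem.mpr (M.ae_of_ae_grid (P := fun X => M.diag n X ∉ E) ?_)
  have h1 := (quasiMeasurePreserving_steps n).comp
    ((quasiMeasurePreserving_pi M.quasiMeasurePreserving_vtx (n + 1)).comp
      (measurePreserving_zip (Measure.haar : Measure G) (Measure.haar : Measure G)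
        (n + 1)).quasiMeasurePreserving)
  filter_upwards [h1.ae (measure_eq_zero_iff_ae_notMem.mp h0)] with z hz hG
  have : M.diag n (M.grid z.1 z.2) = steps fun i => M.vtx (z.1 i) (z.2 i) :=
    funext fun k => hG.diag_grid k
  rw [this]
  exact hz

theorem ae_existsUnique_diag (n : ℕ) : ∀ᵐ x ∂(haarPow G n), ∃! X : M.Gam n n, M.diag n X = x := by
  have h : ∀ᵐ x ∂(haarPow G n), ∃ X : M.Gam n n, M.diag n X = x := by
    refine ae_of_ae_steps ?_
    filter_upwards [M.ae_grid_comp_of_ae (p := n) (q := n) (P := fun _ => True)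
      (Filter.Eventually.of_forall fun _ => trivial) id id
      Function.injective_id Function.injective_id] with z hz
    have hG : M.Good z z := hz.1
    exact ⟨M.grid z z, funext fun k => by rw [hG.diag_grid]; simp [steps]⟩
  filter_upwards [h] with x hx
  obtain ⟨X, hX⟩ := hx
  exact ⟨X, hX, fun Y hY => M.diag_injective n (hY.trans hX.symm)⟩

end MatchedPair

end

noncomputable section

/-! ### Lists and tuples -/

section ListFacts

variable {X : Type*}

theorem exists_eq_ofFn {l : List X} {n : ℕ} (h : l.length = n) : ∃ x : Fin n → X, l = List.ofFn x := by
  subst h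
  exact ⟨l.get, (List.ofFn_get l).symm⟩

theorem getD_ofFn {n : ℕ} (x : Fin n → X) (i : Fin n) (d : X) : (List.ofFn x).getD i d = x i := by
  rw [List.getD_eq_getElem _ _ (by simp)]
  simp

theorem headD_ofFn {n : ℕ} (x : Fin (n + 1) → X) (d : X) : (List.ofFn x).headD d = x 0 := by
  simp [List.ofFn_succ]

theorem eraseIdx_ofFn {n : ℕ} (x : Fin (n + 1) → X) (k : Fin (n + 1)) :
    (List.ofFn x).eraseIdx k = List.ofFn (x ∘ k.succAbove) := by
  apply List.ext_getElem
  · rw [List.length_eraseIdx_of_lt (by rw [List.length_ofFn]; exact k.isLt)]; simp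
  · intro i h1 h2
    simp only [List.length_ofFn] at h2
    rw [List.getElem_eraseIdx]
    split_ifs with h
    · simp only [List.getElem_ofFn, Function.comp_apply]
      congr 1
      rw [Fin.succAbove_of_castSucc_lt _ _ (by simpa [Fin.lt_def] using h)]
      rfl
    · simp only [List.getElem_ofFn, Function.comp_apply]
      congr 1
      rw [Fin.succAbove_of_le_castSucc _ _ (by simpa [Fin.le_def] using h)]
      rfl

theorem cbd_ofFn {A : Type*} [AddCommGroup A] {n : ℕ} (Φ : List X → A) (x : Fin (n + 1) → X) :
    cbd Φ (List.ofFn x)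
      = ∑ k : Fin (n + 1), (-1 : ℤ) ^ (k : ℕ) • Φ (List.ofFn (x ∘ k.succAbove)) := by
  rw [cbd_eq_sum, List.length_ofFn, Finset.sum_range]
  simp only [eraseIdx_ofFn]

theorem sublist_ofFn {n N : ℕ} {x : Fin n → X} {w : Fin N → X}
    (h : (List.ofFn x).Sublist (List.ofFn w)) :
    ∃ f : Fin n → Fin N, Function.Injective f ∧ x = w ∘ f := by
  obtain ⟨f, hf⟩ := List.sublist_iff_exists_fin_orderEmbedding_get_eq.mp h
  refine ⟨fun i => Fin.cast (by simp) (f (Fin.cast (by simp) i)), fun i j hij => ?_, ?_⟩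
  · simpa using hij
  · funext i
    have := hf (Fin.cast (by simp) i)
    simp only [List.get_eq_getElem, List.getElem_ofFn] at this
    exact this

end ListFacts

/-! ### Generic lists -/

section Generic

variable {G : Type*} [Group G] [TopologicalSpace G] [IsTopologicalGroup G] [LocallyCompactSpace G]
  [T2Space G] [SecondCountableTopology G] [MeasurableSpace G] [BorelSpace G]

/-- The property `P` holds for almost all lists of elements of `G` of each length. -/
def Generic (P : List G → Prop) : Prop := ∀ N, ∀ᵐ w ∂(haarPow G N), P (List.ofFn w)

theorem Generic.mono {P Q : List G → Prop} (h : Generic P) (hPQ : ∀ l, P l → Q l) : Generic Q :=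
  fun N => (h N).mono fun _ => hPQ _

theorem Generic.and {P Q : List G → Prop} (h : Generic P) (h' : Generic Q) :
    Generic fun l => P l ∧ Q l := fun N => (h N).and (h' N)

/-- A sublist of a tuple is an injective selection of coordinates, and for each length there are
only countably many of these. -/
theorem Generic.sublist {P : List G → Prop} (h : Generic P) :
    Generic fun l => ∀ l' : List G, l'.Sublist l → P l' := by
  intro N
  have h1 : ∀ᵐ w ∂(haarPow G N), ∀ (n : ℕ) (f : Fin n → Fin N), Function.Injective f →
      P (List.ofFn (w ∘ f)) := by
    simp only [ae_all_iff]
    intro n f hf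
    exact (quasiMeasurePreserving_comp_injective (Measure.haar : Measure G) f hf).ae (h n)
  filter_upwards [h1] with w hw l' hl
  obtain ⟨n, hn⟩ : ∃ n, l'.length = n := ⟨_, rfl⟩
  obtain ⟨x, rfl⟩ := exists_eq_ofFn hn
  obtain ⟨f, hf, rfl⟩ := sublist_ofFn hl
  exact hw _ f hf

theorem Generic.append {P : List G → List G → Prop}
    (h : Generic fun l => ∀ α β : List G, α.Sublist l → β.Sublist l → P α β) (m n : ℕ) :
    ∀ᵐ z ∂((haarPow G m).prod (haarPow G n)), P (List.ofFn z.1) (List.ofFn z.2) := by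
  filter_upwards [(quasiMeasurePreserving_append m n).ae (h (m + n))] with z hz
  rw [List.ofFn_fin_append] at hz
  exact hz _ _ (List.sublist_append_left _ _) (List.sublist_append_right _ _)

variable {A : Type*} [AddCommGroup A]

/-- Two functions on lists agree on generic lists. -/
def EqGeneric (Φ Φ' : List G → A) : Prop :=
  Generic fun l => ∀ l' : List G, l'.Sublist l → Φ l' = Φ' l'

/-- Two functions on pairs of lists agree on sublists of generic lists. -/
def EqGeneric₂ (Ψ Ψ' : List G → List G → A) : Prop :=
  Generic fun l => ∀ α β : List G, α.Sublist l → β.Sublist l → Ψ α β = Ψ' α β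

theorem EqGeneric.symm {Φ Φ' : List G → A} (h : EqGeneric Φ Φ') : EqGeneric Φ' Φ :=
  Generic.mono h fun _ hl l' hl' => (hl l' hl').symm

theorem EqGeneric.trans {Φ Φ' Φ'' : List G → A} (h : EqGeneric Φ Φ') (h' : EqGeneric Φ' Φ'') :
    EqGeneric Φ Φ'' :=
  Generic.mono (Generic.and h h') fun _ hl l' hl' => (hl.1 l' hl').trans (hl.2 l' hl')

theorem EqGeneric.cbd {Φ Φ' : List G → A} (h : EqGeneric Φ Φ') : EqGeneric (cbd Φ) (cbd Φ') :=
  Generic.mono h fun _ hl _ hl' => cbd_congr fun l'' h1 _ => hl l'' (h1.trans hl')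

theorem EqGeneric₂.symm {Ψ Ψ' : List G → List G → A} (h : EqGeneric₂ Ψ Ψ') : EqGeneric₂ Ψ' Ψ :=
  Generic.mono h fun _ hl α β ha hb => (hl α β ha hb).symm

theorem EqGeneric₂.trans {Ψ Ψ' Ψ'' : List G → List G → A} (h : EqGeneric₂ Ψ Ψ')
    (h' : EqGeneric₂ Ψ' Ψ'') : EqGeneric₂ Ψ Ψ'' :=
  Generic.mono (Generic.and h h') fun _ hl α β ha hb => (hl.1 α β ha hb).trans (hl.2 α β ha hb)

theorem EqGeneric₂.tot {Ψ Ψ' : List G → List G → A} (h : EqGeneric₂ Ψ Ψ') :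
    EqGeneric₂ (tot Ψ) (tot Ψ') :=
  Generic.mono h fun _ hl α β ha hb => by
    unfold _root_.tot
    rw [cbd_congr fun β' h1 _ => hl α β' ha (h1.trans hb),
      cbd_congr fun α' h1 _ => hl α' β (h1.trans ha) hb]

theorem EqGeneric₂.aw {Ψ Ψ' : List G → List G → A} (h : EqGeneric₂ Ψ Ψ') :
    EqGeneric (aw Ψ) (aw Ψ') :=
  Generic.mono h fun _ hl _ hl' => aw_congr fun α β ha hb _ _ _ =>
    hl α β (ha.trans hl') (hb.trans hl')

/-! ### Homogeneous cochains of `G` -/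

variable [DistribMulAction G A]

/-- The homogeneous cochain that belongs to a function on `Gⁿ`. -/
def homog (n : ℕ) (F : (Fin n → G) → A) (l : List G) : A :=
  if l.length = n + 1 then l.headD 1 • F (steps fun i : Fin (n + 1) => l.getD i 1) else 0

theorem homog_of_ne {n : ℕ} (F : (Fin n → G) → A) {l : List G} (h : l.length ≠ n + 1) :
    homog n F l = 0 := if_neg h

theorem homog_ofFn {n : ℕ} (F : (Fin n → G) → A) (z : Fin (n + 1) → G) :
    homog n F (List.ofFn z) = z 0 • F (steps z) := by
  rw [homog, if_pos (by simp), headD_ofFn]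
  simp only [getD_ofFn]

theorem homog_smul (n : ℕ) (F : (Fin n → G) → A) (g : G) (l : List G) :
    homog n F (l.map (g * ·)) = g • homog n F l := by
  by_cases h : l.length = n + 1
  · obtain ⟨z, rfl⟩ := exists_eq_ofFn h
    rw [List.map_ofFn]
    have := homog_ofFn F (fun i => g * z i)
    rw [steps_smul] at this
    rw [homog_ofFn F z, smul_smul]
    exact this
  · rw [homog_of_ne F h, homog_of_ne F (by simpa using h), smul_zero]

theorem mul_faceCoeff_steps {H : Type*} [Group H] {n : ℕ} (k : Fin (n + 2)) (z : Fin (n + 2) → H) :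
    z 0 * faceCoeff k (steps z) = z (k.succAbove 0) := by
  unfold faceCoeff
  split_ifs with h
  · subst h
    simp [steps]
  · rw [mul_one, Fin.succAbove_ne_zero_zero h]

/-- The dictionary between equality almost everywhere on `Gⁿ` and equality on generic lists, through
which all statements on `L(Gⁿ, A)` are proved. -/
theorem eqGeneric_homog_iff {n : ℕ} {F F' : (Fin n → G) → A} :
    EqGeneric (homog n F) (homog n F') ↔ F =ᵐ[haarPow G n] F' := by
  constructor
  · intro h
    refine ae_of_ae_steps ?_
    filter_upwards [h (n + 1)] with z hz
    have := hz _ (List.Sublist.refl _)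
    rw [homog_ofFn, homog_ofFn] at this
    exact smul_left_cancel _ this
  · intro h
    refine Generic.sublist fun N => ?_
    by_cases hN : N = n + 1
    · subst hN
      filter_upwards [(quasiMeasurePreserving_steps n).ae h] with z hz
      rw [homog_ofFn, homog_ofFn, hz]
    · refine Filter.Eventually.of_forall fun w => ?_
      rw [homog_of_ne F (by simpa using hN), homog_of_ne F' (by simpa using hN)]

variable [TopologicalSpace A] [IsTopologicalAddGroup A] [PolishSpace A]
  [MeasurableSpace A] [BorelSpace A] [ContinuousSMul G A]

theorem borelCoboundary_apply (n : ℕ) (F : BorelCochain G A n) (x : Fin (n + 1) → G) :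
    (borelCoboundary G A n F).1 x
      = ∑ k : Fin (n + 2), (-1 : ℤ) ^ (k : ℕ) • faceCoeff k x • F.1 (barFace k x) := by
  simp only [borelCoboundary, AddMonoidHom.finsetSum_apply, AddSubgroup.val_finsetSum,
    Finset.sum_apply, AddMonoidHom.smul_apply, AddSubgroup.coe_zsmul, Pi.smul_apply]
  rfl

/-- The factor `g₀` in the first face moves the base point from the first to the second vertex. The
identity holds on all lists, which the Borel complex requires. -/
theorem homog_borelCoboundary (n : ℕ) (F : BorelCochain G A n) :
    homog (n + 1) (borelCoboundary G A n F).1 = cbd (homog n F.1) := by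
  funext l
  by_cases h : l.length = n + 2
  · obtain ⟨z, rfl⟩ := exists_eq_ofFn h
    rw [homog_ofFn, cbd_ofFn, borelCoboundary_apply, Finset.smul_sum]
    refine Finset.sum_congr rfl fun k _ => ?_
    rw [homog_ofFn, smul_comm, smul_smul, mul_faceCoeff_steps, barFace_steps]
    rfl
  · rw [homog_of_ne _ h, cbd_eq_zero]
    intro l' _ h'
    exact homog_of_ne _ (by omega)

theorem homog_injective {n : ℕ} {F F' : (Fin n → G) → A} (h : ∀ l, homog n F l = homog n F' l) :
    F = F' := by
  funext x
  have := h (List.ofFn (Fin.partialProd x))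
  rw [homog_ofFn, homog_ofFn, steps_partialProd] at this
  exact smul_left_cancel _ this

theorem isCochainComplex_borelCoboundary : IsCochainComplex (borelCoboundary G A) := by
  intro n F
  refine Subtype.ext (homog_injective fun l => ?_)
  rw [homog_borelCoboundary, homog_borelCoboundary, cbd_cbd]
  simp [homog]

/-! ### Classes of Borel functions -/

section Classes

variable {X Y : Type*} [MeasurableSpace X] [MeasurableSpace Y]

theorem borelClass_eq_iff {μ : Measure X} {F F' : borelFun X A} :
    borelClass μ F = borelClass μ F' ↔ F.1 =ᵐ[μ] F'.1 := AEEqFun.mk_eq_mk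

theorem borelClass_surjective (μ : Measure X) :
    Function.Surjective (borelClass μ : borelFun X A →+ (X →ₘ[μ] A)) := fun F =>
  ⟨⟨F, F.measurable⟩, AEEqFun.mk_coeFn F⟩

theorem lPull_borelClass {μ : Measure X} {ν : Measure Y} {f : X → Y}
    (hf : Measure.QuasiMeasurePreserving f μ ν) (c : X → G) (hc : Measurable c)
    (F : borelFun Y A) :
    lPull μ ν f c hc (borelClass ν F) = borelClass μ (borelPull f hf.measurable c hc F) := by
  rw [lPull, dif_pos hf]
  refine AEEqFun.mk_eq_mk.mpr ?_
  filter_upwards [hf.ae_eq_comp (AEEqFun.coeFn_mk F.1 F.2.aestronglyMeasurable)] with x hx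
  exact congrArg (c x • ·) hx

end Classes

theorem isCochainMap_borelToL :
    IsCochainMap (borelCoboundary G A) (lCoboundary G A) (borelToL G A) := by
  intro n F
  simp only [lCoboundary, borelCoboundary, borelToL, AddMonoidHom.finsetSum_apply,
    AddMonoidHom.smul_apply, map_sum, map_zsmul]
  refine Finset.sum_congr rfl fun k _ => ?_
  rw [lPull_borelClass (quasiMeasurePreserving_barFace n k)]

theorem isCochainComplex_lCoboundary : IsCochainComplex (lCoboundary G A) := by
  intro n x
  obtain ⟨F, rfl⟩ := borelClass_surjective (haarPow G n) x
  have h1 := isCochainMap_borelToL n F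
  have h2 := isCochainMap_borelToL (n + 1) (borelCoboundary G A n F)
  rw [isCochainComplex_borelCoboundary, map_zero] at h2
  rw [← h2, ← h1]
  rfl

end Generic

end

noncomputable section

theorem tot_tot {Z A : Type*} [AddCommGroup A] (Ψ : List Z → List Z → A) (α β : List Z) :
    tot (tot Ψ) α β = 0 := by
  have h := del_del (fun α β ζ => if ζ = [] then Ψ α β else 0) α β []
  rw [del_nil_right] at h
  simpa [del_nil_right] using h

/-! ### Rows and columns taken from one generic list -/

namespace MatchedPair

variable {G : Type*} [Group G] [TopologicalSpace G] [IsTopologicalGroup G] [LocallyCompactSpace G]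
  [T2Space G] [SecondCountableTopology G] [MeasurableSpace G] [BorelSpace G]
  (M : MatchedPair G) {p q : ℕ}

/-- All rows of the first list meet all columns of the second one. -/
def GoodLists (α β : List G) : Prop := ∀ a ∈ α, ∀ b ∈ β, M.Meet a b

theorem goodLists_ofFn (x : Fin (p + 1) → G) (y : Fin (q + 1) → G) :
    M.GoodLists (List.ofFn x) (List.ofFn y) ↔ M.Good x y := by
  simp only [GoodLists, Good, List.mem_ofFn, forall_exists_index,
    forall_apply_eq_imp_iff]

theorem generic_grid {P : M.Gam p q → Prop} (h : ∀ᵐ X ∂(M.measure p q), P X) :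
    Generic fun l => ∀ α β : List G, α.Sublist l → β.Sublist l →
      ∀ (x : Fin (p + 1) → G) (y : Fin (q + 1) → G), α = List.ofFn x → β = List.ofFn y →
        M.Good x y ∧ P (M.grid x y) := by
  intro N
  have h1 : ∀ᵐ w ∂(haarPow G N), ∀ (f : Fin (p + 1) → Fin N) (g : Fin (q + 1) → Fin N),
      Function.Injective f → Function.Injective g →
      M.Good (w ∘ f) (w ∘ g) ∧ P (M.grid (w ∘ f) (w ∘ g)) := by
    simp only [ae_all_iff]
    intro f g hf hg
    exact M.ae_grid_comp_of_ae h f g hf hg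
  filter_upwards [h1] with w hw
  rintro _ _ ha hb x y rfl rfl
  obtain ⟨f, hf, rfl⟩ := sublist_ofFn ha
  obtain ⟨g, hg, rfl⟩ := sublist_ofFn hb
  exact hw f g hf hg

theorem generic_goodLists : Generic fun l => M.GoodLists l l := by
  have h := M.generic_grid (p := 0) (q := 0) (P := fun _ => True)
    (Filter.Eventually.of_forall fun _ => trivial)
  refine h.mono fun l hl a ha b hb => ?_
  have := (hl [a] [b] (List.singleton_sublist.mpr ha) (List.singleton_sublist.mpr hb)
    (fun _ => a) (fun _ => b) (by simp) (by simp)).1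
  exact this 0 0

theorem generic_goodLists_sublist : Generic fun l => ∀ α β : List G, α.Sublist l → β.Sublist l →
    M.GoodLists α β :=
  M.generic_goodLists.mono fun _ hl _ _ ha hb a haa b hbb => hl a (ha.subset haa) b (hb.subset hbb)

/-! ### Homogeneous cochains of the bicomplex -/

variable {A : Type*} [AddCommGroup A] [DistribMulAction G A]

open Classical in
/-- The homogeneous cochain on rows and columns that belongs to a family of functions on the spaces
`Γ_pq`. -/
def homog₂ (F : ∀ p q, M.Gam p q → A) (α β : List G) : A :=
  if α ≠ [] ∧ β ≠ [] ∧ M.GoodLists α β then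
    M.vtx (α.headD 1) (β.headD 1) • F (α.length - 1) (β.length - 1)
      (M.grid (fun i => α.getD i 1) fun j => β.getD j 1)
  else 0

variable (F F' : ∀ p q, M.Gam p q → A)

@[simp] theorem homog₂_nil_left (β : List G) : M.homog₂ F [] β = 0 := by simp [homog₂]

@[simp] theorem homog₂_nil_right (α : List G) : M.homog₂ F α [] = 0 := by simp [homog₂]

variable {F} in
theorem homog₂_of_not_good {α β : List G} (h : ¬ M.GoodLists α β) : M.homog₂ F α β = 0 :=
  if_neg fun h' => h h'.2.2

variable {M} in
theorem Good.homog₂_ofFn {x : Fin (p + 1) → G} {y : Fin (q + 1) → G} (h : M.Good x y) :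
    M.homog₂ F (List.ofFn x) (List.ofFn y) = M.vtx (x 0) (y 0) • F p q (M.grid x y) := by
  have key : ∀ (α β : List G) (p q : ℕ), α.length = p + 1 → β.length = q + 1 →
      M.GoodLists α β → M.homog₂ F α β = M.vtx (α.headD 1) (β.headD 1) •
        F p q (M.grid (fun i => α.getD i 1) fun j => β.getD j 1) := by
    intro α β p q ha hb hG
    obtain rfl : p = α.length - 1 := by omega
    obtain rfl : q = β.length - 1 := by omega
    rw [homog₂, if_pos ⟨List.ne_nil_of_length_eq_add_one ha, List.ne_nil_of_length_eq_add_one hb, hG⟩]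
  rw [key _ _ p q (by simp) (by simp) ((M.goodLists_ofFn x y).mpr h), headD_ofFn, headD_ofFn]
  simp only [getD_ofFn]

/-- The signed sum of the horizontal faces. -/
def hSum : ∀ p q, M.Gam p q → A
  | _, 0, _ => 0
  | p, q + 1, X => ∑ k : Fin (q + 2), (-1 : ℤ) ^ (k : ℕ) •
      ((faceCoeff k (X.horiz 0) : M.G₂) : G) • F p q (M.hFace p q k X)

/-- The signed sum of the vertical faces. -/
def vSum : ∀ p q, M.Gam p q → A
  | 0, _, _ => 0
  | p + 1, q, X => ∑ k : Fin (p + 2), (-1 : ℤ) ^ (k : ℕ) •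
      ((faceCoeff k (fun i => X.vert i 0) : M.G₁) : G) • F p q (M.vFace p q k X)

/-- The total coboundary of a family of functions. -/
def totSum (p q : ℕ) (X : M.Gam p q) : A := M.hSum F p q X + (-1 : ℤ) ^ q • M.vSum F p q X

theorem coe_faceCoeff {H : Type*} [Group H] {K : Subgroup H} {n : ℕ} (k : Fin (n + 2))
    (u : Fin (n + 1) → K) : ((faceCoeff k u : K) : H) = faceCoeff k (fun j => (u j : H)) := by
  unfold faceCoeff; split_ifs <;> simp

variable {M}

/-- Deleting the first column moves the base vertex along the first horizontal edge; the coefficient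
of the face accounts for this. The other faces keep the base vertex. -/
theorem Good.cbd_right {x : Fin (p + 1) → G} {y : Fin (q + 1) → G} (h : M.Good x y) :
    cbd (M.homog₂ F (List.ofFn x)) (List.ofFn y)
      = M.vtx (x 0) (y 0) • M.hSum F p q (M.grid x y) := by
  cases q with
  | zero => simp [List.ofFn_succ, cbd_cons, hSum]
  | succ q =>
    rw [cbd_ofFn, hSum, Finset.smul_sum]
    refine Finset.sum_congr rfl fun k _ => ?_
    have h' : M.Good x (y ∘ k.succAbove) := h.comp id k.succAbove
    rw [h'.homog₂_ofFn, h.hFace_grid, smul_comm (M.vtx (x 0) (y 0)) ((-1 : ℤ) ^ (k : ℕ)),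
      smul_smul (M.vtx (x 0) (y 0))]
    congr 2
    have e := mul_faceCoeff_steps k fun j => M.vtx (x 0) (y j)
    rw [coe_faceCoeff]
    simp only [h.coe_horiz]
    exact e.symm

theorem Good.cbd_left {x : Fin (p + 1) → G} {y : Fin (q + 1) → G} (h : M.Good x y) :
    cbd (fun α => M.homog₂ F α (List.ofFn y)) (List.ofFn x)
      = M.vtx (x 0) (y 0) • M.vSum F p q (M.grid x y) := by
  cases p with
  | zero => simp [List.ofFn_succ, cbd_cons, vSum]
  | succ p =>
    rw [cbd_ofFn, vSum, Finset.smul_sum]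
    refine Finset.sum_congr rfl fun k _ => ?_
    have h' : M.Good (x ∘ k.succAbove) y := h.comp k.succAbove id
    rw [h'.homog₂_ofFn, h.vFace_grid, smul_comm (M.vtx (x 0) (y 0)) ((-1 : ℤ) ^ (k : ℕ)),
      smul_smul (M.vtx (x 0) (y 0))]
    congr 2
    have e := mul_faceCoeff_steps k fun i => M.vtx (x i) (y 0)
    rw [coe_faceCoeff]
    simp only [h.coe_vert]
    exact e.symm

theorem Good.tot_homog₂ {x : Fin (p + 1) → G} {y : Fin (q + 1) → G} (h : M.Good x y) :
    tot (M.homog₂ F) (List.ofFn x) (List.ofFn y)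
      = M.homog₂ (M.totSum F) (List.ofFn x) (List.ofFn y) := by
  -- The list of columns has `q + 1` entries, so the sign in `tot` has exponent `q + 2`, of the
  -- parity of `q`.
  rw [tot, h.cbd_right, h.cbd_left, h.homog₂_ofFn, totSum, smul_add, List.length_ofFn, pow_add,
    pow_add, smul_comm (M.vtx (x 0) (y 0)) ((-1 : ℤ) ^ q)]
  simp

theorem GoodLists.tot_homog₂ {α β : List G} (h : M.GoodLists α β) :
    tot (M.homog₂ F) α β = M.homog₂ (M.totSum F) α β := by
  cases ha : α.length with
  | zero =>
    rw [List.length_eq_zero_iff] at ha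
    subst ha
    have : cbd (M.homog₂ F []) β = 0 := cbd_eq_zero fun _ _ _ => homog₂_nil_left M F _
    rw [homog₂_nil_left, tot, this]; simp
  | succ p =>
    cases hb : β.length with
    | zero =>
      rw [List.length_eq_zero_iff] at hb
      subst hb
      have : cbd (fun α => M.homog₂ F α []) α = 0 :=
        cbd_eq_zero fun _ _ _ => homog₂_nil_right M F _
      rw [homog₂_nil_right, tot, this]; simp
    | succ q =>
      obtain ⟨x, rfl⟩ := exists_eq_ofFn ha
      obtain ⟨y, rfl⟩ := exists_eq_ofFn hb
      exact Good.tot_homog₂ F ((M.goodLists_ofFn x y).mp h)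

theorem GoodLists.sublist {α β α' β' : List G} (h : M.GoodLists α β) (ha : α'.Sublist α)
    (hb : β'.Sublist β) : M.GoodLists α' β' :=
  fun a haa b hbb => h a (ha.subset haa) b (hb.subset hbb)

theorem GoodLists.tot_congr {α β : List G} (h : M.GoodLists α β) {Ψ Ψ' : List G → List G → A}
    (h' : ∀ α β, M.GoodLists α β → Ψ α β = Ψ' α β) : tot Ψ α β = tot Ψ' α β := by
  unfold tot
  rw [cbd_congr fun β' hb _ => h' _ _ (h.sublist (List.Sublist.refl _) hb),
    cbd_congr fun α' ha _ => h' _ _ (h.sublist ha (List.Sublist.refl _))]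

/-- Every `X` is the grid of its own vertices, so nothing is lost on a null set; this gives
`totSum_totSum` as an exact identity. -/
theorem homog₂_injective {F F' : ∀ p q, M.Gam p q → A}
    (h : ∀ α β, M.GoodLists α β → M.homog₂ F α β = M.homog₂ F' α β) : F = F' := by
  funext p q X
  obtain ⟨hG, e, -⟩ := X.good_and_grid_vertex
  have h1 := h _ _ ((M.goodLists_ofFn _ _).mpr hG)
  rw [hG.homog₂_ofFn, hG.homog₂_ofFn, e] at h1
  exact smul_left_cancel _ h1

theorem totSum_totSum : M.totSum (M.totSum F) = 0 := by
  refine homog₂_injective fun α β h => ?_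
  rw [← h.tot_homog₂, ← h.tot_congr fun α β h => h.tot_homog₂ F, tot_tot]
  simp [homog₂]

theorem eqGeneric_tot_homog₂ : EqGeneric₂ (tot (M.homog₂ F)) (M.homog₂ (M.totSum F)) :=
  M.generic_goodLists_sublist.mono fun _ hl α β ha hb => (hl α β ha hb).tot_homog₂ F

variable (M)

theorem eqGeneric_homog₂ (h : ∀ p q, F p q =ᵐ[M.measure p q] F' p q) :
    EqGeneric₂ (M.homog₂ F) (M.homog₂ F') := by
  have h1 : Generic fun l => ∀ p q, ∀ α β : List G, α.Sublist l → β.Sublist l →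
      ∀ (x : Fin (p + 1) → G) (y : Fin (q + 1) → G), α = List.ofFn x → β = List.ofFn y →
        M.Good x y ∧ F p q (M.grid x y) = F' p q (M.grid x y) := by
    intro N
    rw [ae_all_iff]; intro p
    rw [ae_all_iff]; intro q
    exact M.generic_grid (h p q) N
  refine h1.mono fun l hl α β ha hb => ?_
  cases hla : α.length with
  | zero =>
    rw [List.length_eq_zero_iff] at hla
    subst hla
    simp
  | succ p =>
    cases hlb : β.length with
    | zero =>
      rw [List.length_eq_zero_iff] at hlb
      subst hlb
      simp
    | succ q =>
      obtain ⟨x, rfl⟩ := exists_eq_ofFn hla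
      obtain ⟨y, rfl⟩ := exists_eq_ofFn hlb
      obtain ⟨hG, e⟩ := hl p q _ _ ha hb x y rfl rfl
      rw [hG.homog₂_ofFn, hG.homog₂_ofFn, e]

variable {F F'} in
theorem ae_eq_of_homog₂ {p q : ℕ} (h : Generic fun l => ∀ α β : List G, α.Sublist l →
      β.Sublist l → α.length = p + 1 → β.length = q + 1 → M.homog₂ F α β = M.homog₂ F' α β) :
    F p q =ᵐ[M.measure p q] F' p q := by
  refine M.ae_of_ae_grid ?_
  have h1 := Generic.append (P := fun α β => α.length = p + 1 → β.length = q + 1 →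
    M.homog₂ F α β = M.homog₂ F' α β) h (p + 1) (q + 1)
  filter_upwards [h1] with z hz hG
  have := hz (by simp) (by simp)
  rw [hG.homog₂_ofFn, hG.homog₂_ofFn] at this
  exact smul_left_cancel _ this

/-! ### Classes of families of Borel functions -/

variable [TopologicalSpace A] [IsTopologicalAddGroup A] [PolishSpace A]
  [MeasurableSpace A] [BorelSpace A] [ContinuousSMul G A]

/-- The element of the total complex in degree `n` given by a family of Borel functions. -/
def totClass (n : ℕ) (F : ∀ p q, borelFun (M.Gam p q) A) : M.TotCochain A n :=
  fun x => borelClass _ (F x.1.1 x.1.2)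

/-- The family vanishes outside the total degree `n`. -/
def HasDegree (n : ℕ) (F : ∀ p q, M.Gam p q → A) : Prop := ∀ p q, p + q ≠ n → F p q = 0

theorem exists_totClass_eq {n : ℕ} (T : M.TotCochain A n) :
    ∃ F : ∀ p q, borelFun (M.Gam p q) A, M.HasDegree n (fun p q => (F p q).1) ∧
      M.totClass n F = T := by
  choose f hf using fun x : Bidegree n => borelClass_surjective _ (T x)
  refine ⟨fun p q => if h : p + q = n then f ⟨(p, q), h⟩ else 0, fun p q h => ?_, ?_⟩
  · simp only [dif_neg h]; rfl
  · funext x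
    simp only [totClass, dif_pos x.2]
    exact hf x

variable {M} in
theorem totClass_eq_iff {n : ℕ} {F F' : ∀ p q, borelFun (M.Gam p q) A} :
    M.totClass n F = M.totClass n F' ↔
      ∀ p q, p + q = n → (F p q).1 =ᵐ[M.measure p q] (F' p q).1 := by
  constructor
  · intro h p q hpq
    exact borelClass_eq_iff.mp (congrFun h ⟨(p, q), hpq⟩)
  · intro h
    funext x
    exact borelClass_eq_iff.mpr (h _ _ x.2)

variable {F F'} in
theorem HasDegree.homog₂_eq_zero {n : ℕ} (h : M.HasDegree n F) {α β : List G}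
    (hl : α.length + β.length ≠ n + 2) : M.homog₂ F α β = 0 := by
  rw [homog₂]
  split_ifs with h'
  · have ha := List.length_pos_iff.mpr h'.1
    have hb := List.length_pos_iff.mpr h'.2.1
    rw [h _ _ (by omega)]
    simp
  · rfl

variable {F F'} in
theorem HasDegree.totSum {n : ℕ} (h : M.HasDegree n F) : M.HasDegree (n + 1) (M.totSum F) := by
  intro p q hpq
  have h1 : M.hSum F p q = 0 := by
    funext X
    cases q with
    | zero => rfl
    | succ q => simp [hSum, h p q (by omega)]
  have h2 : M.vSum F p q = 0 := by
    funext X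
    cases p with
    | zero => rfl
    | succ p => simp [vSum, h p q (by omega)]
  funext X
  simp [MatchedPair.totSum, h1, h2]

/-- The total coboundary of a family of Borel functions. -/
def borelTot (F : ∀ p q, borelFun (M.Gam p q) A) (p q : ℕ) : borelFun (M.Gam p q) A :=
  (match q with
    | 0 => 0
    | q + 1 => ∑ k : Fin (q + 2), (-1 : ℤ) ^ (k : ℕ) •
        borelPull (M.hFace p q k) (M.quasiMeasurePreserving_hFace p q k).measurable
          (fun X => ((faceCoeff k (X.horiz 0) : M.G₂) : G)) (M.measurable_hCoeff p q k) (F p q)) +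
  (-1 : ℤ) ^ q • (match p with
    | 0 => 0
    | p + 1 => ∑ k : Fin (p + 2), (-1 : ℤ) ^ (k : ℕ) •
        borelPull (M.vFace p q k) (M.quasiMeasurePreserving_vFace p q k).measurable
          (fun X => ((faceCoeff k (fun i => X.vert i 0) : M.G₁) : G)) (M.measurable_vCoeff p q k)
          (F p q))

theorem coe_borelTot (F : ∀ p q, borelFun (M.Gam p q) A) :
    (fun p q => (M.borelTot F p q).1) = M.totSum fun p q => (F p q).1 := by
  funext p q X
  cases p <;> cases q <;>
  simp only [borelTot, MatchedPair.totSum, hSum, vSum, AddSubgroup.coe_add, AddSubgroup.coe_zsmul,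
    AddSubgroup.val_finsetSum, Pi.add_apply, Pi.smul_apply, Finset.sum_apply] <;>
  rfl

theorem totCoboundary_totClass (n : ℕ) (F : ∀ p q, borelFun (M.Gam p q) A) :
    M.totCoboundary A n (M.totClass n F) = M.totClass (n + 1) (M.borelTot F) := by
  have hh : ∀ p q, M.dh A p q (borelClass _ (F p q)) = borelClass _ (∑ k : Fin (q + 2),
      (-1 : ℤ) ^ (k : ℕ) •
        borelPull (M.hFace p q k) (M.quasiMeasurePreserving_hFace p q k).measurable
          (fun X => ((faceCoeff k (X.horiz 0) : M.G₂) : G)) (M.measurable_hCoeff p q k)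
          (F p q)) := by
    intro p q
    simp only [dh, AddMonoidHom.finsetSum_apply, AddMonoidHom.smul_apply, map_sum, map_zsmul]
    refine Finset.sum_congr rfl fun k _ => ?_
    rw [lPull_borelClass (M.quasiMeasurePreserving_hFace p q k)]
  have hv : ∀ p q, M.dv A p q (borelClass _ (F p q)) = borelClass _ (∑ k : Fin (p + 2),
      (-1 : ℤ) ^ (k : ℕ) •
        borelPull (M.vFace p q k) (M.quasiMeasurePreserving_vFace p q k).measurable
          (fun X => ((faceCoeff k (fun i => X.vert i 0) : M.G₁) : G)) (M.measurable_vCoeff p q k)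
          (F p q)) := by
    intro p q
    simp only [dv, AddMonoidHom.finsetSum_apply, AddMonoidHom.smul_apply, map_sum, map_zsmul]
    refine Finset.sum_congr rfl fun k _ => ?_
    rw [lPull_borelClass (M.quasiMeasurePreserving_vFace p q k)]
  funext x
  obtain ⟨⟨p, q⟩, h⟩ := x
  simp only [totClass, borelTot]
  rw [map_add, map_zsmul]
  change M.hPart A n p q h _ + (-1 : ℤ) ^ q • M.vPart A n p q h _ = _
  congr 1
  · cases q with
    | zero => simp [hPart]
    | succ q => exact hh p q
  · congr 1
    cases p with
    | zero => simp [vPart]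
    | succ p => exact hv p q

theorem totClass_zero (n : ℕ) : M.totClass n (0 : ∀ p q, borelFun (M.Gam p q) A) = 0 := by
  funext x
  exact map_zero _

theorem isCochainComplex_totCoboundary : IsCochainComplex (M.totCoboundary A) := by
  intro n T
  obtain ⟨F, -, rfl⟩ := M.exists_totClass_eq T
  rw [totCoboundary_totClass, totCoboundary_totClass, ← totClass_zero]
  congr 1
  funext p q
  refine Subtype.ext ?_
  have h1 := M.coe_borelTot (M.borelTot F)
  rw [M.coe_borelTot F, totSum_totSum] at h1
  exact congrFun (congrFun h1 p) q

theorem totClass_eq_of_eqGeneric {n : ℕ} {F F' : ∀ p q, borelFun (M.Gam p q) A}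
    (h : Generic fun l => ∀ α β : List G, α.Sublist l → β.Sublist l →
      α.length + β.length = n + 2 →
      M.homog₂ (fun p q => (F p q).1) α β = M.homog₂ (fun p q => (F' p q).1) α β) :
    M.totClass n F = M.totClass n F' := by
  refine totClass_eq_iff.mpr fun p q hpq => ?_
  refine M.ae_eq_of_homog₂ (F := fun p q => (F p q).1) (F' := fun p q => (F' p q).1) ?_
  exact h.mono fun l hl α β ha hb h1 h2 => hl α β ha hb (by omega)

theorem eqGeneric_of_totClass_eq {n : ℕ} {F F' : ∀ p q, borelFun (M.Gam p q) A}
    (hF : M.HasDegree n fun p q => (F p q).1) (hF' : M.HasDegree n fun p q => (F' p q).1)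
    (h : M.totClass n F = M.totClass n F') :
    EqGeneric₂ (M.homog₂ fun p q => (F p q).1) (M.homog₂ fun p q => (F' p q).1) := by
  refine M.eqGeneric_homog₂ _ _ fun p q => ?_
  by_cases hpq : p + q = n
  · exact totClass_eq_iff.mp h p q hpq
  · have h1 := hF p q hpq
    have h2 := hF' p q hpq
    simp only at h1 h2
    rw [h1, h2]

end MatchedPair

end

noncomputable section

namespace MatchedPair

variable {G : Type*} [Group G] [TopologicalSpace G] [IsTopologicalGroup G] [LocallyCompactSpace G]
  [T2Space G] [SecondCountableTopology G] [MeasurableSpace G] [BorelSpace G]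
  (M : MatchedPair G) {p q : ℕ}
  {A : Type*} [AddCommGroup A] [TopologicalSpace A] [IsTopologicalAddGroup A] [PolishSpace A]
  [MeasurableSpace A] [BorelSpace A] [DistribMulAction G A] [ContinuousSMul G A]

/-! ### The map `I'` in homogeneous terms -/

/-- The map `I'` on families of Borel functions. -/
def borelAw (n : ℕ) (F : ∀ p q, borelFun (M.Gam p q) A) : BorelCochain G A n :=
  borelPull (M.ofDiag n) (M.measurable_ofDiag n) (fun _ => (1 : G)) measurable_const
    (∑ i : Fin (n + 1), borelPull (M.corner n (n - i) i (by omega))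
      (M.quasiMeasurePreserving_corner n (n - i) i (by omega)).measurable
      (M.leftProd n i (by omega)) (M.measurable_leftProd n i (by omega)) (F (n - i) i))

theorem mapI'_totClass (n : ℕ) (F : ∀ p q, borelFun (M.Gam p q) A) :
    M.mapI' A n (M.totClass n F) = borelToL G A n (M.borelAw n F) := by
  simp only [mapI', AddMonoidHom.comp_apply, AddMonoidHom.finsetSum_apply]
  refine (congrArg _ ?_).trans (lPull_borelClass (M.quasiMeasurePreserving_ofDiag n) _ _ _)
  refine Eq.trans (Finset.sum_congr rfl fun i _ => ?_) (map_sum (borelClass _) _ _).symm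
  rw [← lPull_borelClass (M.quasiMeasurePreserving_corner n (n - i) i (by omega))]
  rfl

/-- The corner with `i` columns has rows `z i, …, z n` and columns `z 0, …, z i`. The first `i`
edges of the left column lead from `z 0` to the vertex of row `z i` and column `z 0`, the base
vertex of that corner. -/
theorem homog_borelAw {n : ℕ} (F : ∀ p q, borelFun (M.Gam p q) A) {z : Fin (n + 1) → G}
    (h : M.Good z z) :
    homog n (M.borelAw n F).1 (List.ofFn z)
      = aw (M.homog₂ fun p q => (F p q).1) (List.ofFn z) := by
  have e : (M.borelAw n F).1 (steps z) = ∑ i : Fin (n + 1),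
      M.leftProd n i (by omega) (M.grid z z) •
        (F (n - i) i).1 (M.corner n (n - i) i (by omega) (M.grid z z)) := by
    have h1 : M.ofDiag n (steps z) = M.grid z z := h.ofDiag_eq
    rw [← h1]
    change (1 : G) • (Subtype.val (∑ i : Fin (n + 1), _) : M.Gam n n → A) _ = _
    rw [AddSubgroup.val_finsetSum, Finset.sum_apply, one_smul]
    rfl
  rw [homog_ofFn, e, aw_eq_sum, List.length_ofFn, Finset.sum_range, Finset.smul_sum]
  refine Finset.sum_congr rfl fun i _ => ?_
  have hd : (List.ofFn z).drop i
      = List.ofFn fun a : Fin (n - i + 1) => z ⟨i + a, by omega⟩ := by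
    apply List.ext_getElem
    · simp; omega
    · intro k h1 h2
      simp only [List.getElem_drop, List.getElem_ofFn]
  have ht : (List.ofFn z).take (i + 1) = List.ofFn fun a : Fin (i + 1) => z ⟨a, by omega⟩ := by
    apply List.ext_getElem
    · simp; omega
    · intro k h1 h2
      simp only [List.getElem_take, List.getElem_ofFn]
  have h' : M.Good (fun a : Fin (n - i + 1) => z ⟨i + a, by omega⟩)
    (fun a : Fin ((i : ℕ) + 1) => z ⟨a, by omega⟩) := fun _ _ => h _ _
  rw [hd, ht, h'.homog₂_ofFn, h.corner_grid, smul_smul, leftProd_eq]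
  congr 1
  have h2 := h.vtx_eq i 0
  rw [vtx_self] at h2
  exact h2.symm

theorem eqGeneric_borelAw {n : ℕ} {F : ∀ p q, borelFun (M.Gam p q) A}
    (hF : M.HasDegree n fun p q => (F p q).1) :
    EqGeneric (homog n (M.borelAw n F).1) (aw (M.homog₂ fun p q => (F p q).1)) := by
  refine M.generic_goodLists.mono fun l hl l' hl' => ?_
  by_cases hlen : l'.length = n + 1
  · obtain ⟨z, rfl⟩ := exists_eq_ofFn hlen
    refine M.homog_borelAw F ((M.goodLists_ofFn z z).mp ?_)
    exact GoodLists.sublist hl hl' hl'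
  · rw [homog_of_ne _ hlen, aw_eq_sum, Finset.sum_eq_zero]
    intro i hi
    have hi' := Finset.mem_range.mp hi
    refine hF.homog₂_eq_zero M ?_
    simp
    omega

/-- This is `aw_tot` on generic lists; its boundary terms vanish because `homog₂` is zero when a
list is empty. -/
theorem isCochainMap_mapI' : IsCochainMap (M.totCoboundary A) (lCoboundary G A) (M.mapI' A) := by
  intro n T
  obtain ⟨F, hF, rfl⟩ := M.exists_totClass_eq T
  rw [totCoboundary_totClass, mapI'_totClass, mapI'_totClass, isCochainMap_borelToL]
  refine borelClass_eq_iff.mpr (eqGeneric_homog_iff.mp ?_)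
  rw [homog_borelCoboundary]
  have hF' : M.HasDegree (n + 1) fun p q => (M.borelTot F p q).1 := by
    rw [coe_borelTot]; exact hF.totSum M
  refine (M.eqGeneric_borelAw hF).cbd.trans (EqGeneric.trans ?_ (M.eqGeneric_borelAw hF').symm)
  rw [coe_borelTot]
  refine EqGeneric.trans ?_ (eqGeneric_tot_homog₂ (M := M) fun p q => (F p q).1).aw
  intro N
  refine Filter.Eventually.of_forall fun w l _ => ?_
  rw [aw_tot]
  simp

/-! ### The map `I` in homogeneous terms -/

/-- The number of steps of the given kind before step `t`. -/
def countBefore {n : ℕ} (w : Fin n → Bool) (b : Bool) (t : ℕ) : ℕ :=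
  (Finset.univ.filter fun u : Fin n => (u : ℕ) < t ∧ w u = b).card

theorem stepsBefore_eq {n : ℕ} (w : Fin n → Bool) (b : Bool) (t : Fin n) :
    stepsBefore w b t = countBefore w b t := rfl

theorem card_filter_fin_succ {n : ℕ} (P : Fin (n + 1) → Prop) [DecidablePred P] :
    (Finset.univ.filter P).card
      = (if P 0 then 1 else 0) + (Finset.univ.filter fun i : Fin n => P i.succ).card := by
  rw [Finset.card_filter, Fin.sum_univ_succ, Finset.card_filter]

@[simp] theorem countBefore_zero {n : ℕ} (w : Fin n → Bool) (b : Bool) : countBefore w b 0 = 0 := by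
  simp [countBefore]

theorem countBefore_cons {n : ℕ} (c : Bool) (w : Fin n → Bool) (b : Bool) (t : ℕ) :
    countBefore (Fin.cons c w : Fin (n + 1) → Bool) b (t + 1)
      = (if c = b then 1 else 0) + countBefore w b t := by
  rw [countBefore, card_filter_fin_succ]
  simp [countBefore]

theorem countBefore_succ {n : ℕ} (w : Fin n → Bool) (b : Bool) (t : Fin n) :
    countBefore w b (t + 1) = countBefore w b t + if w t = b then 1 else 0 := by
  induction n with
  | zero => exact t.elim0
  | succ n ih =>
    rw [← Fin.cons_self_tail w]
    refine Fin.cases ?_ (fun t => ?_) t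
    · rw [countBefore_cons]; simp
    · rw [countBefore_cons, Fin.val_succ, countBefore_cons, ih, Fin.cons_succ]
      omega

theorem countBefore_mono {n : ℕ} (w : Fin n → Bool) (b : Bool) {s t : ℕ} (h : s ≤ t) :
    countBefore w b s ≤ countBefore w b t :=
  Finset.card_le_card fun u => by
    simp only [Finset.mem_filter, Finset.mem_univ, true_and]
    exact fun hu => ⟨hu.1.trans_le h, hu.2⟩

theorem countBefore_total {n : ℕ} (w : Fin n → Bool) (b : Bool) :
    countBefore w b n = (Finset.univ.filter fun u => w u = b).card := by
  simp [countBefore]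

theorem card_false {n p q : ℕ} (hn : p + q = n) {w : Fin n → Bool}
    (hw : (Finset.univ.filter fun u => w u = true).card = p) :
    (Finset.univ.filter fun u => w u = false).card = q := by
  have := Finset.card_filter_add_card_filter_not (s := (Finset.univ : Finset (Fin n)))
    (fun u => w u = true)
  simp only [Bool.not_eq_true, Finset.card_univ, Fintype.card_fin] at this
  omega

theorem squaresAbove_cons {n : ℕ} (c : Bool) (w : Fin n → Bool) :
    squaresAbove (Fin.cons c w : Fin (n + 1) → Bool)
      = squaresAbove w + if c = true then (Finset.univ.filter fun u => w u = false).card else 0 := by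
  simp only [squaresAbove, Finset.sum_filter, stepsBefore_eq]
  rw [Fin.sum_univ_succ, Finset.card_filter]
  simp only [Fin.cons_zero, Fin.val_zero, countBefore_zero, ite_self, zero_add, Fin.cons_succ,
    Fin.val_succ, countBefore_cons]
  cases c
  · simp
  · simp only [if_true]
    rw [← Finset.sum_add_distrib]
    refine Finset.sum_congr rfl fun t _ => ?_
    split_ifs <;> omega

theorem sum_fin_succ_bool {n : ℕ} (f : (Fin (n + 1) → Bool) → A) :
    ∑ w, f w = ∑ w : Fin n → Bool, f (Fin.cons true w) + ∑ w : Fin n → Bool, f (Fin.cons false w) := by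
  rw [← (Fin.consEquiv fun _ : Fin (n + 1) => Bool).sum_comp, Fintype.sum_prod_type,
    Fintype.sum_bool]
  rfl

theorem sum_latticePaths_succ {n p : ℕ} (f : (Fin (n + 1) → Bool) → A) :
    ∑ w ∈ latticePaths (n + 1) (p + 1), f w
      = ∑ w ∈ latticePaths n p, f (Fin.cons true w)
        + ∑ w ∈ latticePaths n (p + 1), f (Fin.cons false w) := by
  simp only [latticePaths, Finset.sum_filter]
  rw [sum_fin_succ_bool]
  simp [card_filter_fin_succ, add_comm 1]

theorem sum_latticePaths_zero {n : ℕ} (f : (Fin (n + 1) → Bool) → A) :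
    ∑ w ∈ latticePaths (n + 1) 0, f w = ∑ w ∈ latticePaths n 0, f (Fin.cons false w) := by
  simp only [latticePaths, Finset.sum_filter]
  rw [sum_fin_succ_bool]
  simp only [card_filter_fin_succ]
  simp

theorem latticePaths_eq_empty {n p : ℕ} (h : n < p) : latticePaths n p = ∅ := by
  refine Finset.filter_eq_empty_iff.mpr fun w _ hw => ?_
  have := Finset.card_filter_le (Finset.univ : Finset (Fin n)) fun t => w t = true
  simp at this
  omega

/-- The recursion of `sh` reads a path by its first step. A first step down puts one more square
above each later step to the right, and their number is the exponent of the sign in the recursion; a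
first step right changes no count. -/
theorem sh_eq_sum {X Y Z : Type*} (v : X → Y → Z) (x₀ : X) (y₀ : Y) (n : ℕ) (Φ : List Z → A)
    (p q : ℕ) (hn : p + q = n) (α : List X) (β : List Y) (ha : α.length = p + 1)
    (hb : β.length = q + 1) :
    sh v Φ α β = ∑ w ∈ latticePaths n p, (-1 : ℤ) ^ squaresAbove w •
      Φ (List.ofFn fun t : Fin (n + 1) =>
        v (α.getD (countBefore w true t) x₀) (β.getD (countBefore w false t) y₀)) := by
  induction n generalizing p q α β Φ with
  | zero =>
    obtain rfl : p = 0 := by omega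
    obtain rfl : q = 0 := by omega
    obtain ⟨a, rfl⟩ := List.length_eq_one_iff.mp ha
    obtain ⟨b, rfl⟩ := List.length_eq_one_iff.mp hb
    rw [sh_cons_cons]
    simp [ifNil, latticePaths, squaresAbove]
  | succ n ih =>
    obtain ⟨a, α, rfl⟩ := List.exists_cons_of_length_eq_add_one ha
    obtain ⟨b, β, rfl⟩ := List.exists_cons_of_length_eq_add_one hb
    rw [sh_cons_cons]
    have h0 : ifNil α β (Φ [v a b]) = 0 := by
      unfold ifNil
      split
      · simp at ha hb; omega
      · rfl
    have hT : (-1 : ℤ) ^ β.length • sh v (fun l => Φ (v a b :: l)) α (b :: β)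
        = if p = 0 then 0 else ∑ w ∈ latticePaths n (p - 1),
          (-1 : ℤ) ^ squaresAbove (Fin.cons true w : Fin (n + 1) → Bool) •
          Φ (List.ofFn fun t : Fin (n + 2) =>
            v ((a :: α).getD (countBefore (Fin.cons true w : Fin (n + 1) → Bool) true t) x₀)
              ((b :: β).getD (countBefore (Fin.cons true w : Fin (n + 1) → Bool) false t) y₀)) := by
      split_ifs with hp
      · have : α = [] := by
          rw [← List.length_eq_zero_iff]; simp at ha; omega
        rw [this]; simp
      · rw [ih _ (p - 1) q (by omega) α (b :: β) (by simp at ha; omega) hb, Finset.smul_sum]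
        refine Finset.sum_congr rfl fun w hw => ?_
        have hq : (Finset.univ.filter fun u => w u = false).card = q :=
          card_false (by omega : p - 1 + q = n) (by simpa [latticePaths] using hw)
        have hb' : β.length = q := by simpa using hb
        rw [squaresAbove_cons, hq, smul_smul, ← pow_add, hb', if_pos rfl, add_comm]
        congr 2
        rw [List.ofFn_succ (n := n + 1)]
        simp [countBefore_cons, add_comm 1]
    have hF : sh v (fun l => Φ (v a b :: l)) (a :: α) β
        = ∑ w ∈ latticePaths n p,
          (-1 : ℤ) ^ squaresAbove (Fin.cons false w : Fin (n + 1) → Bool) •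
          Φ (List.ofFn fun t : Fin (n + 2) =>
            v ((a :: α).getD (countBefore (Fin.cons false w : Fin (n + 1) → Bool) true t) x₀)
              ((b :: β).getD (countBefore (Fin.cons false w : Fin (n + 1) → Bool) false t) y₀)) := by
      by_cases hq : q = 0
      · have : β = [] := by
          rw [← List.length_eq_zero_iff]; simp at hb; omega
        rw [this, latticePaths_eq_empty (by omega)]; simp
      · rw [ih _ p (q - 1) (by omega) (a :: α) β ha (by simp at hb; omega)]
        refine Finset.sum_congr rfl fun w hw => ?_
        rw [squaresAbove_cons, if_neg (by simp), add_zero]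
        congr 2
        rw [List.ofFn_succ (n := n + 1)]
        simp [countBefore_cons, add_comm 1]
    rw [h0, hT, hF, zero_add]
    cases p with
    | zero => rw [if_pos rfl, zero_add, sum_latticePaths_zero]
    | succ p => rw [if_neg (by omega), sum_latticePaths_succ]; rfl

variable {M}

/-- Each edge is the quotient of the vertices at its ends, and one step raises exactly one of the
two counters. As the final counts are `p` and `q`, the default values of `Gam.edge` are never taken.
-/
theorem Good.edge_grid {n : ℕ} (hn : p + q = n) {x : Fin (p + 1) → G} {y : Fin (q + 1) → G}
    (h : M.Good x y) {w : Fin n → Bool} (hw : w ∈ latticePaths n p) :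
    (M.grid x y).edge w = steps fun t : Fin (n + 1) =>
      M.vtx ((List.ofFn x).getD (countBefore w true t) 1)
        ((List.ofFn y).getD (countBefore w false t) 1) := by
  have hp : (Finset.univ.filter fun u => w u = true).card = p := by simpa [latticePaths] using hw
  have hq := card_false hn hp
  rw [← countBefore_total] at hp hq
  have hx : ∀ i (hi : i < p + 1), (List.ofFn x).getD i 1 = x ⟨i, hi⟩ :=
    fun i hi => getD_ofFn x ⟨i, hi⟩ 1
  have hy : ∀ i (hi : i < q + 1), (List.ofFn y).getD i 1 = y ⟨i, hi⟩ :=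
    fun i hi => getD_ofFn y ⟨i, hi⟩ 1
  funext t
  have h1 := countBefore_succ w true t
  have h2 := countBefore_succ w false t
  have h3 := countBefore_mono w true (Nat.succ_le_of_lt t.isLt)
  have h4 := countBefore_mono w false (Nat.succ_le_of_lt t.isLt)
  simp only [Nat.succ_eq_add_one] at h3 h4
  have hs : ∀ b, stepsBefore w b t = countBefore w b t := fun _ => rfl
  simp only [steps, Fin.val_castSucc, Fin.val_succ, Gam.edge]
  by_cases ht : w t = true
  · simp only [ht, if_true, Bool.true_eq_false, if_false, add_zero] at h1 h2 ⊢
    rw [dif_pos ⟨by rw [hs]; omega, by rw [hs]; omega⟩, h.coe_vert, h1, h2, hx _ (by omega), hx _ (by omega),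
      hy _ (by omega)]
    rfl
  · have ht' : w t = false := by simpa using ht
    simp only [ht', if_true, Bool.false_eq_true, if_false, add_zero] at h1 h2 ⊢
    rw [dif_pos ⟨by rw [hs]; omega, by rw [hs]; omega⟩, h.coe_horiz, h1, h2, hy _ (by omega),
      hy _ (by omega), hx _ (by omega)]
    rfl

variable (M)

/-- The family of path sums, put to zero outside the total degree `n`. -/
def pathFamily (n : ℕ) (F : BorelCochain G A n) (p q : ℕ) : borelFun (M.Gam p q) A :=
  if p + q = n then M.pathSum A n p q F else 0

theorem hasDegree_pathFamily (n : ℕ) (F : BorelCochain G A n) :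
    M.HasDegree n fun p q => (M.pathFamily n F p q).1 := by
  intro p q hpq
  simp only [pathFamily, if_neg hpq]
  rfl

theorem mapI_eq (n : ℕ) (F : BorelCochain G A n) :
    M.mapI A n F = M.totClass n (M.pathFamily n F) := by
  funext x
  simp only [totClass, pathFamily, if_pos x.2]
  rfl

theorem pathSum_apply (n p q : ℕ) (F : BorelCochain G A n) (X : M.Gam p q) :
    (M.pathSum A n p q F).1 X
      = ∑ w ∈ latticePaths n p, (-1 : ℤ) ^ squaresAbove w • F.1 (X.edge w) := by
  simp only [pathSum, AddMonoidHom.finsetSum_apply, AddSubgroup.val_finsetSum,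
    Finset.sum_apply, AddMonoidHom.smul_apply, AddSubgroup.coe_zsmul, Pi.smul_apply]
  refine Finset.sum_congr rfl fun w _ => ?_
  congr 1
  exact one_smul G _

theorem sh_homog_of_length_ne {n : ℕ} (F : (Fin n → G) → A) {α β : List G}
    (h : α.length + β.length ≠ n + 2) : sh M.vtx (homog n F) α β = 0 := by
  cases ha : α.length with
  | zero => rw [List.length_eq_zero_iff] at ha; subst ha; simp
  | succ p =>
    cases hb : β.length with
    | zero => rw [List.length_eq_zero_iff] at hb; subst hb; simp
    | succ q =>
      rw [sh_eq_sum M.vtx 1 1 (p + q) _ p q rfl α β ha hb]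
      refine Finset.sum_eq_zero fun w _ => ?_
      rw [homog_of_ne _ (by simp; omega), smul_zero]

theorem homog₂_pathFamily (n : ℕ) (F : BorelCochain G A n) {α β : List G}
    (h : M.GoodLists α β) :
    M.homog₂ (fun p q => (M.pathFamily n F p q).1) α β = sh M.vtx (homog n F.1) α β := by
  by_cases hl : α.length + β.length = n + 2
  · cases ha : α.length with
    | zero => rw [List.length_eq_zero_iff] at ha; subst ha; simp
    | succ p =>
      cases hb : β.length with
      | zero => rw [List.length_eq_zero_iff] at hb; subst hb; simp
      | succ q =>
        have hpq : p + q = n := by omega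
        rw [sh_eq_sum M.vtx 1 1 n _ p q hpq α β ha hb]
        obtain ⟨x, rfl⟩ := exists_eq_ofFn ha
        obtain ⟨y, rfl⟩ := exists_eq_ofFn hb
        have hG := (M.goodLists_ofFn x y).mp h
        rw [hG.homog₂_ofFn]
        simp only [pathFamily, if_pos hpq]
        rw [pathSum_apply, Finset.smul_sum]
        refine Finset.sum_congr rfl fun w hw => ?_
        rw [homog_ofFn, hG.edge_grid hpq hw, smul_comm]
        simp [List.ofFn_succ]
  · rw [(M.hasDegree_pathFamily n F).homog₂_eq_zero M hl, sh_homog_of_length_ne M _ hl]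

theorem eqGeneric_pathFamily (n : ℕ) (F : BorelCochain G A n) :
    EqGeneric₂ (M.homog₂ fun p q => (M.pathFamily n F p q).1) (sh M.vtx (homog n F.1)) :=
  M.generic_goodLists_sublist.mono fun _ hl α β ha hb => M.homog₂_pathFamily n F (hl α β ha hb)

theorem isCochainMap_mapI : IsCochainMap (borelCoboundary G A) (M.totCoboundary A) (M.mapI A) := by
  intro n F
  rw [mapI_eq, mapI_eq, totCoboundary_totClass]
  refine M.totClass_eq_of_eqGeneric ?_
  have h1 := eqGeneric_tot_homog₂ (M := M) fun p q => (M.pathFamily n F p q).1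
  have h2 := (M.eqGeneric_pathFamily n F).tot
  have h3 := M.eqGeneric_pathFamily (n + 1) (borelCoboundary G A n F)
  rw [← coe_borelTot] at h1
  have h4 : tot (sh M.vtx (homog n F.1)) = sh M.vtx (homog (n + 1) (borelCoboundary G A n F).1) := by
    funext α β
    -- The extra term of `sh_cbd` is the value on the empty list, and `homog n` vanishes there.
    have h0 : ifSingle α β (0 : A) = 0 := by unfold ifSingle; split <;> rfl
    rw [homog_borelCoboundary, sh_cbd, homog_of_ne _ (by simp), h0, add_zero]
  rw [h4] at h2
  exact ((h1.symm.trans h2).trans h3.symm).mono fun l hl α β ha hb _ => hl α β ha hb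

end MatchedPair

end

noncomputable section

/-! ### Equivariance of the operations on cochains -/

section Equivariance

variable {Z Z' A A' : Type*} [AddCommGroup A] [AddCommGroup A'] {T : Z → Z'} {σ : A →+ A'}

theorem cbd_map {Φ : List Z → A} {Φ' : List Z' → A'} (h : ∀ l, Φ' (l.map T) = σ (Φ l)) (l : List Z) :
    cbd Φ' (l.map T) = σ (cbd Φ l) := by
  induction l generalizing Φ Φ' with
  | nil => simp
  | cons a l ih =>
    rw [List.map_cons, cbd_cons, cbd_cons, map_sub, h,
      ih (Φ := fun l => Φ (a :: l)) (Φ' := fun l => Φ' (T a :: l)) fun l => h (a :: l)]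

theorem aw_map {Ψ : List Z → List Z → A} {Ψ' : List Z' → List Z' → A'}
    (h : ∀ α β, Ψ' (α.map T) (β.map T) = σ (Ψ α β)) (l : List Z) :
    aw Ψ' (l.map T) = σ (aw Ψ l) := by
  rw [aw_eq_sum, aw_eq_sum, map_sum, List.length_map]
  refine Finset.sum_congr rfl fun i _ => ?_
  rw [← h, List.map_drop, List.map_take]

theorem sh_map {v : Z → Z → Z} {v' : Z' → Z' → Z'} (hv : ∀ a b, v' (T a) (T b) = T (v a b))
    {Φ : List Z → A} {Φ' : List Z' → A'} (h : ∀ l, Φ' (l.map T) = σ (Φ l)) (α β : List Z) :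
    sh v' Φ' (α.map T) (β.map T) = σ (sh v Φ α β) := by
  induction hn : α.length + β.length using Nat.strong_induction_on generalizing α β Φ Φ' with
  | _ n ih =>
    match α, β with
    | [], β => simp
    | a :: α, [] => simp
    | a :: α, b :: β =>
      have h' : ∀ l, Φ' (v' (T a) (T b) :: l.map T) = σ (Φ (v a b :: l)) := by
        intro l; rw [hv]; exact h (v a b :: l)
      have h1 := ih _ (by subst hn; simp) (Φ := fun l => Φ (v a b :: l))
        (Φ' := fun l => Φ' (v' (T a) (T b) :: l)) h' α (b :: β) rfl
      have h2 := ih _ (by subst hn; simp) (Φ := fun l => Φ (v a b :: l))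
        (Φ' := fun l => Φ' (v' (T a) (T b) :: l)) h' (a :: α) β rfl
      have h0 : ifNil (α.map T) (β.map T) (Φ' [v' (T a) (T b)]) = σ (ifNil α β (Φ [v a b])) := by
        unfold ifNil
        cases α <;> cases β <;> simp
        exact h' []
      rw [List.map_cons, List.map_cons] at *
      rw [sh_cons_cons, sh_cons_cons, h1, h2, h0, List.length_map, map_add, map_add, map_zsmul]

theorem shuffleDefect_map {v : Z → Z → Z} {v' : Z' → Z' → Z'}
    (hv : ∀ a b, v' (T a) (T b) = T (v a b)) {Φ : List Z → A} {Φ' : List Z' → A'}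
    (h : ∀ l, Φ' (l.map T) = σ (Φ l)) (l : List Z) :
    shuffleDefect v' Φ' (l.map T) = σ (shuffleDefect v Φ l) := by
  unfold shuffleDefect
  by_cases hl : l = []
  · simp [hl]
  · rw [if_neg hl, if_neg (by simpa using hl), map_sub, h, aw_map fun α β => sh_map hv h α β]

/-- Equivariance of the cone points is asked on nonempty lists only, because a default value at the
empty list is not equivariant. On lists of the matching length no other cone points occur. -/
theorem cone_map {e : (List Z → A) → List Z → A} {e' : (List Z' → A') → List Z' → A'}
    {c : List Z → Z} {c' : List Z' → Z'}
    (he : ∀ Φ Φ', (∀ l, Φ' (l.map T) = σ (Φ l)) → ∀ l, e' Φ' (l.map T) = σ (e Φ l))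
    (hc : ∀ l ≠ [], c' (l.map T) = T (c l)) (n : ℕ) {Φ : List Z → A} {Φ' : List Z' → A'}
    (h : ∀ l, Φ' (l.map T) = σ (Φ l)) (l : List Z) (hl : l.length = n) :
    cone e' c' n Φ' (l.map T) = σ (cone e c n Φ l) := by
  induction n generalizing Φ Φ' l with
  | zero => simp [cone]
  | succ n ih =>
    cases n with
    | zero => simp [cone]
    | succ n =>
      have hl0 : l ≠ [] := List.ne_nil_of_length_eq_add_one hl
      have h' : ∀ l', Φ' (c' (l.map T) :: l'.map T) = σ (Φ (c l :: l')) := by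
        intro l'; rw [hc l hl0]; exact h (c l :: l')
      simp only [cone]
      rw [map_sub, he (fun l' => Φ (c l :: l')) (fun l' => Φ' (c' (l.map T) :: l')) h' l]
      congr 1
      rw [cbd_eq_sum, cbd_eq_sum, map_sum, List.length_map]
      refine Finset.sum_congr rfl fun k hk => ?_
      rw [map_zsmul, ← ih (Φ := fun l' => Φ (c l :: l'))
        (Φ' := fun l' => Φ' (c' (l.map T) :: l')) h' _ ?_, List.eraseIdx_map]
      rw [List.length_eraseIdx_of_lt (Finset.mem_range.mp hk)]
      omega

end Equivariance

/-! ### Measurable families of cochains -/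

section Measurability

variable {Ω G A : Type*} [MeasurableSpace Ω] [MeasurableSpace G] [AddCommGroup A]
  [TopologicalSpace A] [IsTopologicalAddGroup A] [PolishSpace A] [MeasurableSpace A] [BorelSpace A]

/-- The values of a family of functions on lists depend measurably on the parameter and on the
entries of the list. -/
def MeasurableFamily (F : Ω → List G → A) : Prop :=
  ∀ us : List (Ω → G), (∀ u ∈ us, Measurable u) → Measurable fun ω => F ω (us.map (· ω))

/-- The same for functions on pairs of lists. -/
def MeasurableFamily₂ (F : Ω → List G → List G → A) : Prop :=
  ∀ us vs : List (Ω → G), (∀ u ∈ us, Measurable u) → (∀ u ∈ vs, Measurable u) →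
    Measurable fun ω => F ω (us.map (· ω)) (vs.map (· ω))

theorem MeasurableFamily.cons {F : Ω → List G → A} (hF : MeasurableFamily F) {u : Ω → G}
    (hu : Measurable u) : MeasurableFamily fun ω l => F ω (u ω :: l) := by
  intro us hus
  exact hF (u :: us) (by simpa [hu] using hus)

theorem measurable_zsmul (k : ℤ) {f : Ω → A} (hf : Measurable f) : Measurable fun ω => k • f ω :=
  (continuous_zsmul k).measurable.comp hf

theorem measurable_cbd {F : Ω → List G → A} {us : List (Ω → G)}
    (hF : ∀ vs : List (Ω → G), vs.Sublist us → vs.length + 1 = us.length →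
      Measurable fun ω => F ω (vs.map (· ω))) :
    Measurable fun ω => cbd (F ω) (us.map (· ω)) := by
  simp only [cbd_eq_sum, List.length_map]
  refine Finset.measurable_fun_sum _ fun k hk => measurable_zsmul _ ?_
  have hk' := Finset.mem_range.mp hk
  have := hF (us.eraseIdx k) (List.eraseIdx_sublist _ _)
    (by rw [List.length_eraseIdx_of_lt hk']; omega)
  simpa [List.eraseIdx_map] using this

theorem MeasurableFamily.cbd {F : Ω → List G → A} (hF : MeasurableFamily F) :
    MeasurableFamily fun ω => cbd (F ω) :=
  fun _ hus => measurable_cbd fun vs hvs _ => hF vs fun u hu => hus u (hvs.subset hu)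

theorem MeasurableFamily₂.aw {F : Ω → List G → List G → A} (hF : MeasurableFamily₂ F) :
    MeasurableFamily fun ω => aw (F ω) := by
  intro us hus
  simp only [aw_eq_sum, List.length_map]
  refine Finset.measurable_fun_sum _ fun i _ => ?_
  simp only [← List.map_drop, ← List.map_take]
  exact hF _ _ (fun u hu => hus u ((List.drop_sublist _ _).subset hu))
    fun u hu => hus u ((List.take_sublist _ _).subset hu)

theorem MeasurableFamily.sh {v : G → G → G} (hv : Measurable fun p : G × G => v p.1 p.2)
    {F : Ω → List G → A} (hF : MeasurableFamily F) : MeasurableFamily₂ fun ω => sh v (F ω) := by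
  intro us vs hus hvs
  induction hn : us.length + vs.length using Nat.strong_induction_on generalizing us vs F with
  | _ n ih =>
    match us, vs with
    | [], vs => simp
    | u :: us, [] => simp
    | u :: us, w :: vs =>
      have hu : Measurable u := hus u (by simp)
      have hw : Measurable w := hvs w (by simp)
      have huw : Measurable fun ω => v (u ω) (w ω) := hv.comp (hu.prodMk hw)
      have hF' := hF.cons huw
      have h1 := ih _ (by subst hn; simp) hF' us (w :: vs) (fun x hx => hus x (by simp [hx])) hvs rfl
      have h2 := ih _ (by subst hn; simp) hF' (u :: us) vs hus (fun x hx => hvs x (by simp [hx])) rfl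
      have h0 : Measurable fun ω => ifNil (us.map (· ω)) (vs.map (· ω)) (F ω [v (u ω) (w ω)]) := by
        cases us <;> cases vs <;> simp only [ifNil, List.map_nil, List.map_cons, measurable_const]
        exact hF [fun ω => v (u ω) (w ω)] (by simpa using huw)
      simp only [List.map_cons] at h1 h2 ⊢
      simp only [sh_cons_cons, List.length_map]
      exact (h0.add (measurable_zsmul _ h1)).add h2

theorem MeasurableFamily.shuffleDefect {v : G → G → G}
    (hv : Measurable fun p : G × G => v p.1 p.2) {F : Ω → List G → A} (hF : MeasurableFamily F) :
    MeasurableFamily fun ω => shuffleDefect v (F ω) := by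
  intro us hus
  unfold _root_.shuffleDefect
  cases us with
  | nil => simp
  | cons u us =>
    simp only [List.map_cons, List.cons_ne_nil, if_false]
    exact (hF _ hus).sub ((hF.sh hv).aw _ hus)

theorem measurable_cone {e : (List G → A) → List G → A} {c : List G → G}
    (he : ∀ F : Ω → List G → A, MeasurableFamily F → MeasurableFamily fun ω => e (F ω))
    (hc : ∀ us : List (Ω → G), (∀ u ∈ us, Measurable u) → Measurable fun ω => c (us.map (· ω)))
    (n : ℕ) {F : Ω → List G → A} (hF : MeasurableFamily F) :
    MeasurableFamily fun ω => cone e c n (F ω) := by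
  induction n generalizing F with
  | zero => intro us _; simp only [cone]; exact measurable_const
  | succ n ih =>
    cases n with
    | zero => intro us _; simp only [cone]; exact measurable_const
    | succ n =>
      intro us hus
      have hF' := hF.cons (hc us hus)
      simp only [cone]
      exact (he _ hF' us hus).sub ((ih hF').cbd us hus)

end Measurability

/-! ### Borel cochains from equivariant measurable families -/

section Homogeneous

variable {G : Type*} [Group G] [TopologicalSpace G] [IsTopologicalGroup G] [LocallyCompactSpace G]
  [T2Space G] [SecondCountableTopology G] [MeasurableSpace G] [BorelSpace G]
  {A : Type*} [AddCommGroup A] [TopologicalSpace A] [IsTopologicalAddGroup A] [PolishSpace A]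
  [MeasurableSpace A] [BorelSpace A] [DistribMulAction G A] [ContinuousSMul G A]

theorem measurable_smul_apply {Ω : Type*} [MeasurableSpace Ω] {g : Ω → G} {f : Ω → A}
    (hg : Measurable g) (hf : Measurable f) : Measurable fun ω => g ω • f ω :=
  (continuous_smul : Continuous fun p : G × A => p.1 • p.2).measurable.comp (hg.prodMk hf)

theorem measurableFamily_homog {Ω : Type*} [MeasurableSpace Ω] {n : ℕ} {F : (Fin n → G) → A}
    (hF : Measurable F) : MeasurableFamily fun _ : Ω => homog n F := by
  intro us hus
  by_cases h : us.length = n + 1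
  · obtain ⟨u, rfl⟩ := exists_eq_ofFn h
    have hu : ∀ i, Measurable (u i) := fun i => hus _ (List.mem_ofFn.mpr ⟨i, rfl⟩)
    have e : ∀ ω, (List.ofFn u).map (· ω) = List.ofFn fun i => u i ω := by
      intro ω; rw [List.map_ofFn]; rfl
    simp only [e, homog_ofFn]
    refine measurable_smul_apply (hu 0) (hF.comp (measurable_pi_lambda _ fun k => ?_))
    exact (hu _).inv.mul (hu _)
  · have e : ∀ ω, homog n F (us.map (· ω)) = 0 := fun ω => homog_of_ne F (by simpa using h)
    simp only [e, measurable_const]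

theorem measurable_partialProd {n : ℕ} (i : Fin (n + 1)) :
    Measurable fun x : Fin n → G => Fin.partialProd x i := by
  induction i using Fin.induction with
  | zero => simp
  | succ i ih =>
    simp only [Fin.partialProd_succ]
    exact ih.mul (measurable_pi_apply i)

/-- Evaluate on partial products, that is, with the unit as base point; equivariance recovers the
values at every other base point. -/
theorem exists_homog_eq {n : ℕ} {K : List G → A}
    (hK : MeasurableFamily fun _ : Fin n → G => K)
    (hK' : ∀ (g : G) (l : List G), l.length = n + 1 → K (l.map (g * ·)) = g • K l) :
    ∃ F : BorelCochain G A n, ∀ l : List G, l.length = n + 1 → homog n F.1 l = K l := by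
  refine ⟨⟨fun x => K (List.ofFn (Fin.partialProd x)), ?_⟩, fun l hl => ?_⟩
  · have h := hK (List.ofFn fun (i : Fin (n + 1)) (x : Fin n → G) => Fin.partialProd x i) ?_
    · simp only [List.map_ofFn] at h
      exact h
    · intro u hu
      obtain ⟨i, rfl⟩ := List.mem_ofFn.mp hu
      exact measurable_partialProd i
  · obtain ⟨z, rfl⟩ := exists_eq_ofFn hl
    rw [homog_ofFn]
    change z 0 • K (List.ofFn (Fin.partialProd (steps z))) = _
    rw [← hK' _ _ (by simp), List.map_ofFn]
    congr 2
    funext i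
    simp [partialProd_steps]

theorem homog_sub {n : ℕ} (F F' : BorelCochain G A n) (l : List G) :
    homog n (F - F').1 l = homog n F.1 l - homog n F'.1 l := by
  unfold homog
  split_ifs
  · rw [← smul_sub]; rfl
  · simp

theorem homog_zero (n : ℕ) (l : List G) : homog n (0 : (Fin n → G) → A) l = 0 := by
  simp [homog]

end Homogeneous

/-! ### The composite of `I` and `I'` -/

namespace MatchedPair

variable {G : Type*} [Group G] [TopologicalSpace G] [IsTopologicalGroup G] [LocallyCompactSpace G]
  [T2Space G] [SecondCountableTopology G] [MeasurableSpace G] [BorelSpace G]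
  (M : MatchedPair G)
  {A : Type*} [AddCommGroup A] [TopologicalSpace A] [IsTopologicalAddGroup A] [PolishSpace A]
  [MeasurableSpace A] [BorelSpace A] [DistribMulAction G A] [ContinuousSMul G A]

/-- `I' ∘ I` and `j` agree on cohomology. -/
theorem mapI'_mapI_sub_mem (n : ℕ) (F : BorelCochain G A n) (hF : borelCoboundary G A n F = 0) :
    borelToL G A n F - M.mapI' A n (M.mapI A n F) ∈ coboundaries (lCoboundary G A) n := by
  set e : (List G → A) → List G → A := shuffleDefect M.vtx with he
  -- No generic choice is needed here: `M.vtx` is total with `M.vtx a a = a`, and the defect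
  -- commutes with `cbd` on all lists. Any Borel equivariant cone point would serve; the head is the
  -- simplest.
  set c : List G → G := fun l => l.headD 1 with hc
  set Φ := homog n F.1 with hΦ
  -- Zero is written as a difference so that `cone_sub` shows its cone to vanish.
  have h0 : cbd Φ = fun _ => (0 : A) - 0 := by
    rw [hΦ, ← homog_borelCoboundary, hF]
    funext l
    rw [sub_zero]
    exact homog_zero _ l
  have hcone : ∀ l : List G, l.length = n + 1 →
      cbd (cone e c n Φ) l = Φ l - aw (sh M.vtx Φ) l := by
    intro l hl
    have h1 := cone_cbd (e := e) (c := c) (shuffleDefect_sub M.vtx)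
      (shuffleDefect_cbd M.vtx M.vtx_self) n Φ l hl
    rw [h0, cone_sub (shuffleDefect_sub M.vtx), sub_self, zero_add,
      subdiv_eq_zero (shuffleDefect_of_length_le_one M.vtx M.vtx_self) _ _ _ hl, sub_zero] at h1
    rw [h1, he, shuffleDefect, if_neg (List.ne_nil_of_length_eq_add_one hl)]
  have hII : EqGeneric (homog n (M.borelAw n (M.pathFamily n F)).1) (aw (sh M.vtx Φ)) :=
    (M.eqGeneric_borelAw (M.hasDegree_pathFamily n F)).trans (M.eqGeneric_pathFamily n F).aw
  rw [mapI_eq, mapI'_totClass]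
  cases n with
  | zero =>
    change _ = (0 : LCochain G A 0)
    rw [sub_eq_zero]
    refine borelClass_eq_iff.mpr (eqGeneric_homog_iff.mp (EqGeneric.trans ?_ hII.symm))
    intro N
    refine Filter.Eventually.of_forall fun w l _ => ?_
    by_cases hl : l.length = 1
    · have := hcone l hl
      have h2 : cbd (cone e c 0 Φ) l = 0 := cbd_eq_zero fun _ _ _ => rfl
      rw [h2] at this
      exact (sub_eq_zero.mp this.symm)
    · rw [homog_of_ne _ hl, aw_eq_sum, Finset.sum_eq_zero]
      intro i hi
      have hi' := Finset.mem_range.mp hi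
      exact sh_homog_of_length_ne M _ (by simp; omega)
  | succ m =>
    obtain ⟨K, hK⟩ := exists_homog_eq (n := m) (K := cone e c (m + 1) Φ)
      (measurable_cone (fun F hF => hF.shuffleDefect M.measurable_vtx) (fun us hus => by
        cases us with
        | nil => simp [hc]
        | cons u us => simpa [hc] using hus u (by simp)) _ (measurableFamily_homog F.2))
      (fun g l hl => cone_map (σ := DistribSMul.toAddMonoidHom A g)
        (fun Φ Φ' h l => shuffleDefect_map (fun a b => M.vtx_smul g a b) h l)
        (fun l hl => by cases l with
          | nil => exact absurd rfl hl
          | cons a l => simp [hc]) _ (fun l => homog_smul _ _ g l) l hl)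
    refine ⟨borelToL G A m K, ?_⟩
    rw [isCochainMap_borelToL, eq_sub_iff_add_eq, ← eq_sub_iff_add_eq', ← map_sub]
    refine borelClass_eq_iff.mpr (eqGeneric_homog_iff.mp (hII.trans ?_))
    intro N
    refine Filter.Eventually.of_forall fun w l _ => ?_
    rw [homog_sub, homog_borelCoboundary]
    by_cases hl : l.length = m + 2
    · rw [cbd_congr fun l' _ h => hK l' (by omega), hcone l hl, sub_sub_cancel]
    · rw [homog_of_ne _ hl, cbd_eq_zero fun l' _ h => homog_of_ne _ (by omega), sub_zero,
        aw_eq_sum, Finset.sum_eq_zero]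
      intro i hi
      have hi' := Finset.mem_range.mp hi
      exact sh_homog_of_length_ne M _ (by simp; omega)

end MatchedPair

end

noncomputable section

section ListFacts

variable {Z A : Type*} [AddCommGroup A]

theorem cbd_forall₂ {R : Z → Z → Prop} {α α' : List Z} (hα : List.Forall₂ R α α')
    {Φ Φ' : List Z → A} (h : ∀ γ γ', List.Forall₂ R γ γ' → γ.Sublist α → Φ' γ' = Φ γ) :
    cbd Φ' α' = cbd Φ α := by
  induction hα generalizing Φ Φ' with
  | nil => simp
  | @cons a a' l l' ha hl ih =>
    rw [cbd_cons, cbd_cons, h _ _ hl (List.sublist_cons_self _ _)]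
    congr 1
    exact ih fun γ γ' hγ hs => h _ _ (List.Forall₂.cons ha hγ) (hs.cons_cons a)

theorem tot_add {Y : Type*} (Ψ Ψ' : List Z → List Y → A) (α : List Z) (β : List Y) :
    tot (fun α β => Ψ α β + Ψ' α β) α β = tot Ψ α β + tot Ψ' α β := by
  simp only [tot, cbd_add, smul_add]
  abel

end ListFacts

/-! ### Generic triples of lists -/

section Generic

variable {G : Type*} [Group G] [TopologicalSpace G] [IsTopologicalGroup G] [LocallyCompactSpace G]
  [T2Space G] [SecondCountableTopology G] [MeasurableSpace G] [BorelSpace G]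

/-- The property `P` holds for all sublists of generic lists, the third one being independent of
the first two. -/
def Generic₃ (P : List G → List G → List G → Prop) : Prop :=
  ∀ m n, ∀ᵐ z ∂((haarPow G m).prod (haarPow G n)), ∀ α β ζ : List G,
    α.Sublist (List.ofFn z.1) → β.Sublist (List.ofFn z.1) → ζ.Sublist (List.ofFn z.2) → P α β ζ

variable {P Q : List G → List G → List G → Prop}

theorem Generic₃.mono (h : Generic₃ P) (hPQ : ∀ α β ζ, (∀ α' β' ζ', α'.Sublist α → β'.Sublist β →
    ζ'.Sublist ζ → P α' β' ζ') → Q α β ζ) : Generic₃ Q := by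
  intro m n
  filter_upwards [h m n] with z hz α β ζ ha hb hc
  exact hPQ α β ζ fun α' β' ζ' ha' hb' hc' => hz _ _ _ (ha'.trans ha) (hb'.trans hb) (hc'.trans hc)

theorem Generic₃.and (h : Generic₃ P) (h' : Generic₃ Q) :
    Generic₃ fun α β ζ => P α β ζ ∧ Q α β ζ := by
  intro m n
  filter_upwards [h m n, h' m n] with z hz hz' α β ζ ha hb hc
  exact ⟨hz _ _ _ ha hb hc, hz' _ _ _ ha hb hc⟩

theorem Generic₃.nil (h : Generic₃ P) : Generic fun l => ∀ α β : List G, α.Sublist l →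
    β.Sublist l → P α β [] := by
  intro N
  have h1 := Measure.ae_ae_of_ae_prod (h N 0)
  have : (ae (haarPow G 0)).NeBot := by
    have : haarPow G 0 ≠ 0 := by
      rw [haarPow, Measure.pi_of_empty (fun _ : Fin 0 => (Measure.haar : Measure G))]
      exact Measure.dirac_ne_zero
    exact ae_neBot.mpr this
  filter_upwards [h1] with w hw α β ha hb
  obtain ⟨w', hw'⟩ := hw.exists
  exact hw' α β [] ha hb (List.nil_sublist _)

theorem generic₃_of_generic {P : List G → Prop} (h : Generic P)
    (hPQ : ∀ l α β ζ : List G, P l → (α ++ ζ).Sublist l → (β ++ ζ).Sublist l → Q α β ζ) :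
    Generic₃ Q := by
  intro m n
  filter_upwards [(quasiMeasurePreserving_append m n).ae (h (m + n))] with z hz α β ζ ha hb hc
  rw [List.ofFn_fin_append] at hz
  exact hPQ _ α β ζ hz (ha.append hc) (hb.append hc)

/-- The new point depends on the heads of `α` and `β`. Left multiplication by it is a shear that
preserves null sets in the product with the variable `k`, so by Fubini almost every `k` works,
simultaneously for the countably many lengths and positions of heads. The same point serves all
sublists `α'` and `β'`. -/
theorem Generic₃.cons {v : G → G → G} (hv : Measurable fun p : G × G => v p.1 p.2)
    (h : Generic₃ P) :
    ∀ᵐ k ∂(Measure.haar : Measure G), Generic₃ fun α β ζ => α ≠ [] → β ≠ [] →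
      ∀ α' β' : List G, α'.Sublist α → β'.Sublist β →
        P α' β' (v (α.headD 1) (β.headD 1) * k :: ζ) := by
  have key : ∀ m n : ℕ, ∀ᵐ k ∂(Measure.haar : Measure G),
      ∀ᵐ z ∂((haarPow G m).prod (haarPow G n)), ∀ (i j : Fin m) (α β ζ : List G),
        α.Sublist (List.ofFn z.1) → β.Sublist (List.ofFn z.1) → ζ.Sublist (List.ofFn z.2) →
          P α β (v (z.1 i) (z.1 j) * k :: ζ) := by
    intro m n
    have h1 : ∀ i j : Fin m, ∀ᵐ k ∂(Measure.haar : Measure G),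
        ∀ᵐ z ∂((haarPow G m).prod (haarPow G n)), ∀ (α β ζ : List G),
        α.Sublist (List.ofFn z.1) → β.Sublist (List.ofFn z.1) → ζ.Sublist (List.ofFn z.2) →
          P α β (v (z.1 i) (z.1 j) * k :: ζ) := by
      intro i j
      have hm : Measurable fun z : (Fin m → G) × (Fin n → G) => v (z.1 i) (z.1 j) :=
        hv.comp (by fun_prop : Measurable fun z : (Fin m → G) × (Fin n → G) => (z.1 i, z.1 j))
      have q1 := quasiMeasurePreserving_smul_skew (Measure.haar : Measure G)
        ((haarPow G m).prod (haarPow G n)) _ hm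
      have q2 := (measurePreserving_prodAssoc (Measure.haar : Measure G) (haarPow G m)
        (haarPow G n)).symm.quasiMeasurePreserving
      have q3 := QuasiMeasurePreserving.prodMap
        (Measure.measurePreserving_swap (μ := (Measure.haar : Measure G))
          (ν := haarPow G m)).quasiMeasurePreserving (.id (haarPow G n))
      have q4 := (measurePreserving_prodAssoc (haarPow G m) (Measure.haar : Measure G)
        (haarPow G n)).quasiMeasurePreserving
      have q5 := QuasiMeasurePreserving.prodMap (.id (haarPow G m))
        (measurePreserving_cons (Measure.haar : Measure G) n).quasiMeasurePreserving
      have h2 := (q5.comp (q4.comp (q3.comp (q2.comp q1)))).ae (h m (n + 1))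
      filter_upwards [Measure.ae_ae_of_ae_prod h2] with k hk
      filter_upwards [hk] with z hz α β ζ ha hb hc
      refine hz α β _ ha hb ?_
      change List.Sublist _ (List.ofFn (Fin.cons (v (z.1 i) (z.1 j) * k) z.2 : Fin (n + 1) → G))
      rw [List.ofFn_cons]
      exact hc.cons_cons _
    have h2 : ∀ᵐ k ∂(Measure.haar : Measure G), ∀ i j : Fin m,
        ∀ᵐ z ∂((haarPow G m).prod (haarPow G n)), ∀ (α β ζ : List G),
        α.Sublist (List.ofFn z.1) → β.Sublist (List.ofFn z.1) → ζ.Sublist (List.ofFn z.2) →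
          P α β (v (z.1 i) (z.1 j) * k :: ζ) := by
      simp only [ae_all_iff (ι := Fin m)]
      exact h1
    filter_upwards [h2] with k hk
    simp only [ae_all_iff (ι := Fin m)]
    exact hk
  have key' : ∀ᵐ k ∂(Measure.haar : Measure G), ∀ m n : ℕ,
      ∀ᵐ z ∂((haarPow G m).prod (haarPow G n)), ∀ (i j : Fin m) (α β ζ : List G),
        α.Sublist (List.ofFn z.1) → β.Sublist (List.ofFn z.1) → ζ.Sublist (List.ofFn z.2) →
          P α β (v (z.1 i) (z.1 j) * k :: ζ) := by
    simp only [ae_all_iff (ι := ℕ)]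
    exact key
  filter_upwards [key'] with k hk m n
  filter_upwards [hk m n] with z hz α β ζ ha hb hc ha0 hb0 α' β' ha' hb'
  obtain ⟨a, α, rfl⟩ := List.exists_cons_of_ne_nil ha0
  obtain ⟨b, β, rfl⟩ := List.exists_cons_of_ne_nil hb0
  obtain ⟨i, hi⟩ := List.mem_ofFn.mp (ha.subset List.mem_cons_self)
  obtain ⟨j, hj⟩ := List.mem_ofFn.mp (hb.subset List.mem_cons_self)
  have := hz i j α' β' ζ (ha'.trans ha) (hb'.trans hb) hc
  rw [hi, hj] at this
  exact this

end Generic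

/-! ### Cochains on three lists and the contraction of the third direction -/

namespace MatchedPair

variable {G : Type*} [Group G] [TopologicalSpace G] [IsTopologicalGroup G] [LocallyCompactSpace G]
  [T2Space G] [SecondCountableTopology G] [MeasurableSpace G] [BorelSpace G]
  (M : MatchedPair G)
  {A : Type*} [AddCommGroup A] [TopologicalSpace A] [IsTopologicalAddGroup A] [PolishSpace A]
  [MeasurableSpace A] [BorelSpace A] [DistribMulAction G A] [ContinuousSMul G A]

/-- The equivariant measurable functions of a list of rows, a list of columns and a list of
points. -/
structure Admissible (f : List G → List G → List G → A) : Prop where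
  nil_left : ∀ β ζ, f [] β ζ = 0
  nil_right : ∀ α ζ, f α [] ζ = 0
  smul : ∀ (g : G) (α β ζ : List G),
    f (α.map (g * ·)) (β.map (g * ·)) (ζ.map (g * ·)) = g • f α β ζ
  congr : ∀ α α' β β' ζ : List G, List.Forall₂ (fun a a' => a⁻¹ * a' ∈ M.G₂) α α' →
    List.Forall₂ (fun b b' => b⁻¹ * b' ∈ M.G₁) β β' → M.GoodLists α β → f α' β' ζ = f α β ζ
  meas : ∀ (p q : ℕ) (us vs ws : List (M.Gam p q → G)), (∀ u ∈ us, Measurable u) →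
    (∀ u ∈ vs, Measurable u) → (∀ u ∈ ws, Measurable u) →
    Measurable fun X => f (us.map (· X)) (vs.map (· X)) (ws.map (· X))

variable {M} {f g : List G → List G → List G → A}

theorem Admissible.zero : M.Admissible fun _ _ _ => (0 : A) :=
  ⟨by simp, by simp, by simp, by simp, fun _ _ _ _ _ _ _ _ => measurable_const⟩

theorem Admissible.add (hf : M.Admissible f) (hg : M.Admissible g) :
    M.Admissible fun α β ζ => f α β ζ + g α β ζ where
  nil_left β ζ := by simp [hf.nil_left, hg.nil_left]
  nil_right α ζ := by simp [hf.nil_right, hg.nil_right]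
  smul c α β ζ := by rw [hf.smul, hg.smul, smul_add]
  congr α α' β β' ζ h1 h2 h3 := by
    rw [hf.congr _ _ _ _ _ h1 h2 h3, hg.congr _ _ _ _ _ h1 h2 h3]
  meas p q us vs ws h1 h2 h3 := (hf.meas p q us vs ws h1 h2 h3).add (hg.meas p q us vs ws h1 h2 h3)

theorem Admissible.sub (hf : M.Admissible f) (hg : M.Admissible g) :
    M.Admissible fun α β ζ => f α β ζ - g α β ζ where
  nil_left β ζ := by simp [hf.nil_left, hg.nil_left]
  nil_right α ζ := by simp [hf.nil_right, hg.nil_right]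
  smul c α β ζ := by rw [hf.smul, hg.smul, smul_sub]
  congr α α' β β' ζ h1 h2 h3 := by
    rw [hf.congr _ _ _ _ _ h1 h2 h3, hg.congr _ _ _ _ _ h1 h2 h3]
  meas p q us vs ws h1 h2 h3 := (hf.meas p q us vs ws h1 h2 h3).sub (hg.meas p q us vs ws h1 h2 h3)

theorem Admissible.del (hf : M.Admissible f) : M.Admissible (del f) where
  nil_left β ζ := by
    have h1 : cbd (fun β' => f [] β' ζ) β = 0 := cbd_eq_zero fun _ _ _ => hf.nil_left _ _
    have h2 : cbd (fun ζ' => f [] β ζ') ζ = 0 := cbd_eq_zero fun _ _ _ => hf.nil_left _ _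
    simp [_root_.del, h1, h2]
  nil_right α ζ := by
    have h1 : cbd (fun α' => f α' [] ζ) α = 0 := cbd_eq_zero fun _ _ _ => hf.nil_right _ _
    have h2 : cbd (fun ζ' => f α [] ζ') ζ = 0 := cbd_eq_zero fun _ _ _ => hf.nil_right _ _
    simp [_root_.del, h1, h2]
  smul c α β ζ := by
    have e := hf.smul c
    have h1 := cbd_map (T := (c * ·)) (σ := DistribSMul.toAddMonoidHom A c)
      (Φ := fun β' => f α β' ζ) (Φ' := fun β' => f (α.map (c * ·)) β' (ζ.map (c * ·)))
      (fun β' => e α β' ζ) β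
    have h2 := cbd_map (T := (c * ·)) (σ := DistribSMul.toAddMonoidHom A c)
      (Φ := fun ζ' => f α β ζ') (Φ' := fun ζ' => f (α.map (c * ·)) (β.map (c * ·)) ζ')
      (fun ζ' => e α β ζ') ζ
    have h3 := cbd_map (T := (c * ·)) (σ := DistribSMul.toAddMonoidHom A c)
      (Φ := fun α' => f α' β ζ) (Φ' := fun α' => f α' (β.map (c * ·)) (ζ.map (c * ·)))
      (fun α' => e α' β ζ) α
    simp only [_root_.del, List.length_map]
    rw [h1, h2, h3]
    simp only [DistribSMul.toAddMonoidHom_apply, smul_add]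
    rw [smul_comm c, smul_comm c]
  congr α α' β β' ζ h1 h2 h3 := by
    simp only [_root_.del, ← h2.length_eq]
    rw [cbd_forall₂ h2 fun γ γ' hγ hs => hf.congr α α' γ γ' ζ h1 hγ
        (h3.sublist (List.Sublist.refl _) hs),
      cbd_forall₂ h1 fun γ γ' hγ hs => hf.congr γ γ' β β' ζ hγ h2
        (h3.sublist hs (List.Sublist.refl _)),
      cbd_congr fun ζ' _ _ => hf.congr α α' β β' ζ' h1 h2 h3]
  meas p q us vs ws h1 h2 h3 := by
    simp only [_root_.del, List.length_map]
    refine Measurable.add (Measurable.add ?_ (measurable_zsmul _ ?_)) (measurable_zsmul _ ?_)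
    · exact measurable_cbd (F := fun X β' => f (us.map (· X)) β' (ws.map (· X)))
        fun vs' hs _ => hf.meas p q us vs' ws h1 (fun u hu => h2 u (hs.subset hu)) h3
    · exact measurable_cbd (F := fun X ζ' => f (us.map (· X)) (vs.map (· X)) ζ')
        fun ws' hs _ => hf.meas p q us vs ws' h1 h2 fun u hu => h3 u (hs.subset hu)
    · exact measurable_cbd (F := fun X α' => f α' (vs.map (· X)) (ws.map (· X)))
        fun us' hs _ => hf.meas p q us' vs ws (fun u hu => h1 u (hs.subset hu)) h2 h3

variable (M) in
/-- The contraction in the third variable. -/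
def contract (k : G) (f : List G → List G → List G → A) (α β ζ : List G) : A :=
  (-1 : ℤ) ^ β.length • f α β (M.vtx (α.headD 1) (β.headD 1) * k :: ζ)

/-- The factor `k` stands on the right of the vertex, so left translations pass through, and the
vertex depends only on the cosets of its row and column. -/
theorem Admissible.contract (hf : M.Admissible f) (k : G) : M.Admissible (M.contract k f) where
  nil_left β ζ := by simp [MatchedPair.contract, hf.nil_left]
  nil_right α ζ := by simp [MatchedPair.contract, hf.nil_right]
  smul c α β ζ := by
    match α, β with
    | [], β => simp [MatchedPair.contract, hf.nil_left]
    | a :: α, [] => simp [MatchedPair.contract, hf.nil_right]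
    | a :: α, b :: β =>
      have := hf.smul c (a :: α) (b :: β) (M.vtx a b * k :: ζ)
      simp only [MatchedPair.contract, List.map_cons, List.headD_cons, List.length_cons,
        List.length_map, vtx_smul] at this ⊢
      rw [smul_comm c, ← this, mul_assoc]
  congr α α' β β' ζ h1 h2 h3 := by
    cases h1 with
    | nil => simp [MatchedPair.contract, hf.nil_left]
    | @cons a a' α α' ha h1 =>
      cases h2 with
      | nil => simp [MatchedPair.contract, hf.nil_right]
      | @cons b b' β β' hb h2 =>
        simp only [MatchedPair.contract, List.headD_cons, List.length_cons, h2.length_eq]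
        have h0 : M.Meet a b := h3 a (by simp) b (by simp)
        rw [(h0.congr ha hb).2, hf.congr _ _ _ _ _ (.cons ha h1) (.cons hb h2) h3]
  meas p q us vs ws h1 h2 h3 := by
    match us, vs with
    | [], vs => simp [MatchedPair.contract, hf.nil_left]
    | u :: us, [] => simp [MatchedPair.contract, hf.nil_right]
    | u :: us, v :: vs =>
      have hu : Measurable u := h1 u (by simp)
      have hv : Measurable v := h2 v (by simp)
      have huv : Measurable fun X => M.vtx (u X) (v X) * k :=
        (M.measurable_vtx.comp (hu.prodMk hv)).mul_const k
      have := hf.meas p q (u :: us) (v :: vs) ((fun X => M.vtx (u X) (v X) * k) :: ws) h1 h2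
        (by simpa [huv] using h3)
      simp only [MatchedPair.contract, List.map_cons, List.headD_cons, List.length_cons,
        List.length_map] at this ⊢
      exact measurable_zsmul _ this

/-- A cocycle that vanishes for long third lists is a coboundary for the empty third list. -/
theorem exists_tot_eq (m : ℕ) (hf : M.Admissible f)
    (hd : Generic₃ fun α β ζ => del f α β ζ = 0)
    (hm : Generic₃ fun α β ζ => m ≤ ζ.length → f α β ζ = 0) :
    ∃ g : List G → List G → List G → A, M.Admissible g ∧
      Generic₃ fun α β _ => f α β [] = tot (fun α β => g α β []) α β := by
  induction m generalizing f with
  | zero =>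
    refine ⟨fun _ _ _ => 0, Admissible.zero, hm.mono fun α β ζ h => ?_⟩
    rw [h α β [] (List.Sublist.refl _) (List.Sublist.refl _) (List.nil_sublist _) (by simp)]
    simp [tot, cbd_const_zero]
  | succ m ih =>
    have : (ae (Measure.haar : Measure G)).NeBot := ae_neBot.mpr (NeZero.ne _)
    -- One `k` that is generic for the vanishing and for the cocycle condition at once.
    obtain ⟨k, hk⟩ := ((hm.and hd).cons M.measurable_vtx).exists
    set f' : List G → List G → List G → A := fun α β ζ => f α β ζ - del (M.contract k f) α β ζ
      with hf'
    have hfa : M.Admissible f' := hf.sub (hf.contract k).del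
    have hd' : Generic₃ fun α β ζ => del f' α β ζ = 0 := by
      refine hd.mono fun α β ζ h => ?_
      rw [hf', del_sub, del_del, sub_zero]
      exact h _ _ _ (List.Sublist.refl _) (List.Sublist.refl _) (List.Sublist.refl _)
    have hm' : Generic₃ fun α β ζ => m ≤ ζ.length → f' α β ζ = 0 := by
      refine hk.mono fun α β ζ h hl => ?_
      by_cases ha : α = []
      · rw [ha]; exact hfa.nil_left _ _
      by_cases hb : β = []
      · rw [hb]; exact hfa.nil_right _ _
      have h0 : ∀ α' β' : List G, α'.Sublist α → β'.Sublist β → M.contract k f α' β' ζ = 0 := by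
        intro α' β' ha' hb'
        by_cases ha0 : α' = []
        · rw [ha0]; exact (hf.contract k).nil_left _ _
        by_cases hb0 : β' = []
        · rw [hb0]; exact (hf.contract k).nil_right _ _
        rw [contract, (h α' β' ζ ha' hb' (List.Sublist.refl _) ha0 hb0 α' β' (List.Sublist.refl _)
          (List.Sublist.refl _)).1 (by simpa using hl), smul_zero]
      have h1 := h α β ζ (List.Sublist.refl _) (List.Sublist.refl _) (List.Sublist.refl _) ha hb
      set v := M.vtx (α.headD 1) (β.headD 1) * k with hv
      -- The third list `v :: ζ` has at least `m + 1` entries, where `f` vanishes together with its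
      -- row and column faces. Only the third part of the cocycle condition survives, and it says
      -- that the contraction inverts that coboundary at `ζ`.
      have h2 : cbd (f α β) (v :: ζ) = 0 := by
        have h3 := (h1 α β (List.Sublist.refl _) (List.Sublist.refl _)).2
        rw [del, cbd_eq_zero fun β' hs _ => (h1 α β' (List.Sublist.refl _) hs).1 (by simpa using hl),
          cbd_eq_zero fun α' hs _ => (h1 α' β hs (List.Sublist.refl _)).1 (by simpa using hl)] at h3
        have h4 := congrArg ((-1 : ℤ) ^ β.length • ·) h3
        simpa [neg_one_pow_smul_smul] using h4
      have h5 : del (M.contract k f) α β ζ = cbd (fun ζ' => f α β (v :: ζ')) ζ := by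
        rw [del, cbd_eq_zero fun β' hs _ => h0 α β' (List.Sublist.refl _) hs,
          cbd_eq_zero fun α' hs _ => h0 α' β hs (List.Sublist.refl _)]
        simp only [contract, ← hv]
        rw [cbd_zsmul, neg_one_pow_smul_smul]
        simp
      rw [cbd_cons, sub_eq_zero] at h2
      rw [hf']
      simp only
      rw [h5, h2, sub_self]
    obtain ⟨g, hg, hgt⟩ := ih hfa hd' hm'
    -- The subtracted coboundary of the contraction restricts, at the empty third list, to the total
    -- coboundary of the contraction.
    refine ⟨fun α β ζ => g α β ζ + M.contract k f α β ζ, hg.add (hf.contract k),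
      hgt.mono fun α β ζ h => ?_⟩
    rw [tot_add, ← h α β ζ (List.Sublist.refl _) (List.Sublist.refl _) (List.Sublist.refl _),
      ← del_nil_right, hf', sub_add_cancel]

end MatchedPair

end

noncomputable section

namespace MatchedPair

variable {G : Type*} [Group G] [TopologicalSpace G] [IsTopologicalGroup G] [LocallyCompactSpace G]
  [T2Space G] [SecondCountableTopology G] [MeasurableSpace G] [BorelSpace G]
  (M : MatchedPair G)
  {A : Type*} [AddCommGroup A] [TopologicalSpace A] [IsTopologicalAddGroup A] [PolishSpace A]
  [MeasurableSpace A] [BorelSpace A] [DistribMulAction G A] [ContinuousSMul G A]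

/-! ### Homogeneous cochains are admissible -/

theorem homog₂_smul (F : ∀ p q, M.Gam p q → A) (g : G) (α β : List G) :
    M.homog₂ F (α.map (g * ·)) (β.map (g * ·)) = g • M.homog₂ F α β := by
  by_cases h : M.GoodLists α β
  · cases ha : α.length with
    | zero => rw [List.length_eq_zero_iff] at ha; subst ha; simp
    | succ p =>
      cases hb : β.length with
      | zero => rw [List.length_eq_zero_iff] at hb; subst hb; simp
      | succ q =>
        obtain ⟨x, rfl⟩ := exists_eq_ofFn ha
        obtain ⟨y, rfl⟩ := exists_eq_ofFn hb
        have hG := (M.goodLists_ofFn x y).mp h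
        have h2 := Good.homog₂_ofFn F ((M.good_smul g x y).mpr hG)
        rw [hG.grid_smul, vtx_smul, mul_smul] at h2
        rw [hG.homog₂_ofFn, List.map_ofFn, List.map_ofFn]
        exact h2
  · rw [homog₂_of_not_good M h, homog₂_of_not_good M, smul_zero]
    intro h'
    refine h fun a ha b hb => ?_
    rw [← M.meet_smul g]
    exact h' _ (List.mem_map_of_mem ha) _ (List.mem_map_of_mem hb)

theorem homog₂_congr (F : ∀ p q, M.Gam p q → A) {α α' β β' : List G}
    (ha : List.Forall₂ (fun a a' => a⁻¹ * a' ∈ M.G₂) α α')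
    (hb : List.Forall₂ (fun b b' => b⁻¹ * b' ∈ M.G₁) β β') :
    M.homog₂ F α' β' = M.homog₂ F α β := by
  have hla := ha.length_eq
  have hlb := hb.length_eq
  cases hp : α.length with
  | zero =>
    rw [hp] at hla
    rw [List.length_eq_zero_iff.mp hp, List.length_eq_zero_iff.mp hla.symm]; simp
  | succ p =>
    cases hq : β.length with
    | zero =>
      rw [hq] at hlb
      rw [List.length_eq_zero_iff.mp hq, List.length_eq_zero_iff.mp hlb.symm]; simp
    | succ q =>
      obtain ⟨x, rfl⟩ := exists_eq_ofFn hp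
      obtain ⟨y, rfl⟩ := exists_eq_ofFn hq
      obtain ⟨x', rfl⟩ := exists_eq_ofFn (hla.symm.trans hp)
      obtain ⟨y', rfl⟩ := exists_eq_ofFn (hlb.symm.trans hq)
      have hx : ∀ i, (x i)⁻¹ * x' i ∈ M.G₂ := by
        intro i
        have := (List.forall₂_iff_get.mp ha).2 i (by rw [List.length_ofFn]; exact i.isLt)
          (by rw [List.length_ofFn]; exact i.isLt)
        simpa only [List.get_eq_getElem, List.getElem_ofFn, Fin.eta] using this
      have hy : ∀ i, (y i)⁻¹ * y' i ∈ M.G₁ := by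
        intro i
        have := (List.forall₂_iff_get.mp hb).2 i (by rw [List.length_ofFn]; exact i.isLt)
          (by rw [List.length_ofFn]; exact i.isLt)
        simpa only [List.get_eq_getElem, List.getElem_ofFn, Fin.eta] using this
      by_cases h : M.Good x y
      · have h' := h.congr hx hy
        rw [h.homog₂_ofFn, h'.1.homog₂_ofFn, h'.2, ((h 0 0).congr (hx 0) (hy 0)).2]
      · rw [homog₂_of_not_good M fun h' => h ((M.goodLists_ofFn x y).mp h'),
          homog₂_of_not_good M fun h' => h ((good_congr_iff hx hy).mpr ((M.goodLists_ofFn _ _).mp h'))]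

theorem measurableFamily_homog₂ {Ω : Type*} [MeasurableSpace Ω]
    (F : ∀ p q, borelFun (M.Gam p q) A) :
    MeasurableFamily₂ fun _ : Ω => M.homog₂ fun p q => (F p q).1 := by
  classical
  intro us vs hus hvs
  cases ha : us.length with
  | zero =>
    rw [List.length_eq_zero_iff.mp ha]
    simp
  | succ p =>
    cases hb : vs.length with
    | zero =>
      rw [List.length_eq_zero_iff.mp hb]
      simp
    | succ q =>
      obtain ⟨u, rfl⟩ := exists_eq_ofFn ha
      obtain ⟨v, rfl⟩ := exists_eq_ofFn hb
      have hu : ∀ i, Measurable (u i) := fun i => hus _ (List.mem_ofFn.mpr ⟨i, rfl⟩)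
      have hv : ∀ i, Measurable (v i) := fun i => hvs _ (List.mem_ofFn.mpr ⟨i, rfl⟩)
      have e : ∀ ω, M.homog₂ (fun p q => (F p q).1) ((List.ofFn u).map (· ω))
          ((List.ofFn v).map (· ω)) = if M.Good (fun i => u i ω) (fun j => v j ω) then
            M.vtx (u 0 ω) (v 0 ω) • (F p q).1 (M.grid (fun i => u i ω) fun j => v j ω) else 0 := by
        intro ω
        rw [List.map_ofFn, List.map_ofFn]
        split_ifs with h
        · exact Good.homog₂_ofFn (fun p q => (F p q).1) h
        · exact homog₂_of_not_good M fun h' => h ((M.goodLists_ofFn _ _).mp h')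
      simp only [e]
      have hm : Measurable fun ω => ((fun i => u i ω : Fin (p + 1) → G),
          (fun j => v j ω : Fin (q + 1) → G)) :=
        (measurable_pi_lambda _ hu).prodMk (measurable_pi_lambda _ hv)
      refine Measurable.ite (hm M.measurableSet_good) ?_ measurable_const
      exact measurable_smul_apply (M.measurable_vtx.comp ((hu 0).prodMk (hv 0)))
        (Measurable.comp (F p q).2 (M.measurable_grid.comp hm))

/-- The points of `ζ` are appended to rows or columns, or serve as both. A change of representatives
moves only the genuine rows and columns and leaves these points fixed, so the coset invariance of
`Ψ` applies to the concatenated lists. -/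
theorem admissible_ext₀ (F : ∀ p q, borelFun (M.Gam p q) A) {η : List G → A}
    (hη : ∀ (g : G) (l : List G), η (l.map (g * ·)) = g • η l)
    (hη' : ∀ p q, MeasurableFamily fun _ : M.Gam p q => η) :
    M.Admissible (ext₀ (M.homog₂ fun p q => (F p q).1) η) := by
  set Ψ := M.homog₂ fun p q => (F p q).1 with hΨ
  have hs : ∀ (g : G) (α β : List G), Ψ (α.map (g * ·)) (β.map (g * ·)) = g • Ψ α β :=
    M.homog₂_smul _
  have hcongr : ∀ {α α' β β' : List G}, List.Forall₂ (fun a a' => a⁻¹ * a' ∈ M.G₂) α α' →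
      List.Forall₂ (fun b b' => b⁻¹ * b' ∈ M.G₁) β β' → Ψ α' β' = Ψ α β :=
    fun ha hb => M.homog₂_congr _ ha hb
  have hrefl : ∀ (H : Subgroup G) (ζ : List G), List.Forall₂ (fun a a' => a⁻¹ * a' ∈ H) ζ ζ :=
    fun H ζ => List.forall₂_same.mpr fun a _ => by simp
  have happ : ∀ (H : Subgroup G) (α α' ζ : List G), List.Forall₂ (fun a a' => a⁻¹ * a' ∈ H) α α' →
      List.Forall₂ (fun a a' => a⁻¹ * a' ∈ H) (α ++ ζ) (α' ++ ζ) :=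
    fun H α α' ζ h => List.rel_append h (hrefl H ζ)
  have hnil : ∀ {R : G → G → Prop} {α α' : List G}, List.Forall₂ R α α' → (α' = [] ↔ α = []) := by
    intro R α α' h
    rw [← List.length_eq_zero_iff, ← List.length_eq_zero_iff, h.length_eq]
  have h1 : M.Admissible (ext₁ Ψ) := by
    refine ⟨fun β ζ => ?_, fun α ζ => ?_, fun g α β ζ => ?_, fun α α' β β' ζ h1 h2 h3 => ?_,
      fun p q us vs ws h1 h2 h3 => ?_⟩
    · simp [ext₁, hΨ]
    · simp [ext₁]
    · unfold ext₁
      by_cases hb : β = []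
      · simp [hb]
      · rw [if_neg hb, if_neg (by simpa using hb), ← hs, List.map_append]
    · unfold ext₁
      simp only [hnil h2]
      rw [hcongr h1 (happ M.G₁ β β' ζ h2)]
    · unfold ext₁
      cases vs with
      | nil => simp
      | cons v vs =>
        simp only [List.map_cons, List.cons_ne_nil, if_false]
        have := M.measurableFamily_homog₂ (Ω := M.Gam p q) F us (v :: vs ++ ws) h1 (by
          intro u hu
          rcases List.mem_append.mp hu with h | h
          · exact h2 u h
          · exact h3 u h)
        simpa using this
  have h2 : M.Admissible (ext₂ Ψ) := by
    refine ⟨fun β ζ => ?_, fun α ζ => ?_, fun g α β ζ => ?_, fun α α' β β' ζ h1 h2 h3 => ?_,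
      fun p q us vs ws h1 h2 h3 => ?_⟩
    · simp [ext₂]
    · simp [ext₂]
    · have e : aw (twist Ψ (α.map (g * ·))) (ζ.map (g * ·)) = g • aw (twist Ψ α) ζ :=
        aw_map (σ := DistribSMul.toAddMonoidHom A g) (fun α' β' => by
          simp only [twist, List.length_map, ← List.map_append, hs,
            DistribSMul.toAddMonoidHom_apply]
          rw [smul_comm]) ζ
      unfold ext₂
      rw [e]
      simp only [List.length_map, List.map_eq_nil_iff]
      split_ifs
      · simp
      · rw [smul_neg, smul_comm g]
      · simp
    · unfold ext₂
      simp only [hnil h1, h1.length_eq, h2.length_eq]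
      rw [aw_congr (Ψ := twist Ψ α') (Ψ' := twist Ψ α) fun γ δ _ _ _ _ _ => ?_]
      simp only [twist, h1.length_eq]
      rw [hcongr (happ M.G₂ α α' γ h1) (hrefl M.G₁ δ)]
    · unfold ext₂
      simp only [List.length_map, List.map_eq_nil_iff]
      split_ifs
      · exact measurable_const
      · refine Measurable.neg (measurable_zsmul _ ?_)
        refine MeasurableFamily₂.aw (F := fun X : M.Gam p q => twist Ψ (us.map (· X))) ?_ ws h3
        intro us' vs' hu hv
        simp only [twist, List.length_map]
        refine measurable_zsmul _ ?_
        have := M.measurableFamily_homog₂ (Ω := M.Gam p q) F (us ++ us') vs' (by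
          intro u h
          rcases List.mem_append.mp h with h | h
          · exact h1 u h
          · exact hu u h) hv
        simpa using this
      · exact measurable_const
  have h3 : M.Admissible (ext₃ η) := by
    refine ⟨fun β ζ => ?_, fun α ζ => ?_, fun g α β ζ => ?_, fun α α' β β' ζ h1 h2 h3 => ?_,
      fun p q us vs ws h1 h2 h3 => ?_⟩
    · simp [ext₃]
    · simp [ext₃]
    · unfold ext₃
      simp only [List.length_map, hη]
      split_ifs <;> simp
    · unfold ext₃
      rw [h1.length_eq, h2.length_eq]
    · unfold ext₃
      simp only [List.length_map]
      split_ifs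
      · exact hη' p q ws h3
      · exact measurable_const
      · exact measurable_const
  exact (h1.add h2).sub h3

/-! ### The map `I'` is injective on cohomology -/

variable {M}

/-- Evaluate `g` on the vertices of the left column and of the top row of `X`. Equivariance restores
the base vertex, and invariance in the cosets replaces the vertices by the given rows and columns.
-/
theorem Admissible.exists_homog₂_eq {g : List G → List G → List G → A} (hg : M.Admissible g)
    (m : ℕ) : ∃ U : ∀ p q, borelFun (M.Gam p q) A, ∀ α β : List G, M.GoodLists α β →
      α.length + β.length = m + 2 → M.homog₂ (fun p q => (U p q).1) α β = g α β [] := by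
  have hv : ∀ (p q : ℕ) (i : Fin (p + 1)) (j : Fin (q + 1)),
      Measurable fun X : M.Gam p q => X.vertex i j := by
    intro p q i j
    exact ((measurable_partialProd i).comp (measurable_pi_lambda _ fun a =>
      measurable_subtype_coe.comp (Gam.measurable_vert a 0))).mul
      ((measurable_partialProd j).comp (measurable_pi_lambda _ fun b =>
        measurable_subtype_coe.comp (Gam.measurable_horiz i b)))
  refine ⟨fun p q => ⟨fun X => g (List.ofFn fun i => X.vertex i 0) (List.ofFn fun j => X.vertex 0 j)
    [], ?_⟩, fun α β h hl => ?_⟩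
  · have := hg.meas p q (List.ofFn fun i X => X.vertex i 0) (List.ofFn fun j X => X.vertex 0 j) []
      (fun u hu => by obtain ⟨i, rfl⟩ := List.mem_ofFn.mp hu; exact hv p q i 0)
      (fun u hu => by obtain ⟨j, rfl⟩ := List.mem_ofFn.mp hu; exact hv p q 0 j) (by simp)
    simp only [List.map_ofFn] at this
    exact this
  · cases ha : α.length with
    | zero => rw [List.length_eq_zero_iff.mp ha, hg.nil_left]; simp
    | succ p =>
      cases hb : β.length with
      | zero => rw [List.length_eq_zero_iff.mp hb, hg.nil_right]; simp
      | succ q =>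
        obtain ⟨x, rfl⟩ := exists_eq_ofFn ha
        obtain ⟨y, rfl⟩ := exists_eq_ofFn hb
        have hG := (M.goodLists_ofFn x y).mp h
        rw [hG.homog₂_ofFn]
        simp only
        rw [← hg.smul, List.map_ofFn, List.map_ofFn, List.map_nil]
        have e1 : ((M.vtx (x 0) (y 0) * ·) ∘ fun i => (M.grid x y).vertex i 0)
            = fun i => M.vtx (x i) (y 0) := funext fun i => (hG.vtx_eq i 0).symm
        have e2 : ((M.vtx (x 0) (y 0) * ·) ∘ fun j => (M.grid x y).vertex 0 j)
            = fun j => M.vtx (x 0) (y j) := funext fun j => (hG.vtx_eq 0 j).symm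
        rw [e1, e2]
        refine hg.congr _ _ _ _ _ (List.forall₂_iff_get.mpr ⟨by simp, fun i h1 h2 => ?_⟩)
          (List.forall₂_iff_get.mpr ⟨by simp, fun i h1 h2 => ?_⟩) h
        · simpa only [List.get_eq_getElem, List.getElem_ofFn] using
            (hG ⟨i, by rwa [List.length_ofFn] at h1⟩ 0).row
        · simpa only [List.get_eq_getElem, List.getElem_ofFn] using
            M.vtx_col (x 0) (y ⟨i, by rwa [List.length_ofFn] at h1⟩)

variable (M)

theorem exists_eqGeneric_cbd (n : ℕ) (F : ∀ p q, borelFun (M.Gam p q) A)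
    (hF : M.HasDegree n fun p q => (F p q).1)
    (h : M.mapI' A n (M.totClass n F) ∈ coboundaries (lCoboundary G A) n) :
    ∃ η : List G → A, (∀ (g : G) (l : List G), η (l.map (g * ·)) = g • η l) ∧
      (∀ p q, MeasurableFamily fun _ : M.Gam p q => η) ∧ (∀ l, l.length ≠ n → η l = 0) ∧
      η [] = 0 ∧ EqGeneric (aw (M.homog₂ fun p q => (F p q).1)) (cbd η) := by
  rw [mapI'_totClass] at h
  cases n with
  | zero =>
    have h' : borelToL G A 0 (M.borelAw 0 F) = borelToL G A 0 0 := by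
      rw [map_zero]; exact h
    refine ⟨fun _ => 0, by simp, fun p q us _ => measurable_const, by simp, rfl, ?_⟩
    refine (M.eqGeneric_borelAw hF).symm.trans
      ((eqGeneric_homog_iff.mpr (borelClass_eq_iff.mp h')).trans fun N => ?_)
    refine Filter.Eventually.of_forall fun w l _ => ?_
    rw [cbd_const_zero]
    exact homog_zero _ _
  | succ m =>
    obtain ⟨x, hx⟩ := h
    obtain ⟨E, rfl⟩ := borelClass_surjective (haarPow G m) x
    have hx' : borelToL G A (m + 1) (borelCoboundary G A m E)
        = borelToL G A (m + 1) (M.borelAw (m + 1) F) := by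
      rw [← isCochainMap_borelToL, ← hx]; rfl
    refine ⟨homog m E.1, homog_smul _ _, fun p q => measurableFamily_homog E.2,
      fun l hl => homog_of_ne _ hl, homog_of_ne _ (by simp), ?_⟩
    rw [← homog_borelCoboundary]
    exact (M.eqGeneric_borelAw hF).symm.trans
      (eqGeneric_homog_iff.mpr (borelClass_eq_iff.mp hx').symm)

/-- A primitive `η` of the image corrects the extension of the cocycle to three lists, giving the
cocycle `ext₀`. The latter vanishes for long third lists, so `exists_tot_eq` applies; at the empty
third list `ext₀` is the given cocycle. -/
theorem mem_coboundaries_of_mapI' (n : ℕ) (T : M.TotCochain A n) (hT : M.totCoboundary A n T = 0)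
    (h : M.mapI' A n T ∈ coboundaries (lCoboundary G A) n) :
    T ∈ coboundaries (M.totCoboundary A) n := by
  obtain ⟨F, hF, rfl⟩ := M.exists_totClass_eq T
  obtain ⟨η, hη, hηm, hηn, hη0, hηF⟩ := M.exists_eqGeneric_cbd n F hF h
  set Ψ := M.homog₂ fun p q => (F p q).1 with hΨ
  have hΨt : EqGeneric₂ (tot Ψ) fun _ _ => 0 := by
    rw [totCoboundary_totClass, ← totClass_zero] at hT
    have h1 := M.eqGeneric_of_totClass_eq (F := M.borelTot F) (F' := 0)
      (by rw [coe_borelTot]; exact hF.totSum M) (fun p q _ => rfl) hT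
    rw [coe_borelTot] at h1
    refine (eqGeneric_tot_homog₂ _).trans (h1.trans fun N => ?_)
    refine Filter.Eventually.of_forall fun w α β _ _ => ?_
    simp [homog₂]
  have hW := M.admissible_ext₀ F hη hηm
  have hΨ0 : ∀ α, Ψ α [] = 0 := M.homog₂_nil_right _
  have hd : Generic₃ fun α β ζ => del (ext₀ Ψ η) α β ζ = 0 := by
    refine generic₃_of_generic (hΨt.and hηF) fun l α β ζ hl ha hb => ?_
    by_cases ha0 : α = []
    · rw [ha0]; exact hW.del.nil_left _ _
    by_cases hb0 : β = []
    · rw [hb0]; exact hW.del.nil_right _ _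
    have hz : ζ.Sublist l := (List.sublist_append_right α ζ).trans ha
    exact del_ext₀ Ψ η hΨ0 α β ζ ha0 hb0
      (fun α' β' ha' hb' => hl.1 _ _
        (((List.Sublist.refl α).append ha').trans ha) (hb'.trans hz))
      (hl.1 _ _ ((List.sublist_append_left α ζ).trans ha) hb) (hl.2 _ hz)
  -- For degree reasons: with nonempty `α` and `β`, every evaluation of `Ψ` that occurs has total
  -- length at least `n + 3`, while `Ψ` lives in length `n + 2`; and `η` lives in length `n`.
  have hm : Generic₃ fun α β ζ => n + 1 ≤ ζ.length → ext₀ Ψ η α β ζ = 0 := by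
    refine fun _ _ => Filter.Eventually.of_forall fun z α β ζ _ _ _ hl => ?_
    by_cases ha0 : α = []
    · rw [ha0]; exact hW.nil_left _ _
    have ha1 := List.length_pos_iff.mpr ha0
    have h1 : ext₁ Ψ α β ζ = 0 := by
      unfold ext₁
      split_ifs with hb
      · rfl
      · have hb1 := List.length_pos_iff.mpr hb
        exact hF.homog₂_eq_zero M (by rw [List.length_append]; omega)
    have h2 : ext₂ Ψ α β ζ = 0 := by
      have h0 : aw (twist Ψ α) ζ = 0 := by
        rw [aw_congr (Ψ' := fun _ _ => (0 : A)) fun γ δ _ _ hlen _ _ => ?_]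
        · simp [aw_eq_sum]
        · rw [twist, hΨ, hF.homog₂_eq_zero M (by rw [List.length_append]; omega), smul_zero]
      rw [ext₂, h0]
      simp
    have h3 : ext₃ η α β ζ = 0 := by
      unfold ext₃
      rw [hηn _ (by omega)]
      simp
    simp [ext₀, h1, h2, h3]
  obtain ⟨g, hg, hgt⟩ := exists_tot_eq (n + 1) hW hd hm
  have hgt' : Generic fun l => ∀ α β : List G, α.Sublist l → β.Sublist l →
      Ψ α β = tot (fun α β => g α β []) α β := by
    refine hgt.nil.mono fun l hl α β ha hb => ?_
    rw [← hl α β ha hb, ext₀_nil Ψ η hΨ0 hη0]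
  cases n with
  | zero =>
    -- There are no coboundaries in degree zero. Here `tot` of `g` vanishes, as each face of a pair
    -- of singletons has an empty list.
    change _ = (0 : M.TotCochain A 0)
    rw [← totClass_zero]
    refine M.totClass_eq_of_eqGeneric (hgt'.mono fun l hl α β ha hb hlen => ?_)
    rw [← hΨ, hl α β ha hb]
    match α, β, hlen with
    | [], β, _ => simp [tot, hg.nil_left, cbd_const_zero]
    | α, [], _ => simp [tot, hg.nil_right, cbd_const_zero]
    | [a], [b], _ => simp [tot, cbd_cons, hg.nil_left, hg.nil_right, homog₂]
    | a :: a' :: α, b :: β, hlen => simp at hlen; omega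
    | a :: α, b :: b' :: β, hlen => simp at hlen; omega
  | succ m =>
    obtain ⟨U, hU⟩ := hg.exists_homog₂_eq m
    refine ⟨M.totClass m U, ?_⟩
    rw [totCoboundary_totClass]
    refine M.totClass_eq_of_eqGeneric ((hgt'.and M.generic_goodLists_sublist).mono
      fun l hl α β ha hb hlen => ?_)
    have hG := hl.2 α β ha hb
    rw [coe_borelTot, ← hG.tot_homog₂, ← hΨ, hl.1 α β ha hb]
    unfold tot
    rw [cbd_congr fun β' hs h' => hU α β' (hG.sublist (List.Sublist.refl _) hs) (by omega),
      cbd_congr fun α' hs h' => hU α' β (hG.sublist hs (List.Sublist.refl _)) (by omega)]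

end MatchedPair

end

noncomputable section

/-! ### Measurable selection from sets with conull sections -/

section Selection

variable {X : Type*} [MeasurableSpace X]

/-- A subset of `X × ℝ` is inner closed if its sections can be exhausted, up to small measure and
measurably in the parameter, by closed sets. -/
def InnerClosed (μ : Measure ℝ) (E : Set (X × ℝ)) : Prop :=
  ∀ ε : ENNReal, ε ≠ 0 → ∃ K : Set (X × ℝ), MeasurableSet K ∧ K ⊆ E ∧
    (∀ x, IsClosed (Prod.mk x ⁻¹' K)) ∧ ∀ x, μ (Prod.mk x ⁻¹' (E \ K)) ≤ ε

variable {μ : Measure ℝ} [IsFiniteMeasure μ]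

theorem innerClosed_of_fibers {E : Set (X × ℝ)} {s : Set X} {t u : Set ℝ} (hs : MeasurableSet s)
    (ht : MeasurableSet t) (hu : MeasurableSet u)
    (hE : E = s ×ˢ t ∪ sᶜ ×ˢ u) : InnerClosed μ E := by
  intro ε hε
  obtain ⟨K, hKt, hK, hKε⟩ := ht.exists_isClosed_sdiff_lt (measure_ne_top μ t) hε
  obtain ⟨L, hLu, hL, hLε⟩ := hu.exists_isClosed_sdiff_lt (measure_ne_top μ u) hε
  refine ⟨s ×ˢ K ∪ sᶜ ×ˢ L, (hs.prod hK.measurableSet).union (hs.compl.prod hL.measurableSet), ?_,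
    fun x => ?_, fun x => ?_⟩
  · rw [hE]
    exact Set.union_subset_union (Set.prod_mono_right hKt) (Set.prod_mono_right hLu)
  · by_cases hx : x ∈ s
    · convert hK using 1
      ext y; simp [hx]
    · convert hL using 1
      ext y; simp [hx]
  · subst hE
    by_cases hx : x ∈ s
    · refine le_trans (le_of_eq ?_) hKε.le
      congr 1
      ext y; simp [hx]
    · refine le_trans (le_of_eq ?_) hLε.le
      congr 1
      ext y; simp [hx]

theorem innerClosed_iInter {E : ℕ → Set (X × ℝ)} (h : ∀ n, InnerClosed μ (E n)) :
    InnerClosed μ (⋂ n, E n) := by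
  intro ε hε
  obtain ⟨δ, hδ, hsum⟩ := ENNReal.exists_pos_sum_of_countable' hε ℕ
  choose K hKm hKE hKc hKε using fun n => h n (δ n) (hδ n).ne'
  refine ⟨⋂ n, K n, MeasurableSet.iInter hKm, Set.iInter_mono hKE, fun x => ?_, fun x => ?_⟩
  · rw [Set.preimage_iInter]
    exact isClosed_iInter fun n => hKc n x
  · calc μ (Prod.mk x ⁻¹' ((⋂ n, E n) \ ⋂ n, K n))
        ≤ μ (⋃ n, Prod.mk x ⁻¹' (E n \ K n)) := by
          refine measure_mono fun y hy => ?_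
          obtain ⟨h1, h2⟩ := hy
          simp only [Set.mem_iInter, not_forall] at h1 h2
          obtain ⟨n, hn⟩ := h2
          exact Set.mem_iUnion.mpr ⟨n, h1 n, hn⟩
      _ ≤ ∑' n, μ (Prod.mk x ⁻¹' (E n \ K n)) := measure_iUnion_le _
      _ ≤ ∑' n, δ n := ENNReal.tsum_le_tsum fun n => hKε n x
      _ ≤ ε := hsum.le

/-- A countable union of closed sets need not be closed, so it is cut off. In each section the tails
`D n` decrease to the empty set, and `K n` is kept only while the tail has measure at least `ε / 2`.
This condition is measurable in the parameter and leaves finitely many closed sets in each section.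
-/
theorem innerClosed_iUnion {E : ℕ → Set (X × ℝ)} (hm : ∀ n, MeasurableSet (E n))
    (h : ∀ n, InnerClosed μ (E n)) : InnerClosed μ (⋃ n, E n) := by
  intro ε hε
  have hε2 : ε / 2 ≠ 0 := by simpa using hε
  obtain ⟨δ, hδ, hsum⟩ := ENNReal.exists_pos_sum_of_countable' hε2 ℕ
  choose K hKm hKE hKc hKε using fun n => h n (δ n) (hδ n).ne'
  set D : ℕ → Set (X × ℝ) := fun n => (⋃ k, E k) \ ⋃ k < n, E k with hD
  have hDm : ∀ n, MeasurableSet (D n) := fun n =>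
    (MeasurableSet.iUnion hm).diff (MeasurableSet.iUnion fun k => MeasurableSet.iUnion fun _ => hm k)
  have hDanti : ∀ x, Antitone fun n => Prod.mk x ⁻¹' D n := by
    intro x m n hmn y hy
    refine ⟨hy.1, fun h' => hy.2 ?_⟩
    simp only [Set.mem_iUnion] at h' ⊢
    obtain ⟨k, hk, h'⟩ := h'
    exact ⟨k, hk.trans_le hmn, h'⟩
  have hDlim : ∀ x, ∃ n, μ (Prod.mk x ⁻¹' D n) < ε / 2 := by
    intro x
    have ht := tendsto_measure_iInter_atTop (μ := μ)
      (fun n => ((hDm n).preimage measurable_prodMk_left).nullMeasurableSet)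
      (hDanti x) ⟨0, measure_ne_top _ _⟩
    have h0 : (⋂ n, Prod.mk x ⁻¹' D n) = ∅ := by
      rw [Set.eq_empty_iff_forall_notMem]
      intro y hy
      rw [Set.mem_iInter] at hy
      obtain ⟨k, hk⟩ := Set.mem_iUnion.mp (hy 0).1
      refine (hy (k + 1)).2 ?_
      simp only [Set.mem_iUnion]
      exact ⟨k, Nat.lt_succ_self k, hk⟩
    rw [h0, measure_empty] at ht
    exact (ht.eventually_lt_const (pos_iff_ne_zero.mpr hε2)).exists
  refine ⟨⋃ n, Prod.fst ⁻¹' {x | ε / 2 ≤ μ (Prod.mk x ⁻¹' D n)} ∩ K n, ?_, ?_, fun x => ?_,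
    fun x => ?_⟩
  · refine MeasurableSet.iUnion fun n => ((measurableSet_le measurable_const
      (measurable_measure_prodMk_left (hDm n))).preimage measurable_fst).inter (hKm n)
  · exact Set.iUnion_mono fun n => Set.inter_subset_right.trans (hKE n)
  · obtain ⟨N, hN⟩ := hDlim x
    have : Prod.mk x ⁻¹' (⋃ n, Prod.fst ⁻¹' {x | ε / 2 ≤ μ (Prod.mk x ⁻¹' D n)} ∩ K n)
        = ⋃ n ∈ {n | n < N ∧ ε / 2 ≤ μ (Prod.mk x ⁻¹' D n)}, Prod.mk x ⁻¹' K n := by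
      ext y
      simp only [Set.mem_preimage, Set.mem_iUnion, Set.mem_inter_iff, Set.mem_ofPred_eq, exists_prop]
      refine ⟨fun ⟨n, h1, h2⟩ => ⟨n, ⟨?_, h1⟩, h2⟩, fun ⟨n, h1, h2⟩ => ⟨n, h1.2, h2⟩⟩
      by_contra! hn
      exact absurd ((h1.trans (measure_mono (hDanti x hn))).trans_lt hN) (lt_irrefl _)
    rw [this]
    exact Set.Finite.isClosed_biUnion ((Set.finite_lt_nat N).subset fun n hn => hn.1)
      fun n _ => hKc n x
  · classical
    set N := Nat.find (hDlim x) with hN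
    have h1 : μ (Prod.mk x ⁻¹' D N) < ε / 2 := Nat.find_spec (hDlim x)
    have h2 : ∀ n < N, ε / 2 ≤ μ (Prod.mk x ⁻¹' D n) := fun n hn =>
      not_lt.mp (Nat.find_min (hDlim x) hn)
    calc μ (Prod.mk x ⁻¹' ((⋃ n, E n) \ ⋃ n, Prod.fst ⁻¹' {x | ε / 2 ≤ μ (Prod.mk x ⁻¹' D n)} ∩ K n))
        ≤ μ (Prod.mk x ⁻¹' D N ∪ ⋃ n, Prod.mk x ⁻¹' (E n \ K n)) := by
          refine measure_mono fun y hy => ?_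
          by_cases hyD : (x, y) ∈ D N
          · exact Or.inl hyD
          · right
            have h3 : (x, y) ∈ ⋃ k < N, E k := by
              by_contra h3
              exact hyD ⟨hy.1, h3⟩
            simp only [Set.mem_iUnion] at h3
            obtain ⟨k, hk, h3⟩ := h3
            refine Set.mem_iUnion.mpr ⟨k, h3, fun h4 => hy.2 (Set.mem_iUnion.mpr ⟨k, ?_, h4⟩)⟩
            exact h2 k hk
      _ ≤ μ (Prod.mk x ⁻¹' D N) + ∑' n, μ (Prod.mk x ⁻¹' (E n \ K n)) :=
          (measure_union_le _ _).trans (add_le_add le_rfl (measure_iUnion_le _))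
      _ ≤ ε / 2 + ε / 2 := by
          refine add_le_add h1.le ((ENNReal.tsum_le_tsum fun n => hKε n x).trans hsum.le)
      _ = ε := ENNReal.add_halves ε

/-- The property is not visibly stable under complements, so it is carried for a set and its
complement together, from rectangles onwards. -/
theorem MeasurableSet.innerClosed {E : Set (X × ℝ)} (hE : MeasurableSet E) :
    InnerClosed μ E := by
  suffices MeasurableSet E ∧ InnerClosed μ E ∧ InnerClosed μ Eᶜ from this.2.1
  rw [← generateFrom_prod] at hE
  induction hE with
  | basic E hE =>
    obtain ⟨s, hs, t, ht, rfl⟩ := hE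
    refine ⟨hs.prod ht, innerClosed_of_fibers hs ht MeasurableSet.empty (by simp),
      innerClosed_of_fibers hs (MeasurableSet.compl ht) MeasurableSet.univ ?_⟩
    ext ⟨x, y⟩
    by_cases hx : x ∈ s <;> simp [hx]
  | empty =>
    refine ⟨MeasurableSet.empty, innerClosed_of_fibers (s := ∅) (t := ∅) (u := ∅)
      MeasurableSet.empty MeasurableSet.empty MeasurableSet.empty (by simp), ?_⟩
    exact innerClosed_of_fibers (s := Set.univ) (t := Set.univ) (u := ∅)
      MeasurableSet.univ MeasurableSet.univ MeasurableSet.empty (by simp)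
  | compl E _ ih => exact ⟨ih.1.compl, ih.2.2, by rw [compl_compl]; exact ih.2.1⟩
  | iUnion E _ ih =>
    refine ⟨MeasurableSet.iUnion fun n => (ih n).1,
      innerClosed_iUnion (fun n => (ih n).1) fun n => (ih n).2.1, ?_⟩
    rw [Set.compl_iUnion]
    exact innerClosed_iInter fun n => (ih n).2.2

/-- Inside `E` there is a set `L` with closed sections of positive measure, bounded uniformly. The
selected point is the infimum of those `a` for which the section has positive measure in `(-∞, a]`.
Testing rational `a` shows measurability; the point lies in the closed section, since a gap around
it would contradict the infimum. -/
theorem exists_measurable_selection_real (hμ : μ ≠ 0) {E : Set (X × ℝ)} (hE : MeasurableSet E)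
    (h : ∀ x, ∀ᵐ y ∂μ, (x, y) ∈ E) : ∃ c : X → ℝ, Measurable c ∧ ∀ x, (x, c x) ∈ E := by
  obtain ⟨n, hn⟩ : ∃ n : ℕ, μ (Set.Icc (-n : ℝ) n) ≠ 0 := by
    by_contra! h0
    have h1 : μ (⋃ n : ℕ, Set.Icc (-n : ℝ) n) = 0 := measure_iUnion_null h0
    refine hμ (Measure.measure_univ_eq_zero.mp ?_)
    convert h1
    symm
    rw [Set.eq_univ_iff_forall]
    intro y
    obtain ⟨n, hn⟩ := exists_nat_ge |y|
    exact Set.mem_iUnion.mpr ⟨n, abs_le.mp hn⟩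
  have hn2 : μ (Set.Icc (-n : ℝ) n) / 2 ≠ 0 := by simpa using hn
  obtain ⟨K, hKm, hKE, hKc, hKε⟩ := hE.innerClosed (μ := μ) _ hn2
  set L : Set (X × ℝ) := K ∩ Prod.snd ⁻¹' Set.Icc (-n : ℝ) n with hL
  have hLm : MeasurableSet L := hKm.inter (measurableSet_Icc.preimage measurable_snd)
  have hLc : ∀ x, IsClosed (Prod.mk x ⁻¹' L) := fun x => (hKc x).inter isClosed_Icc
  have hLpos : ∀ x, μ (Prod.mk x ⁻¹' L) ≠ 0 := by
    intro x h0
    have h1 : μ (Set.Icc (-n : ℝ) n) ≤ μ (Prod.mk x ⁻¹' L) + μ (Prod.mk x ⁻¹' (E \ K)) := by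
      refine le_trans (measure_mono_ae ?_) (measure_union_le _ _)
      filter_upwards [h x] with y hy hyI
      by_cases hyK : (x, y) ∈ K
      · exact Or.inl ⟨hyK, hyI⟩
      · exact Or.inr ⟨hy, hyK⟩
    rw [h0, zero_add] at h1
    have h2 := h1.trans (hKε x)
    exact absurd (ENNReal.half_lt_self hn (measure_ne_top _ _)) (not_lt.mpr h2)
  set S : X → Set ℝ := fun x => {a | μ (Prod.mk x ⁻¹' L ∩ Set.Iic a) ≠ 0} with hS
  have hSne : ∀ x, (n : ℝ) ∈ S x := by
    intro x
    have : Prod.mk x ⁻¹' L ∩ Set.Iic (n : ℝ) = Prod.mk x ⁻¹' L :=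
      Set.inter_eq_left.mpr fun y hy => hy.2.2
    change μ _ ≠ 0
    rw [this]
    exact hLpos x
  have hSbdd : ∀ x, BddBelow (S x) := by
    refine fun x => ⟨-n, fun a ha => ?_⟩
    by_contra! hlt
    refine ha ?_
    convert measure_empty (μ := μ)
    rw [Set.eq_empty_iff_forall_notMem]
    rintro y ⟨hy, hya⟩
    exact absurd (hy.2.1.trans hya) (not_le.mpr hlt)
  have hSup : ∀ x a b, a ∈ S x → a ≤ b → b ∈ S x := fun x a b ha hab h0 =>
    ha (measure_mono_null (Set.inter_subset_inter_right _ (Set.Iic_subset_Iic.mpr hab)) h0)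
  refine ⟨fun x => sInf (S x), ?_, fun x => hKE ?_⟩
  · refine measurable_of_Iio fun a => ?_
    have : (fun x => sInf (S x)) ⁻¹' Set.Iio a
        = ⋃ q : ℚ, {x | (q : ℝ) < a ∧ μ (Prod.mk x ⁻¹' (L ∩ Prod.snd ⁻¹' Set.Iic (q : ℝ))) ≠ 0} := by
      ext x
      simp only [Set.mem_preimage, Set.mem_Iio, Set.mem_iUnion, Set.mem_ofPred_eq]
      constructor
      · intro hx
        obtain ⟨b, hb, hba⟩ := (csInf_lt_iff (hSbdd x) ⟨_, hSne x⟩).mp hx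
        obtain ⟨q, hq1, hq2⟩ := exists_rat_btwn hba
        exact ⟨q, hq2, hSup x b q hb hq1.le⟩
      · rintro ⟨q, hq, hq'⟩
        exact (csInf_le (hSbdd x) hq').trans_lt hq
    rw [this]
    refine MeasurableSet.iUnion fun q => (MeasurableSet.const _).inter ?_
    exact (measurable_measure_prodMk_left (hLm.inter (measurableSet_Iic.preimage measurable_snd)))
      (measurableSet_singleton 0).compl
  · have hmem : sInf (S x) ∈ Prod.mk x ⁻¹' L := by
      by_contra hnot
      obtain ⟨δ, hδ, hball⟩ := Metric.isOpen_iff.mp (hLc x).isOpen_compl _ hnot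
      obtain ⟨b, hb, hbc⟩ := exists_lt_of_csInf_lt (s := S x) ⟨_, hSne x⟩
        (lt_add_of_pos_right (sInf (S x)) hδ)
      have h1 : sInf (S x) - δ / 2 ∈ S x := by
        intro h0
        refine hb (measure_mono_null ?_ h0)
        rintro y ⟨hy, hyb⟩
        refine ⟨hy, ?_⟩
        by_contra hlt
        rw [Set.mem_Iic, not_le] at hlt
        rw [Set.mem_Iic] at hyb
        refine hball ?_ hy
        rw [Metric.mem_ball, Real.dist_eq, abs_lt]
        constructor <;> linarith
      have := csInf_le (hSbdd x) h1
      linarith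
    exact hmem.1

/-- Embed `Y` into the line as a Borel set and push forward a finite measure with the same null
sets. -/
theorem exists_measurable_selection {Y : Type*} [MeasurableSpace Y] [StandardBorelSpace Y]
    {ν : Measure Y} [SigmaFinite ν] (hν : ν ≠ 0) {E : Set (X × Y)} (hE : MeasurableSet E)
    (h : ∀ x, ∀ᵐ y ∂ν, (x, y) ∈ E) : ∃ c : X → Y, Measurable c ∧ ∀ x, (x, c x) ∈ E := by
  have hf := measurableEmbedding_embeddingReal Y
  set f := embeddingReal Y
  set μ : Measure ℝ := ν.toFinite.map f with hμ
  have hμ0 : μ ≠ 0 := by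
    rw [hμ, Ne, Measure.map_eq_zero_iff hf.measurable.aemeasurable]
    exact fun h0 => hν (by simpa using h0)
  have hF := (MeasurableEmbedding.id : MeasurableEmbedding (id : X → X)).prodMap hf
  obtain ⟨c, hc, hcE⟩ := exists_measurable_selection_real (μ := μ) hμ0
    (hF.measurableSet_image.mpr hE) fun x => by
      rw [hμ, hf.ae_map_iff]
      rw [ae_toFinite]
      filter_upwards [h x] with y hy using ⟨(x, y), hy, rfl⟩
  have hy : ∀ x, ∃ y, f y = c x ∧ (x, y) ∈ E := by
    intro x
    obtain ⟨⟨x', y⟩, hE', he⟩ := hcE x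
    obtain ⟨rfl, hy⟩ := Prod.mk.inj he
    exact ⟨y, hy, hE'⟩
  choose c' hc' hcE' using hy
  refine ⟨c', ?_, hcE'⟩
  rw [← hf.measurable_comp_iff]
  convert hc using 1
  exact funext hc'

end Selection

end

noncomputable section

/-! ### Borel cocycles that vanish almost everywhere -/

section NullCocycles

universe u

variable {G : Type u} [Group G] [TopologicalSpace G] [IsTopologicalGroup G] [LocallyCompactSpace G]
  [T2Space G] [SecondCountableTopology G] [MeasurableSpace G] [BorelSpace G]
  {A : Type*} [AddCommGroup A] [TopologicalSpace A] [IsTopologicalAddGroup A] [PolishSpace A]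
  [MeasurableSpace A] [BorelSpace A] [DistribMulAction G A] [ContinuousSMul G A]

/-- The function `Φ` vanishes on almost all extensions of a list by `m` entries in front. -/
def VanishAE (Φ : List G → A) : ℕ → List G → Prop
  | 0, t => Φ t = 0
  | m + 1, t => ∀ᵐ c ∂(Measure.haar : Measure G), VanishAE Φ m (c :: t)

theorem vanishAE_map {Φ : List G → A} (hΦ : ∀ (g : G) (l : List G), Φ (l.map (g * ·)) = g • Φ l)
    (g : G) (m : ℕ) {t : List G} (h : VanishAE Φ m t) : VanishAE Φ m (t.map (g * ·)) := by
  induction m generalizing t with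
  | zero => rw [VanishAE] at *; rw [hΦ, h, smul_zero]
  | succ m ih =>
    rw [VanishAE] at *
    have h1 := (measurePreserving_mul_left (Measure.haar : Measure G) g⁻¹).quasiMeasurePreserving.ae h
    filter_upwards [h1] with c hc
    simpa using ih hc

theorem vanishAE_map_iff {Φ : List G → A}
    (hΦ : ∀ (g : G) (l : List G), Φ (l.map (g * ·)) = g • Φ l) (g : G) (m : ℕ) {t : List G} :
    VanishAE Φ m (t.map (g * ·)) ↔ VanishAE Φ m t := by
  refine ⟨fun h => ?_, vanishAE_map hΦ g m⟩
  have := vanishAE_map hΦ g⁻¹ m h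
  simpa [Function.comp_def] using this

/-- Each step adjoins a variable from `G` to the parameter space and measures the sections. The
induction therefore has to allow all parameter spaces in the universe of `G`. -/
theorem measurableSet_vanishAE {Φ : List G → A} {Ω : Type u} [MeasurableSpace Ω]
    (hΦ : ∀ (Ω : Type u) [MeasurableSpace Ω], MeasurableFamily fun _ : Ω => Φ) (m : ℕ)
    {us : List (Ω → G)} (hus : ∀ u ∈ us, Measurable u) :
    MeasurableSet {ω | VanishAE Φ m (us.map (· ω))} := by
  induction m generalizing Ω with
  | zero => exact hΦ Ω us hus (measurableSet_singleton 0)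
  | succ m ih =>
    have h1 := ih (Ω := Ω × G) (us := Prod.snd :: us.map (· ∘ Prod.fst)) (by
      intro u hu
      rcases List.mem_cons.mp hu with rfl | hu
      · exact measurable_snd
      · obtain ⟨v, hv, rfl⟩ := List.mem_map.mp hu
        exact (hus v hv).comp measurable_fst)
    exact (measurable_measure_prodMk_left h1.compl (ν := (Measure.haar : Measure G)))
      (measurableSet_singleton 0) |>.congr (by
        ext ω
        simp only [VanishAE, Set.mem_ofPred_eq, ae_iff, List.map_cons, List.map_map]
        rfl)

variable {n : ℕ} {Φ : List G → A}

theorem ae_vanishAE (h : ∀ᵐ w ∂(haarPow G n), Φ (List.ofFn w) = 0) (k m : ℕ) (hk : k + m = n) :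
    ∀ᵐ w ∂(haarPow G k), VanishAE Φ m (List.ofFn w) := by
  induction m generalizing k with
  | zero => obtain rfl : k = n := by omega
            exact h
  | succ m ih =>
    have h1 := (measurePreserving_cons (Measure.haar : Measure G) k).quasiMeasurePreserving.ae
      (ih (k + 1) (by omega))
    have h2 := Measure.ae_ae_of_ae_prod (Measure.measurePreserving_swap.quasiMeasurePreserving.ae h1)
    filter_upwards [h2] with w hw
    rw [VanishAE]
    filter_upwards [hw] with c hc
    simpa [List.ofFn_succ] using hc

/-- An entry of a list, or a cone point over a list of length less than `k` of its entries. -/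
def ConeEntry (c : List G → G) (k : ℕ) (l : List G) (z : G) : Prop :=
  z ∈ l ∨ ∃ l' : List G, l' ≠ [] ∧ l'.length < k ∧ (∀ y ∈ l', y ∈ l) ∧ z = c l'

/-- The cone points `c`, on lists of length at most `N`, preserve the property `P` of lists. -/
structure ConePoints (P : List G → Prop) (N : ℕ) (c : List G → G) : Prop where
  meas : ∀ (Ω : Type u) [MeasurableSpace Ω] (us : List (Ω → G)), (∀ u ∈ us, Measurable u) →
    Measurable fun ω => c (us.map (· ω))
  map : ∀ (g : G) (l : List G), l ≠ [] → c (l.map (g * ·)) = g * c l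
  cons : ∀ l : List G, l ≠ [] → l.length ≤ N → ∀ t : List G,
    (∀ z ∈ t, ConeEntry c l.length l z) → P t → P (c l :: t)

theorem exists_map_eq_map {X Y Z : Type*} {f : X → Z} {g : Y → Z} {t : List X}
    (h : ∀ z ∈ t, ∃ k, f z = g k) : ∃ s : List Y, t.map f = s.map g := by
  induction t with
  | nil => exact ⟨[], rfl⟩
  | cons a t ih =>
    obtain ⟨s, hs⟩ := ih fun z hz => h z (List.mem_cons_of_mem _ hz)
    obtain ⟨k, hk⟩ := h a List.mem_cons_self
    exact ⟨k :: s, by simp [hs, hk]⟩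

theorem measurable_headD {Ω : Type*} [MeasurableSpace Ω] {us : List (Ω → G)}
    (hus : ∀ u ∈ us, Measurable u) : Measurable fun ω => (us.map (· ω)).headD 1 := by
  cases us with
  | nil => exact measurable_const
  | cons u us => exact hus u (by simp)

/-- Cone points are chosen by induction on the length of the list, each generic with respect to the
entries and to all cone points over shorter lists of these entries. The sections of good choices are
conull, so the choice can be made Borel for every list, not just for almost every one. -/
theorem exists_conePoints {P : List G → Prop}
    (hP : ∀ {Ω : Type u} [MeasurableSpace Ω] (us : List (Ω → G)), (∀ u ∈ us, Measurable u) →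
      MeasurableSet {ω | P (us.map (· ω))})
    (hmap : ∀ (g : G) (t : List G), P (t.map (g * ·)) ↔ P t)
    (hcons : ∀ t, P t → ∀ᵐ y ∂(Measure.haar : Measure G), P (y :: t)) (N : ℕ) :
    ∃ c, ConePoints P N c := by
  classical
  induction N with
  | zero =>
    refine ⟨fun l => l.headD 1, fun Ω _ us hus => measurable_headD hus, fun g l hl => ?_,
      fun l hl hl' => absurd (List.length_eq_zero_iff.mp (Nat.le_zero.mp hl')) hl⟩
    cases l with
    | nil => exact absurd rfl hl
    | cons a l => rfl
  | succ N ih =>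
    obtain ⟨c, hc⟩ := ih
    have := standardBorelSpace_group G
    set X := Fin (N + 1) → G
    let ent : (Fin (N + 1) ⊕ List (Fin (N + 1))) → X → G :=
      Sum.elim (fun i x => x i) fun L x => c (L.map x)
    have hent : ∀ k, Measurable (ent k) := by
      rintro (i | L)
      · exact measurable_pi_apply i
      · have := hc.meas X (L.map fun i x => x i) (by
          intro u hu
          obtain ⟨i, _, rfl⟩ := List.mem_map.mp hu
          exact measurable_pi_apply i)
        simpa [ent, Function.comp_def] using this
    -- Countably many conditions, indexed by the lists formed from entries of `x` and previous cone
    -- points; each holds for almost every second coordinate.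
    let E : Set (X × G) := ⋂ s : List (Fin (N + 1) ⊕ List (Fin (N + 1))),
      {p | P (s.map fun k => ent k p.1) → P (p.2 :: s.map fun k => ent k p.1)}
    have hE : MeasurableSet E := by
      refine MeasurableSet.iInter fun s => ?_
      have h1 := hP (Ω := X × G) (s.map fun k p => ent k p.1) (by
        intro u hu
        obtain ⟨k, _, rfl⟩ := List.mem_map.mp hu
        exact (hent k).comp measurable_fst)
      have h2 := hP (Ω := X × G) (Prod.snd :: s.map fun k p => ent k p.1) (by
        intro u hu
        rcases List.mem_cons.mp hu with rfl | hu
        · exact measurable_snd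
        obtain ⟨k, _, rfl⟩ := List.mem_map.mp hu
        exact (hent k).comp measurable_fst)
      simp only [List.map_cons, List.map_map, Function.comp_def] at h1 h2
      exact h1.imp h2
    obtain ⟨sel, hsel, hselE⟩ := exists_measurable_selection
      (ν := (Measure.haar : Measure G)) (NeZero.ne _) hE fun x => by
        simp only [E, Set.mem_iInter, ae_all_iff]
        intro s
        by_cases hs : P (s.map fun k => ent k x)
        · filter_upwards [hcons _ hs] with y hy _ using hy
        · exact Filter.Eventually.of_forall fun y h => absurd h hs
    -- The selection is made for the translate whose first entry is the unit and is then translated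
    -- back. This makes the new cone points equivariant.
    let c' : List G → G := fun l => if l.length = N + 1 then
      l.headD 1 * sel (fun i => (l.headD 1)⁻¹ * l.getD i 1) else c l
    have hc' : ∀ l, l.length ≠ N + 1 → c' l = c l := fun l hl => if_neg hl
    have hc'' : ∀ x : X, c' (List.ofFn x) = x 0 * sel fun i => (x 0)⁻¹ * x i := by
      intro x
      simp only [c', headD_ofFn, getD_ofFn]
      rw [if_pos (List.length_ofFn)]
    refine ⟨c', fun Ω _ us hus => ?_, fun g l hl => ?_, fun l hl hlN t ht hPt => ?_⟩
    · by_cases h : us.length = N + 1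
      · simp only [c', List.length_map, h, if_true]
        refine (measurable_headD hus).mul (hsel.comp (measurable_pi_lambda _ fun i =>
          (measurable_headD hus).inv.mul ?_))
        have hi : (i : ℕ) < us.length := by rw [h]; exact i.isLt
        have e : ∀ ω, (us.map (· ω)).getD i 1 = us[(i : ℕ)] ω := by
          intro ω
          rw [List.getD_eq_getElem _ _ (by simpa using hi), List.getElem_map]
        simp only [e]
        exact hus _ (List.getElem_mem hi)
      · simp only [c', List.length_map, h, if_false]
        exact hc.meas Ω us hus
    · by_cases h : l.length = N + 1
      · obtain ⟨x, rfl⟩ := exists_eq_ofFn h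
        have e : (List.ofFn x).map (g * ·) = List.ofFn fun i => g * x i := by
          rw [List.map_ofFn]; rfl
        rw [e, hc'', hc'', mul_assoc]
        simp only [mul_inv_rev, mul_assoc, inv_mul_cancel_left]
      · rw [hc' _ h, hc' _ (by simpa using h), hc.map g l hl]
    · by_cases h : l.length = N + 1
      · obtain ⟨x, rfl⟩ := exists_eq_ofFn h
        obtain ⟨s, hs⟩ : ∃ s : List (Fin (N + 1) ⊕ List (Fin (N + 1))), t.map ((x 0)⁻¹ * ·)
            = s.map fun k => ent k fun i => (x 0)⁻¹ * x i := by
          refine exists_map_eq_map fun z hz => ?_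
          rcases ht z hz with hzl | ⟨l', hl0, hl1, hl2, rfl⟩
          · obtain ⟨i, rfl⟩ := List.mem_ofFn.mp hzl
            exact ⟨Sum.inl i, rfl⟩
          · obtain ⟨L, hL⟩ := exists_map_eq_map (f := id) (g := x) (t := l') fun y hy => by
              obtain ⟨i, hi⟩ := List.mem_ofFn.mp (hl2 y hy)
              exact ⟨i, hi.symm⟩
            rw [List.map_id] at hL
            refine ⟨Sum.inr L, ?_⟩
            rw [hc' _ (by omega), ← hc.map _ _ hl0, hL, List.map_map]
            rfl
        have h1 := Set.mem_iInter.mp (hselE fun i => (x 0)⁻¹ * x i) s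
        have h2 := h1 (by rw [← hs]; exact (hmap _ _).mpr hPt)
        rw [← hmap (x 0)⁻¹, hc'', List.map_cons, inv_mul_cancel_left, hs]
        exact h2
      · rw [hc' _ h]
        refine hc.cons l hl (by omega) t (fun z hz => ?_) hPt
        rcases ht z hz with hzl | ⟨l', hl0, hl1, hl2, rfl⟩
        · exact Or.inl hzl
        · exact Or.inr ⟨l', hl0, hl1, hl2, hc' _ (by omega)⟩

variable {P : List G → Prop} {N : ℕ} {c : List G → G}

theorem ConeEntry.mono {k k' : ℕ} {l l' : List G} {z : G} (h : ConeEntry c k l z)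
    (hk : k ≤ k') (hl : l ⊆ l') : ConeEntry c k' l' z := by
  rcases h with h | ⟨s, h0, h1, h2, rfl⟩
  · exact Or.inl (hl h)
  · exact Or.inr ⟨s, h0, h1.trans_le hk, fun y hy => hl (h2 y hy), rfl⟩

/-- Cone entries over the face `l'` are cone entries over `l` of smaller level, so `c l` may be put
in front of them without leaving `P`. Hence freezing `c l` in `Φ` preserves the hypothesis when
passing to a face. -/
theorem ConePoints.restrict (hc : ConePoints P N c) {l l' : List G} (hl0 : l ≠ [])
    (hlN : l.length ≤ N) (hl : l'.Sublist l) (hl' : l'.length + 1 = l.length) {Φ : List G → A}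
    (hΦ : ∀ t, (∀ z ∈ t, ConeEntry c (l.length + 1) l z) → P t → Φ t = 0) (t : List G)
    (ht : ∀ z ∈ t, ConeEntry c (l'.length + 1) l' z) (hPt : P t) : Φ (c l :: t) = 0 := by
  have h1 : ∀ z ∈ t, ConeEntry c l.length l z := fun z hz =>
    (ht z hz).mono hl'.le hl.subset
  refine hΦ _ (fun z hz => ?_) (hc.cons l hl0 hlN t h1 hPt)
  rcases List.mem_cons.mp hz with rfl | hz
  · exact Or.inr ⟨l, hl0, Nat.lt_succ_self _, fun _ h => h, rfl⟩
  · exact (h1 z hz).mono (Nat.le_succ _) (List.Subset.refl _)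

/-- All lists that occur consist of cone points over successive faces, ending in a single entry.
Singletons always satisfy `P`, so the vanishing holds for every `l`. -/
theorem ConePoints.subdiv_eq_zero (hc : ConePoints P N c) (h1 : ∀ x, P [x]) (m : ℕ)
    {Φ : List G → A} (l : List G) (hl : l.length = m + 1) (hlN : l.length ≤ N)
    (hΦ : ∀ t, (∀ z ∈ t, ConeEntry c (l.length + 1) l z) → P t → Φ t = 0) :
    subdiv (fun Φ => Φ) c (m + 1) Φ l = 0 := by
  induction m generalizing Φ l with
  | zero =>
    obtain ⟨x, rfl⟩ := List.length_eq_one_iff.mp hl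
    exact hΦ [x] (fun z hz => Or.inl hz) (h1 x)
  | succ m ih =>
    have hl0 : l ≠ [] := List.ne_nil_of_length_eq_add_one hl
    rw [subdiv]
    refine cbd_eq_zero fun l' hs hl' => ih l' (by omega) (by omega) ?_
    exact hc.restrict hl0 hlN hs hl' hΦ

/-- Here the cone points are followed by a whole face of `l` with at least two entries, so that
sublists of `l` have to satisfy `P`. This is why the primitive vanishes only almost everywhere. -/
theorem ConePoints.cone_eq_zero (hc : ConePoints P N c) (m : ℕ)
    {Φ : List G → A} (l : List G) (hl : l.length = m) (hlN : l.length ≤ N)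
    (hP : ∀ l' : List G, l'.Sublist l → P l')
    (hΦ : ∀ t, (∀ z ∈ t, ConeEntry c (l.length + 1) l z) → P t → Φ t = 0) :
    cone (fun Φ => Φ) c m Φ l = 0 := by
  induction m generalizing Φ l with
  | zero => rfl
  | succ m ih =>
    cases m with
    | zero => rfl
    | succ m =>
      have hl0 : l ≠ [] := List.ne_nil_of_length_eq_add_one hl
      rw [cone, cbd_eq_zero fun l' hs hl' => ih l' (by omega) (by omega)
        (fun l'' h => hP l'' (h.trans hs)) (hc.restrict hl0 hlN hs hl' hΦ), sub_zero]
      refine hΦ _ (fun z hz => ?_) (hc.cons l hl0 hlN l (fun z hz => Or.inl hz)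
        (hP l (List.Sublist.refl l)))
      rcases List.mem_cons.mp hz with rfl | hz
      · exact Or.inr ⟨l, hl0, Nat.lt_succ_self _, fun _ h => h, rfl⟩
      · exact Or.inl hz

/-- The cone homotopy for the identity makes the cocycle cohomologous to its subdivision, which
vanishes everywhere for generic cone points. The cone is the primitive, and it vanishes on generic
lists. -/
theorem exists_borelCoboundary_eq (m : ℕ) (F : BorelCochain G A (m + 1))
    (hF : borelCoboundary G A (m + 1) F = 0) (hF0 : borelToL G A (m + 1) F = 0) :
    ∃ K : BorelCochain G A m, borelToL G A m K = 0 ∧ borelCoboundary G A m K = F := by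
  set Φ := homog (m + 1) F.1 with hΦ
  have hΦs : ∀ (g : G) (l : List G), Φ (l.map (g * ·)) = g • Φ l := homog_smul _ _
  have hΦm : ∀ (Ω : Type u) [MeasurableSpace Ω], MeasurableFamily fun _ : Ω => Φ :=
    fun Ω _ => measurableFamily_homog F.2
  have hgen : EqGeneric Φ fun _ => 0 := by
    have h : borelToL G A (m + 1) F = borelToL G A (m + 1) 0 := by rw [hF0, map_zero]
    refine (eqGeneric_homog_iff.mpr (borelClass_eq_iff.mp h)).trans fun N => ?_
    exact Filter.Eventually.of_forall fun w l _ => homog_zero _ _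
  have hae : ∀ᵐ w ∂(haarPow G (m + 2)), Φ (List.ofFn w) = 0 :=
    (hgen (m + 2)).mono fun w hw => hw _ (List.Sublist.refl _)
  -- A short list is good if `Φ` vanishes on almost all its extensions to length `m + 2`. On longer
  -- lists the truncated subtraction gives zero, and they are good because `Φ` vanishes there.
  let P : List G → Prop := fun t => VanishAE Φ (m + 2 - t.length) t
  have hPΦ : ∀ t, P t → Φ t = 0 := by
    intro t ht
    by_cases hl : t.length = m + 2
    · have : VanishAE Φ (m + 2 - t.length) t := ht
      rwa [hl, Nat.sub_self] at this
    · exact homog_of_ne _ hl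
  have hPgen : ∀ k ≤ m + 2, ∀ᵐ w ∂(haarPow G k), P (List.ofFn w) := by
    intro k hk
    filter_upwards [ae_vanishAE hae k (m + 2 - k) (by omega)] with w hw
    simpa only [P, List.length_ofFn] using hw
  have hPmap : ∀ (g : G) (t : List G), P (t.map (g * ·)) ↔ P t := by
    intro g t
    simp only [P, List.length_map]
    exact vanishAE_map_iff hΦs g _
  have hPcons : ∀ t, P t → ∀ᵐ y ∂(Measure.haar : Measure G), P (y :: t) := by
    intro t ht
    by_cases hl : t.length < m + 2
    · have h : VanishAE Φ (m + 2 - t.length) t := ht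
      rw [show m + 2 - t.length = (m + 2 - (t.length + 1)) + 1 by omega, VanishAE] at h
      exact h
    · refine Filter.Eventually.of_forall fun y => ?_
      change VanishAE Φ (m + 2 - (t.length + 1)) (y :: t)
      rw [show m + 2 - (t.length + 1) = 0 by omega, VanishAE]
      exact homog_of_ne _ (by simp; omega)
  -- Almost every singleton is good, goodness is invariant under translation, and `G` acts
  -- transitively on singletons.
  have hP1 : ∀ x, P [x] := by
    have : (ae (haarPow G 1)).NeBot := by
      unfold haarPow; infer_instance
    obtain ⟨w, hw⟩ := (hPgen 1 (by omega)).exists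
    intro x
    have := (hPmap (x * (w 0)⁻¹) _).mpr hw
    simpa using this
  obtain ⟨c, hc⟩ := exists_conePoints (P := P)
    (fun us hus => by simpa only [P, List.length_map] using measurableSet_vanishAE hΦm _ hus)
    hPmap hPcons (m + 2)
  obtain ⟨K, hK⟩ := exists_homog_eq (n := m) (K := cone (fun Φ => Φ) c (m + 1) Φ)
    (measurable_cone (fun _ h => h) (hc.meas _) _ (hΦm _))
    (fun g l hl => cone_map (σ := DistribSMul.toAddMonoidHom A g) (fun _ _ h => h) (hc.map g) _
      (hΦs g) l hl)
  have hΦc : ∀ l : List G, ∀ t, (∀ z ∈ t, ConeEntry c (l.length + 1) l z) → P t → Φ t = 0 :=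
    fun _ t _ ht => hPΦ t ht
  refine ⟨K, ?_, Subtype.ext (homog_injective fun l => ?_)⟩
  · rw [← map_zero (borelToL G A m)]
    have hPg : Generic fun l => l.length ≤ m + 2 → P l := by
      intro k
      by_cases hk : k ≤ m + 2
      · exact (hPgen k hk).mono fun w hw _ => hw
      · exact Filter.Eventually.of_forall fun w hw => absurd (by simpa using hw) hk
    refine borelClass_eq_iff.mpr (eqGeneric_homog_iff.mp (hPg.sublist.mono fun l hl l' hs => ?_))
    refine Eq.trans ?_ (homog_zero m l').symm
    by_cases hl' : l'.length = m + 1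
    · rw [hK l' hl']
      exact hc.cone_eq_zero _ l' hl' (by omega)
        (fun l'' h => hl l'' (h.trans hs) (h.length_le.trans (by omega))) (hΦc l')
    · exact homog_of_ne _ hl'
  · rw [homog_borelCoboundary]
    by_cases hl : l.length = m + 2
    · have h0 : cbd Φ = fun _ => (0 : A) - 0 := by
        rw [hΦ, ← homog_borelCoboundary, hF]
        funext l
        rw [sub_zero]
        exact homog_zero _ l
      have hsub : ∀ (Φ Ψ : List G → A) (l : List G),
          (fun Φ : List G → A => Φ) (fun l => Φ l - Ψ l) l = Φ l - Ψ l := fun _ _ _ => rfl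
      have h1 := cone_cbd (e := fun Φ => Φ) (c := c) hsub (fun _ _ => rfl) (m + 1) Φ l hl
      rw [h0, cone_sub hsub, sub_self, zero_add,
        hc.subdiv_eq_zero hP1 (m + 1) l hl hl.le (hΦc l), sub_zero] at h1
      rw [cbd_congr fun l' _ h => hK l' (by omega), h1]
    · rw [homog_of_ne _ hl, cbd_eq_zero fun l' _ h => homog_of_ne _ (by omega)]

end NullCocycles

end

noncomputable section

/-! ### Maps of cochain complexes that are bijective on cohomology -/

section BijectiveOnCohomology

variable {K : ℕ → Type*} [∀ n, AddCommGroup (K n)] {K' : ℕ → Type*} [∀ n, AddCommGroup (K' n)]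
  {d : ∀ n, K n →+ K (n + 1)} {d' : ∀ n, K' n →+ K' (n + 1)} {f : ∀ n, K n →+ K' n}

theorem cohomologyClass_eq_iff {n : ℕ} {z w : cocycles d n} :
    cohomologyClass d n z = cohomologyClass d n w ↔ (w : K n) - z ∈ coboundaries d n := by
  unfold cohomologyClass
  rw [QuotientAddGroup.eq, AddSubgroup.mem_addSubgroupOf, neg_add_eq_sub]
  rfl

theorem cohomologyClass_surjective (d : ∀ n, K n →+ K (n + 1)) (n : ℕ) :
    Function.Surjective (cohomologyClass d n) := QuotientAddGroup.mk_surjective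

theorem IsCochainMap.mem_cocycles (hf : IsCochainMap d d' f) {n : ℕ} {z : K n}
    (hz : z ∈ cocycles d n) : f n z ∈ cocycles d' n := by
  have h : d n z = 0 := hz
  change d' n (f n z) = 0
  rw [hf, h, map_zero]

theorem IsCochainMap.mem_coboundaries (hf : IsCochainMap d d' f) {n : ℕ} {z : K n}
    (hz : z ∈ coboundaries d n) : f n z ∈ coboundaries d' n := by
  cases n with
  | zero =>
    have h : z = 0 := hz
    rw [h, map_zero]
    exact zero_mem _
  | succ n =>
    obtain ⟨y, rfl⟩ := hz
    exact ⟨f n y, hf n y⟩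

theorem IsCochainMap.exists_isInducedBy (hf : IsCochainMap d d' f)
    (hinj : ∀ n z, d n z = 0 → f n z ∈ coboundaries d' n → z ∈ coboundaries d n)
    (hsurj : ∀ n w, d' n w = 0 → ∃ z, d n z = 0 ∧ w - f n z ∈ coboundaries d' n) :
    ∃ Φ : ∀ n, Cohomology d n ≃+ Cohomology d' n, IsInducedBy d d' f Φ := by
  let fz : ∀ n, cocycles d n →+ cocycles d' n := fun n =>
    ((f n).comp (cocycles d n).subtype).codRestrict _ fun z => hf.mem_cocycles z.2
  let g : ∀ n, Cohomology d n →+ Cohomology d' n := fun n =>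
    QuotientAddGroup.map _ _ (fz n) fun z hz => hf.mem_coboundaries hz
  have hg : ∀ n z, g n (cohomologyClass d n z) = cohomologyClass d' n (fz n z) := fun n z => rfl
  have hbij : ∀ n, Function.Bijective (g n) := by
    refine fun n => ⟨?_, fun y => ?_⟩
    · rw [injective_iff_map_eq_zero]
      intro x hx
      obtain ⟨z, rfl⟩ := cohomologyClass_surjective d n x
      have h0 : cohomologyClass d n 0 = 0 := rfl
      have h0' : cohomologyClass d' n 0 = 0 := rfl
      rw [hg, ← h0', eq_comm, cohomologyClass_eq_iff] at hx
      rw [← h0, eq_comm, cohomologyClass_eq_iff]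
      simp only [ZeroMemClass.coe_zero, sub_zero] at hx ⊢
      exact hinj n z z.2 hx
    · obtain ⟨w, rfl⟩ := cohomologyClass_surjective d' n y
      obtain ⟨z, hz, hw⟩ := hsurj n w w.2
      refine ⟨cohomologyClass d n ⟨z, hz⟩, ?_⟩
      rw [hg, cohomologyClass_eq_iff]
      exact hw
  refine ⟨fun n => AddEquiv.ofBijective (g n) (hbij n), fun n z => ⟨hf.mem_cocycles z.2, ?_⟩⟩
  exact hg n z

/-- Two out of three: the isomorphism induced by the first factor is that of the composite followed
by the inverse of that of the second. -/
theorem IsCochainMap.exists_isInducedBy_comp {K'' : ℕ → Type*} [∀ n, AddCommGroup (K'' n)]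
    {d'' : ∀ n, K'' n →+ K'' (n + 1)} {f' : ∀ n, K' n →+ K'' n} {j : ∀ n, K n →+ K'' n}
    (hf : IsCochainMap d d' f) {J : ∀ n, Cohomology d n ≃+ Cohomology d'' n}
    (hJ : IsInducedBy d d'' j J) {Ψ : ∀ n, Cohomology d' n ≃+ Cohomology d'' n}
    (hΨ : IsInducedBy d' d'' f' Ψ)
    (h : ∀ n z, d n z = 0 → j n z - f' n (f n z) ∈ coboundaries d'' n) :
    ∃ Φ : ∀ n, Cohomology d n ≃+ Cohomology d' n,
      IsInducedBy d d' f Φ ∧ ∀ n x, Ψ n (Φ n x) = J n x := by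
  refine ⟨fun n => (J n).trans (Ψ n).symm, fun n z => ?_, fun n x => by simp⟩
  have hz := hf.mem_cocycles z.2
  refine ⟨hz, ?_⟩
  obtain ⟨h1, hJz⟩ := hJ n z
  obtain ⟨h2, hΨz⟩ := hΨ n ⟨_, hz⟩
  rw [AddEquiv.trans_apply, AddEquiv.symm_apply_eq, hJz, hΨz, eq_comm, cohomologyClass_eq_iff]
  exact h n z z.2

end BijectiveOnCohomology

/-! ### The map `j` on cohomology -/

section BorelToL

variable {G : Type*} [Group G] [TopologicalSpace G] [IsTopologicalGroup G] [LocallyCompactSpace G]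
  [T2Space G] [SecondCountableTopology G] [MeasurableSpace G] [BorelSpace G]
  {A : Type*} [AddCommGroup A] [TopologicalSpace A] [IsTopologicalAddGroup A] [PolishSpace A]
  [MeasurableSpace A] [BorelSpace A] [DistribMulAction G A] [ContinuousSMul G A]

theorem borelToL_zero_injective : Function.Injective (borelToL G A 0) := by
  intro F F' h
  have h1 : F.1 =ᵐ[haarPow G 0] F'.1 := borelClass_eq_iff.mp h
  have : (ae (haarPow G 0)).NeBot := by
    unfold haarPow; infer_instance
  obtain ⟨w, hw⟩ := h1.exists
  refine Subtype.ext (funext fun x => ?_)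
  rw [Subsingleton.elim x w]
  exact hw

/-- Subtracting the coboundary of a Borel representative of the primitive leaves a Borel cocycle
that vanishes almost everywhere, to which `exists_borelCoboundary_eq` applies. -/
theorem borelToL_mem_coboundaries (n : ℕ) (F : BorelCochain G A n)
    (hF : borelCoboundary G A n F = 0) (h : borelToL G A n F ∈ coboundaries (lCoboundary G A) n) :
    F ∈ coboundaries (borelCoboundary G A) n := by
  cases n with
  | zero =>
    change F = 0
    exact borelToL_zero_injective (by rw [map_zero]; exact h)
  | succ m =>
    obtain ⟨x, hx⟩ := h
    obtain ⟨E, rfl⟩ := borelClass_surjective (haarPow G m) x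
    have hx' : borelToL G A (m + 1) (F - borelCoboundary G A m E) = 0 := by
      rw [map_sub, ← isCochainMap_borelToL, ← hx]
      exact sub_self _
    obtain ⟨K, -, hK⟩ := exists_borelCoboundary_eq m _
      (by rw [map_sub, hF, isCochainComplex_borelCoboundary, sub_zero]) hx'
    refine ⟨K + E, ?_⟩
    rw [map_add, hK, sub_add_cancel]

theorem exists_borelToL_eq (n : ℕ) (x : LCochain G A n) (hx : lCoboundary G A n x = 0) :
    ∃ F : BorelCochain G A n, borelCoboundary G A n F = 0 ∧ borelToL G A n F = x := by
  obtain ⟨E, rfl⟩ := borelClass_surjective (haarPow G n) x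
  have h : borelToL G A (n + 1) (borelCoboundary G A n E) = 0 := by
    rw [← isCochainMap_borelToL]; exact hx
  obtain ⟨K, hK0, hK⟩ := exists_borelCoboundary_eq n _ (isCochainComplex_borelCoboundary n E) h
  refine ⟨E - K, by rw [map_sub, hK, sub_self], ?_⟩
  rw [map_sub, hK0, sub_zero]
  rfl

end BorelToL

/-! ### Assembling the isomorphisms -/

namespace MatchedPair

variable {G : Type*} [Group G] [TopologicalSpace G] [IsTopologicalGroup G] [LocallyCompactSpace G]
  [T2Space G] [SecondCountableTopology G] [MeasurableSpace G] [BorelSpace G]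
  (A : Type*) [AddCommGroup A] [TopologicalSpace A] [IsTopologicalAddGroup A] [PolishSpace A]
  [MeasurableSpace A] [BorelSpace A] [DistribMulAction G A] [ContinuousSMul G A]
  (M : MatchedPair G)

/-- Each class in `L` comes from a Borel cocycle, and `I` maps that cocycle to a preimage under `I'`
up to a coboundary. This is the surjectivity of `I'`; with its injectivity, the statement on `I`
follows by two out of three. -/
theorem exists_cohomologyEquiv :
    ∃ (J : ∀ n, Cohomology (borelCoboundary G A) n ≃+ Cohomology (lCoboundary G A) n)
      (Φ : ∀ n, Cohomology (borelCoboundary G A) n ≃+ Cohomology (M.totCoboundary A) n)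
      (Ψ : ∀ n, Cohomology (M.totCoboundary A) n ≃+ Cohomology (lCoboundary G A) n),
      IsInducedBy (borelCoboundary G A) (lCoboundary G A) (borelToL G A) J ∧
      IsInducedBy (borelCoboundary G A) (M.totCoboundary A) (M.mapI A) Φ ∧
      IsInducedBy (M.totCoboundary A) (lCoboundary G A) (M.mapI' A) Ψ ∧
      ∀ n x, Ψ n (Φ n x) = J n x := by
  obtain ⟨J, hJ⟩ := IsCochainMap.exists_isInducedBy (isCochainMap_borelToL (G := G) (A := A))
    borelToL_mem_coboundaries fun n w hw => by
      obtain ⟨F, hF, hFw⟩ := exists_borelToL_eq n w hw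
      exact ⟨F, hF, by rw [hFw, sub_self]; exact zero_mem _⟩
  obtain ⟨Ψ, hΨ⟩ := IsCochainMap.exists_isInducedBy (M.isCochainMap_mapI' (A := A))
    M.mem_coboundaries_of_mapI' fun n w hw => by
      obtain ⟨F, hF, hFw⟩ := exists_borelToL_eq n w hw
      refine ⟨M.mapI A n F, by rw [M.isCochainMap_mapI, hF, map_zero], ?_⟩
      rw [← hFw]
      exact M.mapI'_mapI_sub_mem n F hF
  obtain ⟨Φ, hΦ, h⟩ := (M.isCochainMap_mapI (A := A)).exists_isInducedBy_comp hJ hΨ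
    M.mapI'_mapI_sub_mem
  exact ⟨J, Φ, Ψ, hJ, hΦ, hΨ, h⟩

end MatchedPair

end

theorem mainTheorem3
    {G : Type*} [Group G] [TopologicalSpace G] [IsTopologicalGroup G] [LocallyCompactSpace G]
    [T2Space G] [SecondCountableTopology G] [MeasurableSpace G] [BorelSpace G]
    {A : Type*} [AddCommGroup A] [TopologicalSpace A] [IsTopologicalAddGroup A] [PolishSpace A]
    [MeasurableSpace A] [BorelSpace A] [DistribMulAction G A] [ContinuousSMul G A]
    (M : MatchedPair G) :
    -- all maps between the underlying measure spaces are nonsingular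
    (∀ (n : ℕ) (i : Fin (n + 2)),
      Measure.QuasiMeasurePreserving (barFace i) (haarPow G (n + 1)) (haarPow G n)) ∧
    (∀ (p q : ℕ) (k : Fin (q + 2)),
      Measure.QuasiMeasurePreserving (M.hFace p q k) (M.measure p (q + 1)) (M.measure p q)) ∧
    (∀ (p q : ℕ) (k : Fin (p + 2)),
      Measure.QuasiMeasurePreserving (M.vFace p q k) (M.measure (p + 1) q) (M.measure p q)) ∧
    (∀ (n p q : ℕ) (h : p + q = n),
      Measure.QuasiMeasurePreserving (M.corner n p q h) (M.measure n n) (M.measure p q)) ∧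
    -- `(x₁, …, xₙ) ↦ X(x₁, …, xₙ)` is an isomorphism of measure classes from `Gⁿ` to `Γ_nn`
    (∀ n : ℕ, (∀ᵐ x ∂(haarPow G n), ∃! X : M.Gam n n, M.diag n X = x) ∧
      Measure.QuasiMeasurePreserving (M.ofDiag n) (haarPow G n) (M.measure n n) ∧
      Measure.QuasiMeasurePreserving (M.diag n) (M.measure n n) (haarPow G n)) ∧
    -- the three cochain complexes
    IsCochainComplex (borelCoboundary G A) ∧
    IsCochainComplex (lCoboundary G A) ∧
    IsCochainComplex (M.totCoboundary A) ∧
    -- the three cochain transformations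
    IsCochainMap (borelCoboundary G A) (lCoboundary G A) (borelToL G A) ∧
    IsCochainMap (borelCoboundary G A) (M.totCoboundary A) (M.mapI A) ∧
    IsCochainMap (M.totCoboundary A) (lCoboundary G A) (M.mapI' A) ∧
    -- they induce isomorphisms on cohomology, those of `I` and `I'` being mutually inverse
    ∃ (J : ∀ n, Cohomology (borelCoboundary G A) n ≃+ Cohomology (lCoboundary G A) n)
      (Φ : ∀ n, Cohomology (borelCoboundary G A) n ≃+ Cohomology (M.totCoboundary A) n)
      (Ψ : ∀ n, Cohomology (M.totCoboundary A) n ≃+ Cohomology (lCoboundary G A) n),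
      IsInducedBy (borelCoboundary G A) (lCoboundary G A) (borelToL G A) J ∧
      IsInducedBy (borelCoboundary G A) (M.totCoboundary A) (M.mapI A) Φ ∧
      IsInducedBy (M.totCoboundary A) (lCoboundary G A) (M.mapI' A) Ψ ∧
      ∀ n x, Ψ n (Φ n x) = J n x := by
  refine ⟨fun n i => quasiMeasurePreserving_barFace n i, M.quasiMeasurePreserving_hFace,
    M.quasiMeasurePreserving_vFace, M.quasiMeasurePreserving_corner,
    fun n => ⟨M.ae_existsUnique_diag n, M.quasiMeasurePreserving_ofDiag n,
      M.quasiMeasurePreserving_diag n⟩, isCochainComplex_borelCoboundary,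
    isCochainComplex_lCoboundary, M.isCochainComplex_totCoboundary, isCochainMap_borelToL,
    M.isCochainMap_mapI, M.isCochainMap_mapI', M.exists_cohomologyEquiv A⟩
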